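/- Let $I$ be a finite set and let $(i\cdot j)_{i,j\in I}$ be an irreducible Cartan datum of finite type: a symmetric positive definite integer matrix such that $i\cdot i/2\in\{1,2,3,\dots\}$ for all $i$, $i\cdot i/2=1$ for some $i$, $2\frac{i\cdot j}{i\cdot i}\in\{0,-1,-2,\dots\}$ for all $i\ne j$, and $I$ is nonempty and is not the disjoint union of two nonempty mutually orthogonal subsets. Put $Y=\mathbf Z[I]$, $X=\mathrm{Hom}(Y,\mathbf Z)$ with the evaluation pairing $\langle\ ,\ \rangle:Y\times X\to\mathbf Z$; define $j'\in X$ by $\langle i,j'\rangle=2\frac{i\cdot j}{i\cdot i}$. In $\mathbf Q(v)$ put $v_i=v^{i\cdot i/2}$, $[n]_i=\frac{v_i^n-v_i^{-n}}{v_i-v_i^{-1}}$, $[n]_i^!=\prod_{s=1}^n[s]_i$. Let $\mathbf U$ be the associative unital $\mathbf Q(v)$-algebra with generators $E_i,F_i$ $(i\in I)$, $K_y$ $(y\in Y)$ and relations $K_0=1$, $K_yK_{y'}=K_{y+y'}$, $K_iE_j=v^{\langle i,j'\rangle}E_jK_i$, $K_iF_j=v^{-\langle i,j'\rangle}F_jK_i$,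 $E_iF_j-F_jE_i=\delta_{ij}\frac{K_i^{i\cdot i/2}-K_i^{-i\cdot i/2}}{v_i-v_i^{-1}}$, and, for $i\ne j$, $$\sum_{p+p'=1-\langle i,j'\rangle}(-1)^{p'}\frac{[p+p']_i^!}{[p]_i^![p']_i^!}E_i^pE_jE_i^{p'}=0,\qquad \sum_{p+p'=1-\langle i,j'\rangle}(-1)^{p'}\frac{[p+p']_i^!}{[p]_i^![p']_i^!}F_i^pF_jF_i^{p'}=0 .$$ Put $E_i^{(s)}=([s]_i^!)^{-1}E_i^s$ and $F_i^{(s)}=([s]_i^!)^{-1}F_i^s$. Let $R\subset X$ be the smallest subset that contains all $i'$ and is stable under the reflections $\lambda\mapsto\lambda-\langle i,\lambda\rangle i'$. For $i\in I$, $\alpha\in R$ let $p_{i,\alpha}$ (resp. $q_{i,\alpha}$) be the largest integer $n\ge 0$ such that $\alpha+mi'\in R$ (resp. $\alpha-mi'\in R$) for all $0\le m\le n$. There is a unique positive root $\alpha_0$ of maximal height (the height of $\sum_i n_ii'$, $n_i\in\mathbf N$, being $\sum_i n_i$). Let $\Lambda=\Lambda_{\alpha_0}$ be the $\mathbf U$-module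 $$\Lambda=\mathbf U\Big/\Big(\sum_i\mathbf UE_i+\sum_{y\in Y}\mathbf U\,(K_y-v^{\langle y,\alpha_0\rangle})+\sum_i\mathbf UF_i^{\langle i,\alpha_0\rangle+1}\Big),$$ let $\eta$ be the image of $1$, and let $\Lambda^\mu=\{x\in\Lambda: K_yx=v^{\langle y,\mu\rangle}x\ \ \forall y\in Y\}$ for $\mu\in X$. Then $\Lambda$ has a unique $\mathbf Q(v)$-basis $\{X_\alpha;\alpha\in R\}\sqcup\{t_i;i\in I\}$ such that $X_{\alpha_0}=\eta$, $X_\alpha\in\Lambda^\alpha$ for $\alpha\in R$, $t_i\in\Lambda^0$ for $i\in I$, and for all $i,j\in I$, $\alpha\in R$: * $E_iX_\alpha=[q_{i,\alpha}+1]_iX_{\alpha+i'}$ if $p_{i,\alpha}>0$; $E_iX_{-i'}=t_i$; $E_iX_\alpha=0$ if $p_{i,\alpha}=0$, $\alpha\ne-i'$; $E_it_j=[|\langle j,i'\rangle|]_jX_{i'}$; * $F_iX_\alpha=[p_{i,\alpha}+1]_iX_{\alpha-i'}$ if $q_{i,\alpha}>0$; $F_iX_{i'}=t_i$; $F_iX_\alpha=0$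 if $q_{i,\alpha}=0$, $\alpha\ne i'$; $F_it_j=[|\langle j,i'\rangle|]_jX_{-i'}$. In this basis, for all $i,j\in I$ and all integers $k\ge1$, the divided powers act as follows: $$E_i^{(k)}X_\alpha=\frac{[q_{i,\alpha}+k]_i^!}{[q_{i,\alpha}]_i^![k]_i^!}X_{\alpha+ki'}\ \text{ if }\alpha\in R,\ \alpha\ne-i',\ k\le p_{i,\alpha};\qquad E_i^{(k)}X_\alpha=0\ \text{ if }\alpha\in R,\ \alpha\ne-i',\ k>p_{i,\alpha};$$ $$E_iX_{-i'}=t_i,\quad E_i^{(2)}X_{-i'}=X_{i'},\quad E_i^{(k)}X_{-i'}=0\ \text{ if }k\ge3;\qquad E_it_j=[|\langle j,i'\rangle|]_jX_{i'},\quad E_i^{(k)}t_j=0\ \text{ if }k\ge2;$$ $$F_i^{(k)}X_\alpha=\frac{[p_{i,\alpha}+k]_i^!}{[p_{i,\alpha}]_i^![k]_i^!}X_{\alpha-ki'}\ \text{ if }\alpha\in R,\ \alpha\ne i',\ k\le q_{i,\alpha};\qquad F_i^{(k)}X_\alpha=0\ \text{ if }\alpha\in R,\ \alpha\ne i',\ k>q_{i,\alpha};$$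 $$F_iX_{i'}=t_i,\quad F_i^{(2)}X_{i'}=X_{-i'},\quad F_i^{(k)}X_{i'}=0\ \text{ if }k\ge3;\qquad F_it_j=[|\langle j,i'\rangle|]_jX_{-i'},\quad F_i^{(k)}t_j=0\ \text{ if }k\ge2.$$ In particular, with respect to this basis every $E_i^{(k)}$ and every $F_i^{(k)}$ acts through a matrix with all entries in $\mathbf N[v,v^{-1}]$. -/

import Mathlib

noncomputable section

namespace QuantumAdjoint

/-- The ground field `ℚ(v)`. -/
abbrev Kv : Type := RatFunc ℚ

/-- The indeterminate `v`. -/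
def vv : Kv := RatFunc.X

/-- The quantum integer `[n] = (u ^ n - u ^ (-n)) / (u - u⁻¹)` with parameter `u`. -/
def qint (u : Kv) (n : ℤ) : Kv := (u ^ n - u ^ (-n)) / (u - u⁻¹)

/-- The quantum factorial `[n]! = [1] [2] ⋯ [n]` with parameter `u`. -/
def qfact (u : Kv) (n : ℕ) : Kv := ∏ s ∈ Finset.range n, qint u ((s : ℤ) + 1)

/-- The quantum binomial `[a + k]! / ([a]! [k]!)` with parameter `u`. -/
def qbinom (u : Kv) (a k : ℕ) : Kv := qfact u (a + k) / (qfact u a * qfact u k)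

/-- `ℕ[v, v⁻¹]` as a subsemiring of `ℚ(v)`. -/
def natLaurent : Subsemiring Kv := Subsemiring.closure {vv, vv⁻¹}

/-- A Cartan datum of finite type on the finite set `I`, normalized so that the smallest value
of `i · i / 2` is attained and equal to `1`.  The form on `ℤ[I]` is given by its Gram matrix
`(i · j)`. -/
structure CartanDatum (I : Type*) [Fintype I] [DecidableEq I] where
  /-- The integers `i · j`. -/
  form : Matrix I I ℤ
  symm : ∀ i j, form i j = form j i
  posDef : (form.map (Int.cast : ℤ → ℝ)).PosDef
  even : ∀ i, ∃ d : ℕ, 0 < d ∧ form i i = 2 * (d : ℤ)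
  exists_short : ∃ i, form i i = 2
  off_diag : ∀ i j, i ≠ j → ∃ n : ℕ, 2 * form i j = -(n : ℤ) * form i i

namespace CartanDatum

/-- The symbols `E_i`, `F_i` (`i ∈ I`) and `K_y` (`y ∈ Y`). -/
inductive Gen (I : Type*) : Type _
  | E (i : I)
  | F (i : I)
  | K (y : I → ℤ)

/-- The free `ℚ(v)`-algebra on the symbols `E_i`, `F_i`, `K_y`. -/
abbrev Free (I : Type*) : Type _ := FreeAlgebra Kv (Gen I)

/-- The generator `E_i` of the free algebra. -/
def gE {I : Type*} (i : I) : Free I := FreeAlgebra.ι Kv (Gen.E i)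

/-- The generator `F_i` of the free algebra. -/
def gF {I : Type*} (i : I) : Free I := FreeAlgebra.ι Kv (Gen.F i)

/-- The generator `K_y` of the free algebra. -/
def gK {I : Type*} (y : I → ℤ) : Free I := FreeAlgebra.ι Kv (Gen.K y)

variable {I : Type*} [Fintype I] [DecidableEq I] (D : CartanDatum I)

/-- A Cartan datum is irreducible if `I` is not empty and is not the disjoint union of two
nonempty mutually orthogonal subsets. -/
def IsIrreducible : Prop :=
  Nonempty I ∧ ∀ S : Set I, S.Nonempty → Sᶜ.Nonempty → ∃ i ∈ S, ∃ j ∈ Sᶜ, D.form i j ≠ 0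

/-- The positive integer `i · i / 2`. -/
def d (i : I) : ℕ := (D.form i i / 2).toNat

/-- The integer `⟨i, j'⟩ = 2 (i · j) / (i · i)` (the division is exact). -/
def cartan (i j : I) : ℤ := 2 * D.form i j / D.form i i

/-- `v_i = v ^ (i · i / 2)`. -/
def vi (i : I) : Kv := vv ^ D.d i

/-! ### Weights and roots -/

/-- The weight lattice `X = Hom(Y, ℤ)`, where `Y = ℤ[I]` is written as `I → ℤ`. -/
abbrev Wt (_D : CartanDatum I) : Type _ := Module.Dual ℤ (I → ℤ)

/-- The integer `⟨i, lam⟩`. -/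
def pairing (i : I) (lam : D.Wt) : ℤ := lam (Pi.single i 1)

/-- The simple root `j' ∈ X`, with `⟨i, j'⟩ = 2 (i · j) / (i · i)`. -/
def simpleRoot (j : I) : D.Wt := ∑ i, D.cartan i j • LinearMap.proj i

/-- The simple reflection `s_i : lam ↦ lam - ⟨i, lam⟩ i'`. -/
def reflect (i : I) (lam : D.Wt) : D.Wt := lam - D.pairing i lam • D.simpleRoot i

/-- Membership in `R`, the smallest subset of `X` that contains the simple roots and is stable
under the simple reflections, that is, under the Weyl group which they generate. -/
inductive IsRoot : D.Wt → Prop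
  | simple (i : I) : IsRoot (D.simpleRoot i)
  | reflect (i : I) {α : D.Wt} (h : IsRoot α) : IsRoot (D.reflect i α)

/-- The set `R` of roots. -/
def R : Set D.Wt := {α | D.IsRoot α}

/-- `p_{i,α}`: the largest `p ≥ 0` with `α, α + i', …, α + p i' ∈ R`. -/
def p (i : I) (α : D.Wt) : ℕ := sSup {n : ℕ | ∀ m ≤ n, α + m • D.simpleRoot i ∈ D.R}

/-- `q_{i,α}`: the largest `q ≥ 0` with `α, α - i', …, α - q i' ∈ R`. -/
def q (i : I) (α : D.Wt) : ℕ := sSup {n : ℕ | ∀ m ≤ n, α - m • D.simpleRoot i ∈ D.R}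

/-- `α` is a positive root, `α = ∑ n_i i'` with `n_i ∈ ℕ`, and its height `∑ n_i` is maximal
among the heights of the positive roots. -/
def IsHighestRoot (α : D.Wt) : Prop :=
  α ∈ D.R ∧ ∃ n : I → ℕ, α = ∑ i, n i • D.simpleRoot i ∧
    ∀ m : I → ℕ, ∑ i, m i • D.simpleRoot i ∈ D.R → ∑ i, m i ≤ ∑ i, n i

theorem cartan_self (i : I) : D.cartan i i = 2 := by
  obtain ⟨d, hd, h⟩ := D.even i
  have : D.form i i ≠ 0 := by omega
  exact Int.mul_ediv_cancel _ this

theorem pairing_simpleRoot (i j : I) : D.pairing i (D.simpleRoot j) = D.cartan i j := by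
  simp [pairing, simpleRoot, Pi.single_apply]

theorem simpleRoot_mem (i : I) : D.simpleRoot i ∈ D.R := IsRoot.simple i

theorem neg_simpleRoot_mem (i : I) : -D.simpleRoot i ∈ D.R := by
  have h : D.IsRoot (D.reflect i (D.simpleRoot i)) := IsRoot.reflect i (IsRoot.simple i)
  rw [reflect, pairing_simpleRoot, cartan_self] at h
  have e : D.simpleRoot i - (2 : ℤ) • D.simpleRoot i = -D.simpleRoot i := by
    rw [two_smul]; abel
  rw [e] at h
  exact h

theorem sSup_mem_of_zero_mem {s : Set ℕ} (h : 0 ∈ s) : sSup s ∈ s := by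
  by_cases hb : BddAbove s
  · exact Nat.sSup_mem ⟨0, h⟩ hb
  · rw [Nat.sSup_of_not_bddAbove hb]; exact h

theorem add_mem {i : I} {α : D.Wt} (hα : α ∈ D.R) {k : ℕ} (hk : k ≤ D.p i α) :
    α + k • D.simpleRoot i ∈ D.R :=
  sSup_mem_of_zero_mem (s := {n : ℕ | ∀ m ≤ n, α + m • D.simpleRoot i ∈ D.R})
    (by simpa using hα) k hk

theorem sub_mem {i : I} {α : D.Wt} (hα : α ∈ D.R) {k : ℕ} (hk : k ≤ D.q i α) :
    α - k • D.simpleRoot i ∈ D.R :=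
  sSup_mem_of_zero_mem (s := {n : ℕ | ∀ m ≤ n, α - m • D.simpleRoot i ∈ D.R})
    (by simpa using hα) k hk

/-- The root `i'`, as an element of `R`. -/
def posRt (i : I) : D.R := ⟨D.simpleRoot i, D.simpleRoot_mem i⟩

/-- The root `-i'`, as an element of `R`. -/
def negRt (i : I) : D.R := ⟨-D.simpleRoot i, D.neg_simpleRoot_mem i⟩

/-- The root `α + k i'`, as an element of `R`, for `k ≤ p_{i,α}`. -/
def up (i : I) (α : D.R) (k : ℕ) (hk : k ≤ D.p i α) : D.R :=
  ⟨α.1 + k • D.simpleRoot i, D.add_mem α.2 hk⟩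

/-- The root `α - k i'`, as an element of `R`, for `k ≤ q_{i,α}`. -/
def down (i : I) (α : D.R) (k : ℕ) (hk : k ≤ D.q i α) : D.R :=
  ⟨α.1 - k • D.simpleRoot i, D.sub_mem α.2 hk⟩

/-! ### The quantized enveloping algebra -/

/-- The quantum Serre expression in `x = x_i` and `z = x_j`:
`∑_{a + b = 1 - ⟨i, j'⟩} (-1) ^ b ([a + b]_i! / ([a]_i! [b]_i!)) x ^ a z x ^ b`. -/
def serre (i j : I) (x z : Free I) : Free I :=
  ∑ ab ∈ Finset.HasAntidiagonal.antidiagonal (1 - D.cartan i j).toNat,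
    ((-1) ^ ab.2 * qbinom (D.vi i) ab.1 ab.2) • (x ^ ab.1 * z * x ^ ab.2)

/-- The defining relations of the quantized enveloping algebra. -/
inductive Rel : Free I → Free I → Prop
  | K_zero : Rel (gK 0) 1
  | K_add (y y' : I → ℤ) : Rel (gK y * gK y') (gK (y + y'))
  | K_E (i j : I) :
      Rel (gK (Pi.single i 1) * gE j) (vv ^ D.cartan i j • (gE j * gK (Pi.single i 1)))
  | K_F (i j : I) :
      Rel (gK (Pi.single i 1) * gF j) (vv ^ (-D.cartan i j) • (gF j * gK (Pi.single i 1)))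
  | E_F_self (i : I) :
      Rel (gE i * gF i - gF i * gE i)
        ((D.vi i - (D.vi i)⁻¹)⁻¹ •
          (gK (Pi.single i (D.d i : ℤ)) - gK (Pi.single i (-(D.d i : ℤ)))))
  | E_F_ne (i j : I) (h : i ≠ j) : Rel (gE i * gF j - gF j * gE i) 0
  | serre_E (i j : I) (h : i ≠ j) : Rel (D.serre i j (gE i) (gE j)) 0
  | serre_F (i j : I) (h : i ≠ j) : Rel (D.serre i j (gF i) (gF j)) 0

/-- The quantized enveloping algebra over `ℚ(v)`. -/
def U : Type _ := RingQuot D.Rel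

instance : Ring D.U := inferInstanceAs (Ring (RingQuot D.Rel))

instance : Algebra Kv D.U := inferInstanceAs (Algebra Kv (RingQuot D.Rel))

/-- The quotient map from the free algebra. -/
def toU : Free I →ₐ[Kv] D.U := RingQuot.mkAlgHom Kv D.Rel

/-- The generator `E_i`. -/
def E (i : I) : D.U := D.toU (gE i)

/-- The generator `F_i`. -/
def F (i : I) : D.U := D.toU (gF i)

/-- The generator `K_y`. -/
def K (y : I → ℤ) : D.U := D.toU (gK y)

/-- The divided power `E_i^{(s)} = ([s]_i!)⁻¹ E_i ^ s`. -/
def divE (i : I) (s : ℕ) : D.U := (qfact (D.vi i) s)⁻¹ • D.E i ^ s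

/-- The divided power `F_i^{(s)} = ([s]_i!)⁻¹ F_i ^ s`. -/
def divF (i : I) (s : ℕ) : D.U := (qfact (D.vi i) s)⁻¹ • D.F i ^ s

/-! ### The module `Λ_lam` -/

/-- The left ideal of `U` generated by the `E_i`, the `K_y - v ^ ⟨y, lam⟩` and the
`F_i ^ (⟨i, lam⟩ + 1)`. -/
def leftIdeal (lam : D.Wt) : Submodule D.U D.U :=
  Submodule.span D.U
    (Set.range D.E ∪
      Set.range (fun y : I → ℤ => D.K y - algebraMap Kv D.U (vv ^ lam y)) ∪
      Set.range (fun i : I => D.F i ^ ((D.pairing i lam).toNat + 1)))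

/-- For a dominant weight `lam`, the `U`-module `Λ_lam`: the quotient of the Verma module of
highest weight `lam` by the submodule generated by the images of the `F_i ^ (⟨i, lam⟩ + 1)`. -/
def Lam (lam : D.Wt) : Type _ := D.U ⧸ D.leftIdeal lam

instance (lam : D.Wt) : AddCommGroup (D.Lam lam) :=
  inferInstanceAs (AddCommGroup (D.U ⧸ D.leftIdeal lam))

instance (lam : D.Wt) : Module D.U (D.Lam lam) :=
  inferInstanceAs (Module D.U (D.U ⧸ D.leftIdeal lam))

instance (lam : D.Wt) : Module Kv (D.Lam lam) :=
  inferInstanceAs (Module Kv (D.U ⧸ D.leftIdeal lam))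

instance (lam : D.Wt) : IsScalarTower Kv D.U (D.Lam lam) :=
  inferInstanceAs (IsScalarTower Kv D.U (D.U ⧸ D.leftIdeal lam))

/-- The canonical generator `η` of `Λ_lam`, the image of `1 ∈ U`. -/
def eta (lam : D.Wt) : D.Lam lam := (D.leftIdeal lam).mkQ 1

/-- The weight space `Λ^μ = {x | K_y x = v ^ ⟨y, μ⟩ x for all y ∈ Y}`, as a set. -/
def weightSpace (lam μ : D.Wt) : Set (D.Lam lam) :=
  {x | ∀ y : I → ℤ, D.K y • x = vv ^ μ y • x}

/-- The conditions that characterize the standard basis `{X_α} ⊔ {t_i}` of the quantum adjoint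
representation `Λ = Λ_{α₀}`; here `X_α = b (Sum.inl α)` and `t_i = b (Sum.inr i)`. -/
structure IsStandardBasis (α₀ : D.Wt) (b : Module.Basis (D.R ⊕ I) Kv (D.Lam α₀)) : Prop where
  highest : ∀ h : α₀ ∈ D.R, b (.inl ⟨α₀, h⟩) = D.eta α₀
  weight_X : ∀ α : D.R, b (.inl α) ∈ D.weightSpace α₀ α
  weight_t : ∀ i : I, b (.inr i) ∈ D.weightSpace α₀ 0
  E_X : ∀ (i : I) (α : D.R) (h : 1 ≤ D.p i α),
    D.E i • b (.inl α) = qint (D.vi i) (D.q i α + 1) • b (.inl (D.up i α 1 h))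
  E_X_neg : ∀ i : I, D.E i • b (.inl (D.negRt i)) = b (.inr i)
  E_X_zero : ∀ (i : I) (α : D.R), D.p i α = 0 → α ≠ D.negRt i → D.E i • b (.inl α) = 0
  E_t : ∀ i j : I,
    D.E i • b (.inr j) = qint (D.vi j) |D.cartan j i| • b (.inl (D.posRt i))
  F_X : ∀ (i : I) (α : D.R) (h : 1 ≤ D.q i α),
    D.F i • b (.inl α) = qint (D.vi i) (D.p i α + 1) • b (.inl (D.down i α 1 h))
  F_X_pos : ∀ i : I, D.F i • b (.inl (D.posRt i)) = b (.inr i)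
  F_X_zero : ∀ (i : I) (α : D.R), D.q i α = 0 → α ≠ D.posRt i → D.F i • b (.inl α) = 0
  F_t : ∀ i j : I,
    D.F i • b (.inr j) = qint (D.vi j) |D.cartan j i| • b (.inl (D.negRt i))

end CartanDatum

end QuantumAdjoint

end

/-! The required formulas define operators on the vector space `M` with basis `R ⊔ I`. The theorem
follows once `M` is shown to be a `U`-module and `Λ` is shown to be no larger than `M`.

`M` is a module. On a root vector the relation between `E_i` and `F_i` is the identity `[p+1][q] -
[q+1][p] = [q-p]`, because root strings are unbroken and `q - p = ⟨i, α⟩`. For `i ≠ j`, commutation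
of `E_i` and `F_j` compares the two paths around a square of roots `x`, `x + i'`, `x + j'`, `x + i'
+ j'`. `IsRt.add_eps_of_square` shows that both paths exist together, and `IsRt.square` that the
quantum integers on them agree, factor by factor or crosswise. The Serre relations are not checked
on vectors: by `serre_of_nilpotent` they follow from the other relations and the nilpotency of the
`E_i` and `F_i`.

`Λ` is no larger. The Serre relations make every `F_i` locally nilpotent on `Λ`, so the theory of
quantum `sl₂` embeds a weight space with `⟨i, x⟩ < 0` into the weight space of the reflected, higher
weight. Descending from the highest weight, every weight is a root or zero, and a root weight space
is at most a line, since a dominant root is covered by at most one root (`IsRt.eq_of_add_eps`). The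
zero weight space is spanned by the images under `F_i` of the lines of weight `i'`. Hence `dim Λ ≤
|R| + |I|`. The universal property of `Λ` gives a map to `M`; it is onto, because the `F_i` generate
`M` from the highest root vector, and therefore bijective.

The same descent from the highest root gives uniqueness of the basis. Iterating `E_i` and `F_i`
along strings gives quantum binomials, whose positivity comes from the `q`-Pascal rule.

The facts on roots are derived directly from the positive definite form and induction over simple
reflections, with the highest root characterized as the only root covered neither by a root nor by
zero. -/

noncomputable section

namespace QuantumAdjoint

/-! ### Quantum integers -/

/-- `u` is not a root of unity (and not zero). -/
def IsGeneric (u : Kv) : Prop := u ≠ 0 ∧ ∀ n : ℤ, n ≠ 0 → u ^ n ≠ 1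

theorem vv_ne_zero : vv ≠ 0 := RatFunc.X_ne_zero

theorem vv_pow_ne_one {n : ℕ} (hn : n ≠ 0) : vv ^ n ≠ 1 := by
  intro h
  have h2 : algebraMap (Polynomial ℚ) Kv (Polynomial.X ^ n) = algebraMap (Polynomial ℚ) Kv 1 := by
    rw [map_pow, RatFunc.algebraMap_X, map_one]; exact h
  have h3 := RatFunc.algebraMap_injective ℚ h2
  have h4 := congrArg Polynomial.natDegree h3
  simp at h4
  exact hn h4

theorem isGeneric_vv : IsGeneric vv := by
  refine ⟨vv_ne_zero, fun n hn h => ?_⟩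
  obtain ⟨m, rfl | rfl⟩ := n.eq_nat_or_neg
  · rw [zpow_natCast] at h
    exact vv_pow_ne_one (by simpa using hn) h
  · rw [zpow_neg, zpow_natCast, inv_eq_one] at h
    exact vv_pow_ne_one (by simpa using hn) h

theorem IsGeneric.pow {u : Kv} (hu : IsGeneric u) {k : ℕ} (hk : 0 < k) : IsGeneric (u ^ k) := by
  refine ⟨pow_ne_zero _ hu.1, fun n hn => ?_⟩
  rw [← zpow_natCast, ← zpow_mul]
  exact hu.2 _ (mul_ne_zero (by omega) hn)

theorem IsGeneric.sub_inv_ne_zero {u : Kv} (hu : IsGeneric u) : u - u⁻¹ ≠ 0 := by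
  intro h
  have h1 : u = u⁻¹ := sub_eq_zero.1 h
  apply hu.2 2 (by norm_num)
  rw [zpow_ofNat, pow_two]
  nth_rewrite 2 [h1]
  exact mul_inv_cancel₀ hu.1

theorem qint_zero (u : Kv) : qint u 0 = 0 := by simp [qint]

theorem IsGeneric.qint_one {u : Kv} (hu : IsGeneric u) : qint u 1 = 1 := by
  rw [qint, zpow_one, zpow_neg, zpow_one, div_self hu.sub_inv_ne_zero]

theorem qint_neg (u : Kv) (n : ℤ) : qint u (-n) = -qint u n := by
  simp only [qint, neg_neg]; ring

theorem IsGeneric.qint_ne_zero {u : Kv} (hu : IsGeneric u) {n : ℤ} (hn : n ≠ 0) :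
    qint u n ≠ 0 := by
  refine div_ne_zero (fun h => ?_) hu.sub_inv_ne_zero
  have h1 : u ^ n = u ^ (-n) := sub_eq_zero.1 h
  apply hu.2 (n + n) (by omega)
  rw [zpow_add₀ hu.1]
  nth_rewrite 2 [h1]
  rw [← zpow_add₀ hu.1, add_neg_cancel, zpow_zero]

theorem qint_add {u : Kv} (hu : u ≠ 0) (a b : ℤ) :
    qint u (a + b) = u ^ (-b) * qint u a + u ^ a * qint u b := by
  simp only [qint, neg_add, zpow_add₀ hu]
  ring

/-- This is the relation between `E_i` and `F_i` on a root vector with string lengths `p` and `q`;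
the same identity drives the `sl₂` computations. -/
theorem IsGeneric.qint_mul_sub {u : Kv} (hu : IsGeneric u) (p q : ℤ) :
    qint u (p + 1) * qint u q - qint u (q + 1) * qint u p = qint u (q - p) := by
  have h0 := hu.1
  have h1 := hu.sub_inv_ne_zero
  have hp : u ^ p ≠ 0 := zpow_ne_zero _ h0
  have hq : u ^ q ≠ 0 := zpow_ne_zero _ h0
  simp only [qint, neg_add, sub_eq_add_neg, neg_neg, zpow_add₀ h0, zpow_one, zpow_neg]
  rw [div_mul_div_comm, div_mul_div_comm, ← neg_div, ← add_div, div_eq_div_iff (by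
    simpa [sub_eq_add_neg] using h1) (by simpa [sub_eq_add_neg] using h1)]
  field_simp
  ring

/-- The previous identity at `p = n`, `q = -c - n`, in the form needed for the induction on iterated
`q`-commutators. -/
theorem IsGeneric.qint_mul_add {u : Kv} (hu : IsGeneric u) (n c : ℤ) :
    qint u n * qint u (c + n - 1) + qint u (c + 2 * n) = qint u (n + 1) * qint u (c + n) := by
  have h := hu.qint_mul_sub n (-c - n)
  have e1 : -c - n = -(c + n) := by ring
  have e2 : -(c + n) + 1 = -(c + n - 1) := by ring
  have e3 : -(c + n) - n = -(c + 2 * n) := by ring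
  rw [e1, e2, e3, qint_neg, qint_neg, qint_neg] at h
  linear_combination h

theorem qfact_zero (u : Kv) : qfact u 0 = 1 := by simp [qfact]

theorem qfact_succ (u : Kv) (n : ℕ) : qfact u (n + 1) = qfact u n * qint u ((n : ℤ) + 1) := by
  simp [qfact, Finset.prod_range_succ]

theorem IsGeneric.qfact_ne_zero {u : Kv} (hu : IsGeneric u) (n : ℕ) : qfact u n ≠ 0 :=
  Finset.prod_ne_zero_iff.2 fun _ _ => hu.qint_ne_zero (by omega)

theorem IsGeneric.qfact_one {u : Kv} (hu : IsGeneric u) : qfact u 1 = 1 := by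
  simp [qfact, hu.qint_one]

theorem IsGeneric.qbinom_zero_right {u : Kv} (hu : IsGeneric u) (a : ℕ) : qbinom u a 0 = 1 := by
  simp [qbinom, qfact_zero, hu.qfact_ne_zero]

theorem IsGeneric.qbinom_zero_left {u : Kv} (hu : IsGeneric u) (a : ℕ) : qbinom u 0 a = 1 := by
  simp [qbinom, qfact_zero, hu.qfact_ne_zero]

/-- The `q`-Pascal rule. Its coefficients are powers of `u`, so positivity of quantum binomials
follows by induction. -/
theorem IsGeneric.qbinom_succ_succ {u : Kv} (hu : IsGeneric u) (a b : ℕ) :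
    qbinom u (a + 1) (b + 1) =
      u ^ (-((b : ℤ) + 1)) * qbinom u a (b + 1) + u ^ ((a : ℤ) + 1) * qbinom u (a + 1) b := by
  have ha := hu.qfact_ne_zero a
  have hb := hu.qfact_ne_zero b
  have ha' : qint u ((a : ℤ) + 1) ≠ 0 := hu.qint_ne_zero (by omega)
  have hb' : qint u ((b : ℤ) + 1) ≠ 0 := hu.qint_ne_zero (by omega)
  have e1 : a + 1 + (b + 1) = (a + b + 1) + 1 := by ring
  have e2 : a + (b + 1) = a + b + 1 := by ring
  have e3 : a + 1 + b = a + b + 1 := by ring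
  have e4 : (((a + b + 1 : ℕ) : ℤ) + 1) = ((a : ℤ) + 1) + ((b : ℤ) + 1) := by push_cast; ring
  rw [qbinom, qbinom, qbinom, e1, e2, e3, qfact_succ u (a + b + 1), e4, qint_add hu.1,
    qfact_succ u a, qfact_succ u b]
  generalize qfact u (a + b + 1) = z
  generalize u ^ (-((b : ℤ) + 1)) = y
  generalize u ^ ((a : ℤ) + 1) = x
  field_simp

theorem IsGeneric.prod_qint_eq {u : Kv} (hu : IsGeneric u) (a k : ℕ) :
    (qfact u k)⁻¹ * ∏ s ∈ Finset.range k, qint u ((a : ℤ) + s + 1) = qbinom u a k := by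
  have h : qfact u (a + k) = qfact u a * ∏ s ∈ Finset.range k, qint u ((a : ℤ) + s + 1) := by
    induction k with
    | zero => simp
    | succ k ih =>
      rw [Finset.prod_range_succ, ← mul_assoc, ← ih, ← add_assoc, qfact_succ]
      push_cast
      rfl
  rw [qbinom, h]
  have := hu.qfact_ne_zero a
  have := hu.qfact_ne_zero k
  field_simp

/-! ### Positivity of quantum integers and binomials -/

theorem vv_zpow_mem_natLaurent (n : ℤ) : vv ^ n ∈ natLaurent := by
  obtain ⟨m, rfl | rfl⟩ := n.eq_nat_or_neg
  · rw [zpow_natCast]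
    exact pow_mem (Subsemiring.subset_closure (by simp)) m
  · rw [zpow_neg, zpow_natCast, ← inv_pow]
    exact pow_mem (Subsemiring.subset_closure (by simp)) m

theorem vv_pow_zpow_mem_natLaurent (k : ℕ) (n : ℤ) : (vv ^ k) ^ n ∈ natLaurent := by
  rw [← zpow_natCast, ← zpow_mul]
  exact vv_zpow_mem_natLaurent _

theorem qint_mem_natLaurent {k : ℕ} (hk : 0 < k) {n : ℤ} (hn : 0 ≤ n) :
    qint (vv ^ k) n ∈ natLaurent := by
  obtain ⟨m, rfl⟩ := Int.eq_ofNat_of_zero_le hn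
  clear hn
  have hu := isGeneric_vv.pow hk
  induction m with
  | zero => simp [qint_zero]
  | succ m ih =>
    rw [Nat.cast_succ, qint_add hu.1, hu.qint_one, mul_one]
    exact add_mem (mul_mem (vv_pow_zpow_mem_natLaurent _ _) ih) (vv_pow_zpow_mem_natLaurent _ _)

theorem qbinom_mem_natLaurent {k : ℕ} (hk : 0 < k) (a b : ℕ) :
    qbinom (vv ^ k) a b ∈ natLaurent := by
  have hu := isGeneric_vv.pow hk
  induction a generalizing b with
  | zero => rw [hu.qbinom_zero_left]; exact one_mem _
  | succ a iha =>
    induction b with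
    | zero => rw [hu.qbinom_zero_right]; exact one_mem _
    | succ b ihb =>
      rw [hu.qbinom_succ_succ]
      exact add_mem (mul_mem (vv_pow_zpow_mem_natLaurent _ _) (iha _))
        (mul_mem (vv_pow_zpow_mem_natLaurent _ _) ihb)

/-! ### The quantum Serre relation for a nilpotent raising operator -/

section Serre

variable {A : Type*} [Ring A] [Algebra Kv A]

/-- Iterated `q`-commutators of `z` with `x`. -/
def qcomm (u : Kv) (c : ℤ) (x z : A) : ℕ → A
  | 0 => z
  | n + 1 => x * qcomm u c x z n - u ^ (c + 2 * (n : ℤ)) • (qcomm u c x z n * x)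

/-- The coefficient of `x ^ a * z * x ^ b` in the iterated `q`-commutator. -/
def qcommCoeff (u : Kv) (c : ℤ) (a b : ℕ) : Kv :=
  (-1) ^ b * u ^ ((b : ℤ) * (a + b - 1 + c)) * qbinom u a b

theorem qcommCoeff_zero_left {u : Kv} (hu : IsGeneric u) (c : ℤ) (b : ℕ) :
    qcommCoeff u c 0 (b + 1) = -(u ^ (c + 2 * (b : ℤ)) * qcommCoeff u c 0 b) := by
  have e : ((b + 1 : ℕ) : ℤ) * ((0 : ℕ) + (b + 1 : ℕ) - 1 + c) =
      (c + 2 * (b : ℤ)) + (b : ℤ) * ((0 : ℕ) + b - 1 + c) := by push_cast; ring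
  rw [qcommCoeff, qcommCoeff, hu.qbinom_zero_left, hu.qbinom_zero_left, e, zpow_add₀ hu.1]
  ring

theorem qcommCoeff_zero_right {u : Kv} (hu : IsGeneric u) (c : ℤ) (a : ℕ) :
    qcommCoeff u c a 0 = 1 := by
  simp [qcommCoeff, hu.qbinom_zero_right]

theorem qcommCoeff_succ_succ {u : Kv} (hu : IsGeneric u) (c : ℤ) (a b : ℕ) :
    qcommCoeff u c (a + 1) (b + 1) = qcommCoeff u c a (b + 1) -
      u ^ (c + 2 * ((a + 1 + b : ℕ) : ℤ)) * qcommCoeff u c (a + 1) b := by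
  have e1 : ((b + 1 : ℕ) : ℤ) * (a + (b + 1 : ℕ) - 1 + c) =
      ((b + 1 : ℕ) : ℤ) * ((a + 1 : ℕ) + (b + 1 : ℕ) - 1 + c) + -((b : ℤ) + 1) := by
    push_cast; ring
  have e2 : ((b + 1 : ℕ) : ℤ) * ((a + 1 : ℕ) + (b + 1 : ℕ) - 1 + c) + ((a : ℤ) + 1) =
      (c + 2 * ((a + 1 + b : ℕ) : ℤ)) + (b : ℤ) * ((a + 1 : ℕ) + b - 1 + c) := by
    push_cast; ring
  rw [qcommCoeff, qcommCoeff, qcommCoeff, e1, zpow_add₀ hu.1, hu.qbinom_succ_succ]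
  have e3 := congrArg (fun n => u ^ n) e2
  simp only [zpow_add₀ hu.1 (((b + 1 : ℕ) : ℤ) * ((a + 1 : ℕ) + (b + 1 : ℕ) - 1 + c)),
    zpow_add₀ hu.1 (c + 2 * ((a + 1 + b : ℕ) : ℤ))] at e3
  rw [pow_succ]
  linear_combination (-(-1) ^ b * qbinom u (a + 1) b) * e3

theorem qcomm_eq_sum {u : Kv} (hu : IsGeneric u) (c : ℤ) (x z : A) (n : ℕ) :
    qcomm u c x z n = ∑ ab ∈ Finset.HasAntidiagonal.antidiagonal n,
      qcommCoeff u c ab.1 ab.2 • (x ^ ab.1 * z * x ^ ab.2) := by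
  induction n with
  | zero => simp [qcomm, qcommCoeff_zero_right hu]
  | succ n ih =>
    -- Left multiplication by `x` raises the first exponent and right multiplication the second. `P`
    -- and `Q` are the two contributions to each monomial, set to zero where the exponent cannot
    -- have been raised.
    let P : ℕ × ℕ → A := fun ab => if ab.1 = 0 then 0 else
      qcommCoeff u c (ab.1 - 1) ab.2 • (x ^ ab.1 * z * x ^ ab.2)
    let Q : ℕ × ℕ → A := fun ab => if ab.2 = 0 then 0 else
      (u ^ (c + 2 * (n : ℤ)) * qcommCoeff u c ab.1 (ab.2 - 1)) • (x ^ ab.1 * z * x ^ ab.2)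
    have hP : ∑ ab ∈ Finset.HasAntidiagonal.antidiagonal (n + 1), P ab =
        x * qcomm u c x z n := by
      rw [Finset.Nat.sum_antidiagonal_succ, ih, Finset.mul_sum]
      simp only [P, if_pos, zero_add]
      refine Finset.sum_congr rfl fun ab _ => ?_
      simp [pow_succ', mul_assoc]
    have hQ : ∑ ab ∈ Finset.HasAntidiagonal.antidiagonal (n + 1), Q ab =
        u ^ (c + 2 * (n : ℤ)) • (qcomm u c x z n * x) := by
      rw [Finset.Nat.sum_antidiagonal_succ', ih, Finset.sum_mul, Finset.smul_sum]
      simp only [Q, if_pos, zero_add]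
      refine Finset.sum_congr rfl fun ab _ => ?_
      simp [pow_succ, mul_assoc, smul_smul]
    rw [qcomm, ← hP, ← hQ, ← Finset.sum_sub_distrib]
    refine Finset.sum_congr rfl fun ab hab => ?_
    obtain ⟨a, b⟩ := ab
    rw [Finset.HasAntidiagonal.mem_antidiagonal] at hab
    rcases a with _ | a <;> rcases b with _ | b
    · simp at hab
    · have : b = n := by simpa using hab
      subst this
      simp [P, Q, qcommCoeff_zero_left hu]
    · simp [P, Q, qcommCoeff_zero_right hu]
    · have : n = a + 1 + b := by simp at hab; omega
      simp only [P, Q, qcommCoeff_succ_succ hu, this]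
      simp [sub_smul]

/-- In an algebra that contains an `sl₂`-triple whose raising element `x` is nilpotent, an
element `z` of weight `c ≤ 0` that commutes with the lowering element satisfies the quantum
Serre relation. -/
theorem serre_of_nilpotent {u : Kv} (hu : IsGeneric u) {c : ℤ} {r : ℕ} (hr : (r : ℤ) = 1 - c)
    {x z f k k' : A} (hxf : x * f - f * x = (u - u⁻¹)⁻¹ • (k - k')) (hzf : z * f = f * z)
    (hk : k' * k = 1) (hk' : k * k' = 1) (hkx : k * x = u ^ (2 : ℤ) • (x * k))
    (hkz : k * z = u ^ c • (z * k)) {N : ℕ} (hx : x ^ N = 0) :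
    ∑ ab ∈ Finset.HasAntidiagonal.antidiagonal r,
      ((-1) ^ ab.2 * qbinom u ab.1 ab.2) • (x ^ ab.1 * z * x ^ ab.2) = 0 := by
  have h0 := hu.1
  have inv : ∀ (y : A) (n : ℤ), k * y = u ^ n • (y * k) → k' * y = u ^ (-n) • (y * k') := by
    intro y n h
    have h1 : k' * (k * y) * k' = k' * (u ^ n • (y * k)) * k' := by rw [h]
    rw [← mul_assoc, hk, one_mul, mul_smul_comm, smul_mul_assoc, mul_assoc, mul_assoc, hk',
      mul_one] at h1
    rw [h1, smul_smul, ← zpow_add₀ h0, neg_add_cancel, zpow_zero, one_smul]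
  -- The exponent in the definition of `qcomm` is exactly the weight of the previous commutator.
  have hkS : ∀ n : ℕ, k * qcomm u c x z n = u ^ (c + 2 * (n : ℤ)) • (qcomm u c x z n * k) := by
    intro n
    induction n with
    | zero => simpa [qcomm] using hkz
    | succ n ih =>
      have e : u ^ (c + 2 * ((n + 1 : ℕ) : ℤ)) = u ^ (2 : ℤ) * u ^ (c + 2 * (n : ℤ)) := by
        rw [← zpow_add₀ h0]; congr 1; push_cast; ring
      have h1 : k * (x * qcomm u c x z n) =
          (u ^ (2 : ℤ) * u ^ (c + 2 * (n : ℤ))) • (x * qcomm u c x z n * k) := by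
        rw [← mul_assoc, hkx, smul_mul_assoc, mul_assoc, ih, mul_smul_comm, smul_smul, mul_assoc]
      have h2 : k * (qcomm u c x z n * x) =
          (u ^ (2 : ℤ) * u ^ (c + 2 * (n : ℤ))) • (qcomm u c x z n * x * k) := by
        rw [← mul_assoc, ih, smul_mul_assoc, mul_assoc, hkx, mul_smul_comm, smul_smul,
          mul_comm, mul_assoc]
      rw [qcomm, e, mul_sub, mul_smul_comm, h1, h2, sub_mul, smul_sub, smul_mul_assoc,
        smul_comm (u ^ (c + 2 * (n : ℤ)))]
  -- Commutation with `f` lowers the iterated commutator by one step. The exponent chosen in `qcomm`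
  -- makes the terms in `k` cancel, so that only `k'` remains.
  have hbr : ∀ n : ℕ, qcomm u c x z (n + 1) * f - f * qcomm u c x z (n + 1) =
      (qint u ((n : ℤ) + 1) * qint u (c + n)) • (qcomm u c x z n * k') := by
    have key : ∀ n : ℕ, (x * f - f * x) * qcomm u c x z n -
        u ^ (c + 2 * (n : ℤ)) • (qcomm u c x z n * (x * f - f * x)) =
        qint u (c + 2 * n) • (qcomm u c x z n * k') := by
      intro n
      rw [hxf, smul_mul_assoc, mul_smul_comm, sub_mul, mul_sub, hkS, inv _ _ (hkS n), qint]
      simp only [smul_sub, smul_smul]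
      rw [mul_comm (u - u⁻¹)⁻¹ (u ^ (c + 2 * (n : ℤ))), div_eq_mul_inv, sub_mul, sub_smul,
        mul_comm (u - u⁻¹)⁻¹ (u ^ (-(c + 2 * (n : ℤ))))]
      abel
    have expand : ∀ s : A, ∀ t : Kv, (x * s - t • (s * x)) * f - f * (x * s - t • (s * x)) =
        ((x * f - f * x) * s - t • (s * (x * f - f * x))) +
        (x * (s * f - f * s) - t • ((s * f - f * s) * x)) := by
      intro s t
      simp only [sub_mul, mul_sub, smul_mul_assoc, mul_smul_comm, smul_sub, mul_assoc]
      abel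
    intro n
    induction n with
    | zero =>
      have h1 := expand (qcomm u c x z 0) (u ^ (c + 2 * ((0 : ℕ) : ℤ)))
      rw [key] at h1
      exact h1.trans (by simp [qcomm, hzf, hu.qint_one])
    | succ n ih =>
      rw [qcomm, expand, key, ih]
      have e : u ^ (c + 2 * ((n + 1 : ℕ) : ℤ)) * u ^ (-(2 : ℤ)) = u ^ (c + 2 * (n : ℤ)) := by
        rw [← zpow_add₀ h0]; congr 1; push_cast; ring
      have h1 : x * (qcomm u c x z n * k') - u ^ (c + 2 * ((n + 1 : ℕ) : ℤ)) •
          (qcomm u c x z n * k' * x) = qcomm u c x z (n + 1) * k' := by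
        rw [mul_assoc (qcomm u c x z n), inv _ _ hkx, mul_smul_comm, smul_smul, e, qcomm,
          sub_mul, smul_mul_assoc, mul_assoc, mul_assoc]
      rw [mul_smul_comm, smul_mul_assoc, smul_comm (u ^ (c + 2 * ((n + 1 : ℕ) : ℤ))), ← smul_sub,
        h1, ← add_smul]
      congr 1
      have := hu.qint_mul_add ((n : ℤ) + 1) c
      push_cast
      rw [show c + ((n : ℤ) + 1) - 1 = c + n by ring] at this
      rw [← this]
      ring
  -- The scalar `[n + 1] [c + n]` is nonzero because `c + n ≥ 1` for `n ≥ r = 1 - c`; at `n = r - 1`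
  -- it vanishes, so the descent stops precisely at the Serre expression.
  have hdown : ∀ n : ℕ, r ≤ n → qcomm u c x z (n + 1) = 0 → qcomm u c x z n = 0 := by
    intro n hn h
    have h1 := hbr n
    rw [h, zero_mul, mul_zero, sub_zero] at h1
    have h2 : qcomm u c x z n * k' = 0 :=
      (smul_eq_zero.1 h1.symm).resolve_left
        (mul_ne_zero (hu.qint_ne_zero (by omega)) (hu.qint_ne_zero (by omega)))
    rw [← mul_one (qcomm u c x z n), ← hk, ← mul_assoc, h2, zero_mul]
  -- In every monomial one of the two exponents of `x` is at least `N`.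
  have hzero : ∀ n : ℕ, 2 * N ≤ n → qcomm u c x z n = 0 := by
    intro n hn
    rw [qcomm_eq_sum hu]
    refine Finset.sum_eq_zero fun ab hab => ?_
    rw [Finset.HasAntidiagonal.mem_antidiagonal] at hab
    rcases le_total N ab.1 with h | h
    · rw [pow_eq_zero_of_le h hx, zero_mul, zero_mul, smul_zero]
    · rw [pow_eq_zero_of_le (by omega : N ≤ ab.2) hx, mul_zero, smul_zero]
  have hr0 : qcomm u c x z r = 0 := by
    have : ∀ m : ℕ, qcomm u c x z (r + m) = 0 → qcomm u c x z r = 0 := by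
      intro m
      induction m with
      | zero => exact id
      | succ m ih => exact fun h => ih (hdown _ (by omega) h)
    exact this (2 * N) (hzero _ (by omega))
  rw [qcomm_eq_sum hu] at hr0
  rw [← hr0]
  refine Finset.sum_congr rfl fun ab hab => ?_
  rw [Finset.HasAntidiagonal.mem_antidiagonal] at hab
  -- In degree `r = 1 - c` the power of `u` in the coefficient disappears, which leaves the signed
  -- quantum binomial.
  have e : (ab.1 : ℤ) + ab.2 - 1 + c = 0 := by omega
  rw [qcommCoeff, e, mul_zero, zpow_zero, mul_one]

end Serre

namespace CartanDatum

/-! ### The root lattice -/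

section Eps

variable {I : Type*} [DecidableEq I]

/-- The standard basis vectors of the root lattice `ℤ[I]`. -/
def eps (i : I) : I → ℤ := Pi.single i 1

theorem eps_same (i : I) : eps i i = 1 := by simp [eps]

theorem eps_ne {i j : I} (h : j ≠ i) : eps i j = 0 := by simp [eps, h]

theorem eps_nonneg (i : I) : 0 ≤ eps i := by
  intro k
  by_cases h : k = i
  · subst h; simp [eps_same]
  · simp [eps_ne h]

theorem eps_injective : Function.Injective (eps : I → I → ℤ) := by
  intro i j h
  by_contra hij
  have := congrFun h i
  rw [eps_same, eps_ne hij] at this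
  omega

theorem eps_ne_zero (i : I) : eps i ≠ 0 := by
  intro h
  have := congrFun h i
  rw [eps_same] at this
  simp at this

theorem eps_ne_neg_eps (i j : I) : (eps i : I → ℤ) ≠ -eps j := by
  intro h
  have h1 := congrFun h i
  have h2 := eps_nonneg j i
  rw [Pi.neg_apply, eps_same] at h1
  simp only [Pi.zero_apply] at h2
  omega

end Eps

variable {I : Type*} [Fintype I] [DecidableEq I] (D : CartanDatum I)

/-- The bilinear form on the root lattice. -/
def B : LinearMap.BilinForm ℤ (I → ℤ) := Matrix.toBilin' D.form

/-- The embedding of the root lattice into the weight lattice. -/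
def emb : (I → ℤ) →ₗ[ℤ] D.Wt := Fintype.linearCombination ℤ D.simpleRoot

/-- The integer `⟨i, x⟩` for an element `x` of the root lattice. -/
def pair (i : I) : (I → ℤ) →ₗ[ℤ] ℤ := (LinearMap.applyₗ (Pi.single i 1)).comp D.emb

theorem pairing_emb (i : I) (x : I → ℤ) : D.pairing i (D.emb x) = D.pair i x := rfl

theorem emb_eps (i : I) : D.emb (eps i) = D.simpleRoot i := by
  simp [emb, eps, Fintype.linearCombination_apply, Pi.single_apply]

theorem pair_eps (i j : I) : D.pair i (eps j) = D.cartan i j := by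
  rw [← pairing_emb, emb_eps, pairing_simpleRoot]

theorem form_self (i : I) : D.form i i = 2 * (D.d i : ℤ) := by
  obtain ⟨d, hd, h⟩ := D.even i
  have : D.d i = d := by rw [CartanDatum.d, h]; omega
  rw [this, h]

theorem d_pos (i : I) : 0 < D.d i := by
  obtain ⟨d, hd, h⟩ := D.even i
  have := D.form_self i
  omega

theorem form_eq (i j : I) : D.form i j = D.d i * D.cartan i j := by
  have hd := D.d_pos i
  have hdvd : D.form i i ∣ 2 * D.form i j := by
    by_cases h : i = j
    · subst h; exact Dvd.intro_left _ rfl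
    · obtain ⟨n, hn⟩ := D.off_diag i j h
      exact ⟨-n, by rw [hn]; ring⟩
  have h := Int.ediv_mul_cancel hdvd
  change D.cartan i j * D.form i i = _ at h
  rw [form_self] at h
  linarith

theorem cartan_nonpos {i j : I} (h : i ≠ j) : D.cartan i j ≤ 0 := by
  obtain ⟨n, hn⟩ := D.off_diag i j h
  have h1 := D.form_eq i j
  have h2 := D.form_self i
  have hd : (0 : ℤ) < D.d i := by exact_mod_cast D.d_pos i
  have : D.cartan i j = -n := by
    apply mul_left_cancel₀ hd.ne'
    rw [h2, h1] at hn
    linarith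
  omega

theorem d_mul_cartan (i j : I) : (D.d i : ℤ) * D.cartan i j = D.d j * D.cartan j i := by
  rw [← form_eq, ← form_eq, D.symm]

theorem cartan_eq_zero_iff (i j : I) : D.cartan i j = 0 ↔ D.cartan j i = 0 := by
  have hi := D.d_pos i
  have hj := D.d_pos j
  have h := D.d_mul_cartan i j
  constructor <;> intro h0 <;> rw [h0] at h <;> simp at h <;> omega

theorem B_eps_eps (i j : I) : D.B (eps i) (eps j) = D.form i j := by
  simp [B, eps]

theorem B_comm (x y : I → ℤ) : D.B x y = D.B y x := by
  simp only [B, Matrix.toBilin'_apply]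
  rw [Finset.sum_comm]
  refine Finset.sum_congr rfl fun i _ => Finset.sum_congr rfl fun j _ => ?_
  rw [D.symm]; ring

theorem eq_sum_eps (x : I → ℤ) : x = ∑ i, x i • eps i := by
  ext j
  simp [Finset.sum_apply, eps, Pi.single_apply]

theorem B_eps (i : I) (x : I → ℤ) : D.B (eps i) x = D.d i * D.pair i x := by
  conv_lhs => rw [eq_sum_eps x]
  conv_rhs => rw [eq_sum_eps x]
  simp only [map_sum, map_smul, Finset.mul_sum, B_eps_eps, pair_eps, form_eq, smul_eq_mul]
  refine Finset.sum_congr rfl fun j _ => ?_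
  ring

theorem B_eps_right (i : I) (x : I → ℤ) : D.B x (eps i) = D.d i * D.pair i x := by
  rw [B_comm, B_eps]

theorem B_eq_sum (x y : I → ℤ) : D.B x y = ∑ i, x i * (D.d i * D.pair i y) := by
  conv_lhs => rw [eq_sum_eps x]
  simp only [map_sum, map_smul, LinearMap.sum_apply, LinearMap.smul_apply, B_eps, smul_eq_mul]

theorem pair_eps_self (i : I) : D.pair i (eps i) = 2 := by rw [pair_eps, cartan_self]

theorem B_pos {x : I → ℤ} (hx : x ≠ 0) : 0 < D.B x x := by
  have hx' : (fun i => (x i : ℝ)) ≠ 0 := by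
    intro h
    apply hx
    ext i
    have h1 := congrFun h i
    simpa using h1
  have h := D.posDef.dotProduct_mulVec_pos hx'
  have e : star (fun i => (x i : ℝ)) ⬝ᵥ ((D.form.map (Int.cast : ℤ → ℝ)).mulVec
      (fun i => (x i : ℝ))) = ((D.B x x : ℤ) : ℝ) := by
    simp only [B, Matrix.toBilin'_apply', dotProduct, Matrix.mulVec, Pi.star_apply, star_trivial,
      Matrix.map_apply]
    push_cast
    rfl
  rw [e] at h
  exact_mod_cast h

/-- A vector that pairs to zero with every `i` has norm zero for the positive definite form. This
allows all work on roots to be done in the root lattice. -/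
theorem emb_injective : Function.Injective D.emb := by
  rw [injective_iff_map_eq_zero]
  intro x hx
  by_contra h
  have h1 := D.B_pos h
  rw [B_eq_sum] at h1
  simp [pair, hx] at h1

/-! ### Roots as elements of the root lattice -/

/-- The simple reflection on the root lattice. -/
def refl (i : I) (x : I → ℤ) : I → ℤ := x - D.pair i x • eps i

theorem emb_refl (i : I) (x : I → ℤ) : D.emb (D.refl i x) = D.reflect i (D.emb x) := by
  rw [refl, map_sub, map_smul, emb_eps, reflect, pairing_emb]

theorem pair_refl (j i : I) (x : I → ℤ) :
    D.pair j (D.refl i x) = D.pair j x - D.pair i x * D.cartan j i := by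
  rw [refl, map_sub, map_smul, pair_eps, smul_eq_mul]

theorem pair_refl_self (i : I) (x : I → ℤ) : D.pair i (D.refl i x) = -D.pair i x := by
  rw [pair_refl, cartan_self]; ring

theorem refl_refl (i : I) (x : I → ℤ) : D.refl i (D.refl i x) = x := by
  rw [refl, pair_refl_self, refl]; simp

theorem refl_neg (i : I) (x : I → ℤ) : D.refl i (-x) = -D.refl i x := by
  simp only [refl, map_neg]; module

theorem refl_eps (i : I) : D.refl i (eps i) = -eps i := by
  rw [refl, pair_eps_self]; module

theorem B_refl_left (i : I) (x y : I → ℤ) : D.B (D.refl i x) y = D.B x (D.refl i y) := by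
  simp only [refl, map_sub, map_smul, LinearMap.sub_apply, LinearMap.smul_apply, B_eps,
    B_eps_right, smul_eq_mul]
  ring

theorem B_refl_refl (i : I) (x y : I → ℤ) : D.B (D.refl i x) (D.refl i y) = D.B x y := by
  rw [B_refl_left, refl_refl]

/-- The roots, as elements of the root lattice. -/
inductive IsRt : (I → ℤ) → Prop
  | simple (i : I) : IsRt (eps i)
  | reflect (i : I) {x : I → ℤ} (h : IsRt x) : IsRt (D.refl i x)

theorem mem_R_iff_exists (α : D.Wt) : α ∈ D.R ↔ ∃ x, D.IsRt x ∧ D.emb x = α := by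
  constructor
  · intro h
    change D.IsRoot α at h
    induction h with
    | simple i => exact ⟨eps i, .simple i, D.emb_eps i⟩
    | reflect i _ ih =>
      obtain ⟨x, hx, rfl⟩ := ih
      exact ⟨_, hx.reflect i, D.emb_refl i x⟩
  · rintro ⟨x, hx, rfl⟩
    change D.IsRoot _
    induction hx with
    | simple i => rw [emb_eps]; exact .simple i
    | reflect i _ ih => rw [emb_refl]; exact ih.reflect i

theorem emb_mem_R {x : I → ℤ} : D.emb x ∈ D.R ↔ D.IsRt x := by
  rw [mem_R_iff_exists]
  constructor
  · rintro ⟨y, hy, h⟩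
    rwa [← D.emb_injective h]
  · exact fun h => ⟨x, h, rfl⟩

/-! ### Integrality and Cartan integers of pairs of roots -/

variable {D}

/-- Simple roots have a coordinate `1`, and reflections are automorphisms of the lattice. This is
the form in which reducedness of the root system is used. -/
theorem IsRt.not_two_smul {x : I → ℤ} (hx : D.IsRt x) (y : I → ℤ) : x ≠ (2 : ℤ) • y := by
  induction hx generalizing y with
  | simple i =>
    intro h
    have := congrFun h i
    rw [eps_same, Pi.smul_apply, smul_eq_mul] at this
    omega
  | @reflect i x _ ih =>
    intro h
    apply ih (D.refl i y)
    rw [← D.refl_refl i x, h]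
    simp only [refl, map_smul, smul_eq_mul]
    module

theorem IsRt.ne_zero {x : I → ℤ} (hx : D.IsRt x) : x ≠ 0 := by
  intro h
  exact hx.not_two_smul 0 (by simp [h])

theorem IsRt.B_pos {x : I → ℤ} (hx : D.IsRt x) : 0 < D.B x x := D.B_pos hx.ne_zero

theorem IsRt.dvd {x : I → ℤ} (hx : D.IsRt x) (y : I → ℤ) : D.B x x ∣ 2 * D.B x y := by
  induction hx generalizing y with
  | simple i =>
    rw [B_eps, B_eps, pair_eps_self]
    exact ⟨D.pair i y, by ring⟩
  | @reflect i x _ ih =>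
    rw [B_refl_refl, B_refl_left]
    exact ih _

/-- The reflection in `s_i x` is the conjugate by `s_i` of the reflection in `x`, so stability under
simple reflections gives stability under the reflection in any root. -/
theorem IsRt.reflection {x : I → ℤ} (hx : D.IsRt x) {y : I → ℤ} (hy : D.IsRt y) {n : ℤ}
    (hn : 2 * D.B x y = n * D.B x x) : D.IsRt (y - n • x) := by
  induction hx generalizing y n with
  | simple i =>
    have hd : (0 : ℤ) < D.d i := by exact_mod_cast D.d_pos i
    rw [B_eps, B_eps, pair_eps_self] at hn
    have : n = D.pair i y := by
      apply mul_left_cancel₀ hd.ne'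
      linarith
    rw [this]
    exact hy.reflect i
  | @reflect i x _ ih =>
    rw [B_refl_refl, B_refl_left] at hn
    have h := (ih (hy.reflect i) hn).reflect i
    convert h using 1
    conv_lhs => rw [← D.refl_refl i y]
    simp only [refl, map_sub, map_smul, smul_eq_mul]
    module

theorem IsRt.neg {x : I → ℤ} (hx : D.IsRt x) : D.IsRt (-x) := by
  have h := hx.reflection hx (n := 2) rfl
  convert h using 1
  module

theorem isRt_neg_iff {x : I → ℤ} : D.IsRt (-x) ↔ D.IsRt x :=
  ⟨fun h => by simpa using h.neg, IsRt.neg⟩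

/-- Two roots that are not proportional have small Cartan integers. -/
theorem IsRt.cartan_cases {x y : I → ℤ} (hx : D.IsRt x) (hy : D.IsRt y) (h1 : y ≠ x)
    (h2 : y ≠ -x) : ∃ m n : ℤ, 2 * D.B x y = m * D.B x x ∧ 2 * D.B x y = n * D.B y y ∧
      0 ≤ m * n ∧ m * n ≤ 3 ∧ (m = 0 ↔ n = 0) := by
  obtain ⟨m, hm⟩ := hx.dvd y
  obtain ⟨n, hn⟩ := hy.dvd x
  rw [B_comm, mul_comm (D.B y y)] at hn
  rw [mul_comm (D.B x x)] at hm
  have ha := hx.B_pos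
  have hb := hy.B_pos
  have hmn : m * n * (D.B x x * D.B y y) = (2 * D.B x y) ^ 2 := by
    rw [pow_two]
    nth_rewrite 1 [hm]
    rw [hn]; ring
  have hab := mul_pos ha hb
  have h0 : 0 ≤ m * n := by
    by_contra h
    have := mul_neg_of_neg_of_pos (not_le.1 h) hab
    rw [hmn] at this
    exact absurd (sq_nonneg _) (not_le.2 this)
  refine ⟨m, n, hm, hn, h0, ?_, ?_⟩
  · by_contra h4
    have h4 : 4 ≤ m * n := by omega
    -- If `m n ≥ 4`, this vector has norm `(4 - m n) B(y, y) ≤ 0`, so definiteness makes `x` and `y`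
    -- proportional.
    have hz : (2 : ℤ) • y - m • x = 0 := by
      by_contra hz
      have hp := D.B_pos hz
      have e : D.B ((2 : ℤ) • y - m • x) ((2 : ℤ) • y - m • x) = (4 - m * n) * D.B y y := by
        simp only [map_sub, map_smul, LinearMap.sub_apply, LinearMap.smul_apply, smul_eq_mul,
          D.B_comm y x]
        linear_combination (-m) * hm - m * hn
      rw [e] at hp
      nlinarith
    have hyx : (2 : ℤ) • y = m • x := sub_eq_zero.1 hz
    have hxy : (2 : ℤ) • x = n • y := by
      by_contra hz
      have hp := D.B_pos (sub_ne_zero.2 hz)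
      have e : D.B ((2 : ℤ) • x - n • y) ((2 : ℤ) • x - n • y) = (4 - m * n) * D.B x x := by
        simp only [map_sub, map_smul, LinearMap.sub_apply, LinearMap.smul_apply, smul_eq_mul,
          D.B_comm y x]
        linear_combination (-n) * hm - n * hn
      rw [e] at hp
      nlinarith
    have h44 : (4 - m * n) • y = 0 := by
      have : (4 - m * n) • y = (2 : ℤ) • ((2 : ℤ) • y) - m • (n • y) := by module
      rw [this, hyx, ← hxy]; module
    have hmn4 : m * n = 4 := by
      rcases smul_eq_zero.1 h44 with h | h
      · omega
      · exact absurd h hy.ne_zero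
    have hm4 : m ∣ 4 := ⟨n, hmn4.symm⟩
    have hmle : m ≤ 4 := Int.le_of_dvd (by norm_num) hm4
    have hmge : -4 ≤ m := by
      have := Int.le_of_dvd (by norm_num) ((neg_dvd).2 hm4)
      omega
    have key : ∀ {a b : I → ℤ}, (2 : ℤ) • a = (2 : ℤ) • b → a = b := fun {a b} h =>
      smul_right_injective _ (by norm_num : (2 : ℤ) ≠ 0) h
    -- Here `m` divides `4`. The values `±1` and `±4` would make one root twice a lattice vector,
    -- and `±2` would give `y = ±x`.
    interval_cases m
    · exact hy.not_two_smul (-x) (key (by rw [hyx]; module))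
    · omega
    · exact h2 (key (by rw [hyx]; module))
    · exact hx.not_two_smul (-y) (by rw [smul_neg, hyx]; module)
    · omega
    · exact hx.not_two_smul y (by rw [hyx]; module)
    · exact h1 (key (by rw [hyx]))
    · omega
    · exact hy.not_two_smul x (key (by rw [hyx]; module))
  · constructor
    · intro h
      rw [h, zero_mul] at hm
      rw [hm] at hn
      rcases mul_eq_zero.1 hn.symm with h | h
      · exact h
      · omega
    · intro h
      rw [h, zero_mul] at hn
      rw [hn] at hm
      rcases mul_eq_zero.1 hm.symm with h | h
      · exact h
      · omega

/-- The usual table of pairs of Cartan integers: equal signs, and at least one of absolute value `1`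
unless both vanish. -/
theorem int_cases {m n : ℤ} (h0 : 0 ≤ m * n) (h3 : m * n ≤ 3) (hz : m = 0 ↔ n = 0) :
    -3 ≤ m ∧ m ≤ 3 ∧ -3 ≤ n ∧ n ≤ 3 ∧ (2 ≤ m → n = 1) ∧ (m ≤ -2 → n = -1) ∧
      (2 ≤ n → m = 1) ∧ (n ≤ -2 → m = -1) ∧ (0 < m ↔ 0 < n) := by
  rcases lt_trichotomy m 0 with hm | hm | hm
  · have hn : n < 0 := by
      rcases lt_trichotomy n 0 with h | h | h
      · exact h
      · omega
      · nlinarith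
    have a1 : -3 ≤ m := by nlinarith
    have a2 : -3 ≤ n := by nlinarith
    interval_cases m <;> omega
  · have := hz.1 hm
    subst hm this
    simp
  · have hn : 0 < n := by
      rcases lt_trichotomy n 0 with h | h | h
      · nlinarith
      · omega
      · exact h
    have a1 : m ≤ 3 := by nlinarith
    have a2 : n ≤ 3 := by nlinarith
    interval_cases m <;> omega

/-- The Cartan integers of a simple root and another root. -/
theorem IsRt.pair_cases {y : I → ℤ} (hy : D.IsRt y) {i : I} (h1 : y ≠ eps i)
    (h2 : y ≠ -eps i) : ∃ n : ℤ, 2 * (D.d i * D.pair i y) = n * D.B y y ∧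
      -3 ≤ D.pair i y ∧ D.pair i y ≤ 3 ∧ (2 ≤ D.pair i y → n = 1) ∧ (D.pair i y ≤ -2 → n = -1) := by
  obtain ⟨m, n, hm, hn, h0, h3, hz⟩ := (IsRt.simple (D := D) i).cartan_cases hy h1 h2
  have hd : (0 : ℤ) < D.d i := by exact_mod_cast D.d_pos i
  rw [B_eps, B_eps, pair_eps_self] at hm
  rw [B_eps] at hn
  have : D.pair i y = m := by
    apply mul_left_cancel₀ hd.ne'
    linarith
  obtain ⟨a, b, -, -, c, e, -⟩ := int_cases h0 h3 hz
  rw [this] at hn ⊢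
  exact ⟨n, hn, a, b, c, e⟩

theorem IsRt.pair_bounds {y : I → ℤ} (hy : D.IsRt y) (i : I) :
    -3 ≤ D.pair i y ∧ D.pair i y ≤ 3 := by
  by_cases h1 : y = eps i
  · rw [h1, pair_eps_self]; norm_num
  by_cases h2 : y = -eps i
  · rw [h2, map_neg, pair_eps_self]; norm_num
  obtain ⟨n, -, a, b, -⟩ := hy.pair_cases h1 h2
  exact ⟨a, b⟩

/-- One of the two Cartan integers equals `1`, so `x - y` is, up to sign, a reflection of one root
in the other. -/
theorem IsRt.sub {x y : I → ℤ} (hx : D.IsRt x) (hy : D.IsRt y) (h : 0 < D.B x y) (hxy : x ≠ y) :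
    D.IsRt (x - y) := by
  have hx0 := hx.B_pos
  have hy0 := hy.B_pos
  have h2 : y ≠ -x := by
    rintro rfl
    rw [map_neg] at h
    omega
  obtain ⟨m, n, hm, hn, h0, h3, hz⟩ := hx.cartan_cases hy hxy.symm h2
  obtain ⟨a1, a2, a3, a4, a5, a6, a7, a8, a9⟩ := int_cases h0 h3 hz
  have hm0 : 0 < m := by
    by_contra h'
    nlinarith
  rcases (by omega : m = 1 ∨ n = 1) with h | h
  · subst h
    have := (hx.reflection hy hm).neg
    simpa using this
  · subst h
    rw [B_comm] at hn
    simpa using hy.reflection hx hn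

theorem IsRt.add {x y : I → ℤ} (hx : D.IsRt x) (hy : D.IsRt y) (h : D.B x y < 0) (hxy : x ≠ -y) :
    D.IsRt (x + y) := by
  have := hx.sub hy.neg (by rw [map_neg]; omega) hxy
  simpa using this

/-! ### Positive and negative roots, finiteness -/

/-- The roots that are obtained from simple roots by simple reflections that increase them. -/
inductive IsPosRt (D : CartanDatum I) : (I → ℤ) → Prop
  | simple (i : I) : IsPosRt D (eps i)
  | raise (i : I) {x : I → ℤ} (h : IsPosRt D x) (hx : D.pair i x < 0) : IsPosRt D (D.refl i x)

theorem IsPosRt.isRt {x : I → ℤ} (hx : D.IsPosRt x) : D.IsRt x := by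
  induction hx with
  | simple i => exact .simple i
  | raise i _ _ ih => exact ih.reflect i

theorem IsPosRt.nonneg {x : I → ℤ} (hx : D.IsPosRt x) : 0 ≤ x := by
  induction hx with
  | simple i => exact eps_nonneg i
  | @raise i x _ h ih =>
    intro k
    have h1 := ih k
    have h2 := eps_nonneg i k
    simp only [refl, Pi.sub_apply, Pi.smul_apply, Pi.zero_apply, smul_eq_mul] at *
    nlinarith

theorem IsPosRt.ne_neg_eps {x : I → ℤ} (hx : D.IsPosRt x) (i : I) : x ≠ -eps i := by
  rintro rfl
  have := hx.nonneg i
  simp [eps_same] at this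

/-- Induction on the way in which the root was built. If the last step raised `y` by `s_j` with `j ≠
i`, then either `s_i` and `s_j` commute, or `⟨i, y⟩ ≥ 2`, which is possible only for `y = ε_i`. -/
theorem IsPosRt.lower {x : I → ℤ} (hx : D.IsPosRt x) {i : I} (h : 0 < D.pair i x)
    (hi : x ≠ eps i) : D.IsPosRt (D.refl i x) := by
  induction hx generalizing i with
  | simple j =>
    have hij : i ≠ j := fun e => hi (by rw [e])
    rw [pair_eps] at h
    have := D.cartan_nonpos hij
    omega
  | @raise j y hy hj ih =>
    by_cases hij : i = j
    · subst hij
      rwa [refl_refl]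
    have hc := D.cartan_nonpos hij
    have hc' := D.cartan_nonpos (Ne.symm hij)
    have hp := D.pair_refl i j y
    have hd : (0 : ℤ) < D.d i := by exact_mod_cast D.d_pos i
    by_cases hc0 : D.cartan i j = 0
    · have hc0' := (D.cartan_eq_zero_iff i j).1 hc0
      have e : D.refl i (D.refl j y) = D.refl j (D.refl i y) := by
        rw [refl, pair_refl, hc0, refl.eq_1 D j (D.refl i y), pair_refl, hc0', refl, refl]
        module
      rw [hc0, mul_zero, sub_zero] at hp
      rw [hp] at h
      rw [e]
      refine .raise j (ih h ?_) ?_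
      · rintro rfl
        rw [pair_eps, hc0'] at hj
        omega
      · rw [pair_refl, hc0', mul_zero, sub_zero]
        exact hj
    · have hc1 : D.cartan i j < 0 := by omega
      have hc1' : D.cartan j i < 0 := by
        have := mt (D.cartan_eq_zero_iff i j).2 hc0
        omega
      by_cases hyi : y = eps i
      · subst hyi
        rw [pair_refl, pair_eps_self, pair_eps] at h
        have e1 : D.cartan i j = -1 := by nlinarith
        have e2 : D.cartan j i = -1 := by nlinarith
        have e : D.refl i (D.refl j (eps i)) = eps j := by
          rw [refl, pair_refl, pair_eps_self, refl, pair_eps, e1, e2]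
          module
        rw [e]
        exact .simple j
      · exfalso
        obtain ⟨n, hn, -, a2, a3, -⟩ := hy.isRt.pair_cases hyi (hy.ne_neg_eps i)
        have hprod : 0 < D.pair j y * D.cartan i j := mul_pos_of_neg_of_neg hj hc1
        have hn1 := a3 (by omega)
        subst hn1
        -- Since `B(y, y) = 2 d_i ⟨i, y⟩` and `s_j` preserves norms, `⟨i, s_j y⟩` is a positive
        -- multiple of `⟨i, y⟩`; but it is smaller, as `⟨j, y⟩ ⟨i, j'⟩ > 0`.
        obtain ⟨l, hl⟩ := (hy.isRt.reflect j).dvd (eps i)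
        rw [B_eps_right, B_refl_refl] at hl
        have hl2 : D.pair i (D.refl j y) = l * D.pair i y := by
          apply mul_left_cancel₀ hd.ne'
          have : 2 * ((D.d i : ℤ) * D.pair i (D.refl j y)) =
              2 * (D.d i * (l * D.pair i y)) := by
            rw [hl, show D.B y y = 1 * D.B y y by ring, ← hn]; ring
          linarith
        have hl0 : 0 < l := by
          by_contra hl0
          nlinarith
        nlinarith

theorem IsRt.posRt_or_neg {x : I → ℤ} (hx : D.IsRt x) : D.IsPosRt x ∨ D.IsPosRt (-x) := by
  have key : ∀ (i : I) {y : I → ℤ}, D.IsPosRt y →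
      D.IsPosRt (D.refl i y) ∨ D.IsPosRt (-D.refl i y) := by
    intro i y hy
    rcases lt_trichotomy (D.pair i y) 0 with h | h | h
    · exact Or.inl (hy.raise i h)
    · left
      rw [refl, h]
      simpa using hy
    · by_cases hi : y = eps i
      · right
        rw [hi, refl_eps, neg_neg]
        exact .simple i
      · exact Or.inl (hy.lower h hi)
  induction hx with
  | simple i => exact Or.inl (.simple i)
  | @reflect i x _ ih =>
    rcases ih with h | h
    · exact key i h
    · have := key i h
      rw [refl_neg, neg_neg] at this
      exact this.symm

theorem IsRt.nonneg_or_nonpos {x : I → ℤ} (hx : D.IsRt x) : 0 ≤ x ∨ x ≤ 0 := by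
  rcases hx.posRt_or_neg with h | h
  · exact Or.inl h.nonneg
  · exact Or.inr (by simpa using h.nonneg)

theorem IsRt.nonneg_of_pos {x : I → ℤ} (hx : D.IsRt x) {k : I} (hk : 0 < x k) : 0 ≤ x := by
  rcases hx.nonneg_or_nonpos with h | h
  · exact h
  · have := h k
    simp at this
    omega

/-- The coordinates have mixed signs. Together with `IsRt.sub`, this is the standard contradiction
when `x + ε_i` and `x + ε_j` have positive product. -/
theorem not_isRt_eps_sub_eps (i j : I) : ¬ D.IsRt (eps i - eps j) := by
  intro h
  by_cases hij : i = j
  · exact h.ne_zero (by rw [hij, sub_self])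
  have h1 := h.nonneg_of_pos (k := i) (by simp [eps_same, eps_ne hij]) j
  simp [eps_same, eps_ne (Ne.symm hij)] at h1

/-- A root is determined by its pairings with all `i`, and these lie between `-3` and `3`. -/
theorem finite_isRt (D : CartanDatum I) : {x | D.IsRt x}.Finite := by
  have h : Function.Injective fun (x : I → ℤ) (i : I) => D.pair i x := by
    intro x y hxy
    rw [← sub_eq_zero]
    by_contra h
    have h1 := D.B_pos h
    rw [B_eq_sum] at h1
    have h2 : ∀ i, D.pair i (x - y) = 0 := fun i => by
      rw [map_sub, sub_eq_zero]
      exact congrFun hxy i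
    simp [h2] at h1
  refine ((Set.finite_Icc (fun _ : I => (-3 : ℤ)) (fun _ => 3)).preimage h.injOn).subset ?_
  intro x hx
  exact ⟨fun i => (IsRt.pair_bounds hx i).1, fun i => (IsRt.pair_bounds hx i).2⟩

theorem finite_R (D : CartanDatum I) : D.R.Finite := by
  refine (D.finite_isRt.image D.emb).subset fun α hα => ?_
  obtain ⟨x, hx, rfl⟩ := (D.mem_R_iff_exists α).1 hα
  exact ⟨x, hx, rfl⟩

instance : Finite D.R := D.finite_R

/-! ### Root strings -/

theorem emb_add_nsmul (i : I) (x : I → ℤ) (n : ℕ) :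
    D.emb x + n • D.simpleRoot i = D.emb (x + (n : ℤ) • eps i) := by
  rw [map_add, map_smul, emb_eps, natCast_zsmul]

theorem emb_sub_nsmul (i : I) (x : I → ℤ) (n : ℕ) :
    D.emb x - n • D.simpleRoot i = D.emb (x - (n : ℤ) • eps i) := by
  rw [map_sub, map_smul, emb_eps, natCast_zsmul]

theorem q_emb (i : I) (x : I → ℤ) : D.q i (D.emb x) = D.p i (D.emb (-x)) := by
  rw [p, q]
  congr 1
  ext n
  refine forall₂_congr fun m _ => ?_
  rw [emb_add_nsmul, emb_sub_nsmul, emb_mem_R, emb_mem_R, ← isRt_neg_iff]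
  rw [show -(x - (m : ℤ) • eps i) = -x + (m : ℤ) • eps i by module]

theorem p_emb (i : I) (x : I → ℤ) : D.p i (D.emb x) = D.q i (D.emb (-x)) := by
  rw [q_emb, neg_neg]

theorem IsRt.add_of_le {x : I → ℤ} (hx : D.IsRt x) {i : I} {m : ℕ} (hm : m ≤ D.p i (D.emb x)) :
    D.IsRt (x + (m : ℤ) • eps i) := by
  have := D.add_mem (emb_mem_R D |>.2 hx) hm
  rwa [emb_add_nsmul, emb_mem_R] at this

theorem IsRt.not_add_succ {x : I → ℤ} (hx : D.IsRt x) (i : I) :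
    ¬ D.IsRt (x + ((D.p i (D.emb x) : ℤ) + 1) • eps i) := by
  intro h
  have hb : BddAbove {n : ℕ | ∀ m ≤ n, D.emb x + m • D.simpleRoot i ∈ D.R} := by
    refine ⟨(3 - D.pair i x).toNat, fun n hn => ?_⟩
    have h1 := hn n le_rfl
    rw [emb_add_nsmul, emb_mem_R] at h1
    have h2 := (h1.pair_bounds i).2
    rw [map_add, map_smul, pair_eps_self, smul_eq_mul] at h2
    omega
  have h1 : D.p i (D.emb x) + 1 ∈ {n : ℕ | ∀ m ≤ n, D.emb x + m • D.simpleRoot i ∈ D.R} := by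
    intro m hm
    rw [emb_add_nsmul, emb_mem_R]
    rcases Nat.lt_or_ge m (D.p i (D.emb x) + 1) with h2 | h2
    · exact hx.add_of_le (by omega)
    · have : m = D.p i (D.emb x) + 1 := by omega
      rw [this]; push_cast; exact h
  have h2 := le_csSup hb h1
  change D.p i (D.emb x) + 1 ≤ D.p i (D.emb x) at h2
  omega

theorem smul_eps_add_ne {x : I → ℤ} (hx : D.IsRt x) {i : I} (h1 : x ≠ eps i) (h2 : x ≠ -eps i)
    (n m : ℤ) : x + n • eps i ≠ m • eps i := by
  intro h
  have hx' : x = (m - n) • eps i := by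
    rw [sub_smul, ← h]; module
  obtain ⟨b1, b2⟩ := hx.pair_bounds i
  rw [hx', map_smul, pair_eps_self, smul_eq_mul] at b1 b2
  have b3 : -1 ≤ m - n := by omega
  have b4 : m - n ≤ 1 := by omega
  generalize m - n = k at *
  interval_cases k
  · exact h2 (by rw [hx']; module)
  · exact hx.ne_zero (by rw [hx']; module)
  · exact h1 (by rw [hx']; module)

/-- Strings have no gaps. At the last root before a gap the pairing with `i` is nonnegative, since
otherwise `ε_i` could be added; so it is positive at the first root after the gap, and `ε_i` can be
subtracted there. -/
theorem IsRt.le_p {x : I → ℤ} (hx : D.IsRt x) {i : I} (h1 : x ≠ eps i) (h2 : x ≠ -eps i)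
    {n : ℤ} (hn : D.IsRt (x + n • eps i)) : n ≤ D.p i (D.emb x) := by
  by_contra hlt
  push Not at hlt
  obtain ⟨k, hk⟩ := Int.eq_ofNat_of_zero_le (by omega : 0 ≤ n - D.p i (D.emb x))
  have hex : ∃ k : ℕ, 0 < k ∧ D.IsRt (x + ((D.p i (D.emb x) : ℤ) + k) • eps i) :=
    ⟨k, by omega, by
      have : (D.p i (D.emb x) : ℤ) + k = n := by omega
      rw [this]; exact hn⟩
  classical
  obtain ⟨hpos, hrt⟩ := Nat.find_spec hex
  have hmin := fun m hm => Nat.find_min hex (m := m) hm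
  generalize Nat.find hex = k at hpos hrt hmin
  have hp := hx.add_of_le (le_refl (D.p i (D.emb x)))
  have hd : (0 : ℤ) < D.d i := by exact_mod_cast D.d_pos i
  have hge : 0 ≤ D.pair i (x + (D.p i (D.emb x) : ℤ) • eps i) := by
    by_contra h
    apply hx.not_add_succ i
    have := hp.add (.simple i) (by rw [B_eps_right]; nlinarith) (by
      have := smul_eps_add_ne hx h1 h2 (D.p i (D.emb x)) (-1)
      simpa using this)
    rw [show x + ((D.p i (D.emb x) : ℤ) + 1) • eps i = x + (D.p i (D.emb x) : ℤ) • eps i + eps i by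
      module]
    exact this
  have hgt : 0 < D.pair i (x + ((D.p i (D.emb x) : ℤ) + k) • eps i) := by
    simp only [map_add, map_smul, pair_eps_self, smul_eq_mul] at hge ⊢
    omega
  have hk1 := hrt.sub (.simple i) (by rw [B_eps_right]; exact mul_pos hd hgt) (by
      have := smul_eps_add_ne hx h1 h2 ((D.p i (D.emb x) : ℤ) + k) 1
      simpa using this)
  rw [show x + ((D.p i (D.emb x) : ℤ) + k) • eps i - eps i =
    x + ((D.p i (D.emb x) : ℤ) + (k - 1 : ℤ)) • eps i by module] at hk1
  rcases Nat.lt_or_ge 1 k with h | h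
  · refine hmin (k - 1) (by omega) ⟨by omega, ?_⟩
    rwa [Nat.cast_sub hpos, Nat.cast_one]
  · have : k = 1 := by omega
    subst this
    exact hx.not_add_succ i (by simpa using hrt)

theorem IsRt.neg_q_le {x : I → ℤ} (hx : D.IsRt x) {i : I} (h1 : x ≠ eps i) (h2 : x ≠ -eps i)
    {n : ℤ} (hn : D.IsRt (x + n • eps i)) : -(D.q i (D.emb x) : ℤ) ≤ n := by
  have h := hx.neg.le_p (i := i) (n := -n) (fun h => h2 (by rw [← h, neg_neg]))
    (fun h => h1 (neg_injective h)) (by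
      rw [← isRt_neg_iff]
      convert hn using 1
      module)
  rw [← q_emb] at h
  omega

theorem IsRt.sub_of_le {x : I → ℤ} (hx : D.IsRt x) {i : I} {m : ℕ} (hm : m ≤ D.q i (D.emb x)) :
    D.IsRt (x - (m : ℤ) • eps i) := by
  rw [q_emb] at hm
  have := (hx.neg.add_of_le hm).neg
  convert this using 1
  module

theorem IsRt.add_zsmul_iff {x : I → ℤ} (hx : D.IsRt x) {i : I} (h1 : x ≠ eps i)
    (h2 : x ≠ -eps i) (n : ℤ) :
    D.IsRt (x + n • eps i) ↔ -(D.q i (D.emb x) : ℤ) ≤ n ∧ n ≤ D.p i (D.emb x) := by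
  refine ⟨fun h => ⟨hx.neg_q_le h1 h2 h, hx.le_p h1 h2 h⟩, fun ⟨ha, hb⟩ => ?_⟩
  obtain ⟨m, rfl | rfl⟩ := n.eq_nat_or_neg
  · exact hx.add_of_le (by omega)
  · have := hx.sub_of_le (i := i) (m := m) (by omega)
    convert this using 1
    module

/-- The reflection `s_i` reverses the string; compare the images of its two ends with the ends
themselves. -/
theorem IsRt.q_sub_p {x : I → ℤ} (hx : D.IsRt x) {i : I} (h1 : x ≠ eps i) (h2 : x ≠ -eps i) :
    (D.q i (D.emb x) : ℤ) - D.p i (D.emb x) = D.pair i x := by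
  have ha := ((hx.add_of_le (le_refl (D.p i (D.emb x)))).reflect i)
  have hb := ((hx.sub_of_le (le_refl (D.q i (D.emb x)))).reflect i)
  rw [refl, map_add, map_smul, pair_eps_self, smul_eq_mul] at ha
  rw [refl, map_sub, map_smul, pair_eps_self, smul_eq_mul] at hb
  rw [show x + (D.p i (D.emb x) : ℤ) • eps i - (D.pair i x + (D.p i (D.emb x) : ℤ) * 2) • eps i =
    x + (-(D.p i (D.emb x) : ℤ) - D.pair i x) • eps i by module] at ha
  rw [show x - (D.q i (D.emb x) : ℤ) • eps i - (D.pair i x - (D.q i (D.emb x) : ℤ) * 2) • eps i =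
    x + ((D.q i (D.emb x) : ℤ) - D.pair i x) • eps i by module] at hb
  have a1 := hx.neg_q_le h1 h2 ha
  have b1 := hx.le_p h1 h2 hb
  omega

theorem p_eps (i : I) : D.p i (D.emb (eps i)) = 0 := by
  by_contra h
  have h1 := (IsRt.simple (D := D) i).add_of_le (i := i) (m := 1) (by omega)
  exact h1.not_two_smul (eps i) (by rw [Nat.cast_one]; module)

/-- Zero is not a root, so the string from `-ε_i` stops at once although `ε_i` is a root. This is
why `±ε_i` are excluded from the general facts on strings. -/
theorem p_neg_eps (i : I) : D.p i (D.emb (-eps i)) = 0 := by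
  by_contra h
  have h1 := (IsRt.simple (D := D) i).neg.add_of_le (i := i) (m := 1) (by omega)
  exact h1.ne_zero (by rw [Nat.cast_one]; module)

theorem one_le_p_iff {x : I → ℤ} (hx : D.IsRt x) (i : I) :
    1 ≤ D.p i (D.emb x) ↔ D.IsRt (x + eps i) := by
  constructor
  · intro h
    simpa using hx.add_of_le h
  · intro h
    by_contra h0
    have h0 : D.p i (D.emb x) = 0 := by omega
    apply hx.not_add_succ i
    rw [h0]
    simpa using h

theorem one_le_q_iff {x : I → ℤ} (hx : D.IsRt x) (i : I) :
    1 ≤ D.q i (D.emb x) ↔ D.IsRt (x - eps i) := by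
  rw [q_emb, one_le_p_iff hx.neg, ← isRt_neg_iff]
  rw [show -(-x + eps i) = x - eps i by module]

theorem IsRt.p_le_three {x : I → ℤ} (hx : D.IsRt x) (i : I) : D.p i (D.emb x) ≤ 3 := by
  by_cases h1 : x = eps i
  · rw [h1, p_eps]; omega
  by_cases h2 : x = -eps i
  · rw [h2, p_neg_eps]; omega
  have h := hx.q_sub_p h1 h2
  have hp := (hx.add_of_le (le_refl (D.p i (D.emb x)))).pair_bounds i
  rw [map_add, map_smul, pair_eps_self, smul_eq_mul] at hp
  omega

theorem IsRt.p_add_q_le {x : I → ℤ} (hx : D.IsRt x) {i : I} (h1 : x ≠ eps i) (h2 : x ≠ -eps i) :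
    D.p i (D.emb x) + D.q i (D.emb x) ≤ 3 := by
  have h := hx.q_sub_p h1 h2
  have hp := (hx.add_of_le (le_refl (D.p i (D.emb x)))).pair_bounds i
  rw [map_add, map_smul, pair_eps_self, smul_eq_mul] at hp
  omega

theorem IsRt.p_add_eps {x : I → ℤ} (hx : D.IsRt x) {i : I} (h : D.IsRt (x + eps i)) :
    D.p i (D.emb x) = D.p i (D.emb (x + eps i)) + 1 ∧
      D.q i (D.emb (x + eps i)) = D.q i (D.emb x) + 1 := by
  have h1 : x ≠ eps i := by
    rintro rfl
    exact h.not_two_smul (eps i) (by module)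
  have h2 : x ≠ -eps i := by
    rintro rfl
    exact h.ne_zero (by module)
  have h1' : x + eps i ≠ eps i := fun e => hx.ne_zero (by simpa using e)
  have h2' : x + eps i ≠ -eps i := fun e => hx.not_two_smul (-eps i) (by
    rw [eq_sub_of_add_eq e]; module)
  have a := hx.q_sub_p h1 h2
  have b := h.q_sub_p h1' h2'
  rw [(D.pair i).map_add, pair_eps_self] at b
  have c := hx.le_p h1 h2 (n := (D.p i (D.emb (x + eps i)) : ℤ) + 1) (by
    convert h.add_of_le (le_refl (D.p i (D.emb (x + eps i)))) using 1
    module)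
  have c1 := (one_le_p_iff hx i).2 h
  have d := h.le_p h1' h2' (n := (D.p i (D.emb x) : ℤ) - 1) (by
    convert hx.add_of_le (le_refl (D.p i (D.emb x))) using 1
    module)
  omega

/-- Two roots in the same string of length at least two determine the norm. -/
theorem IsRt.norm_bottom {x : I → ℤ} (hx : D.IsRt x) {i : I} (h1 : x ≠ eps i) (h2 : x ≠ -eps i)
    (hL : 2 ≤ D.p i (D.emb x) + D.q i (D.emb x)) :
    D.B (x - (D.q i (D.emb x) : ℤ) • eps i) (x - (D.q i (D.emb x) : ℤ) • eps i) =
      2 * D.d i * (D.p i (D.emb x) + D.q i (D.emb x)) := by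
  have hb := hx.sub_of_le (le_refl (D.q i (D.emb x)))
  have h := hx.q_sub_p h1 h2
  have e : x - (D.q i (D.emb x) : ℤ) • eps i = x + (-(D.q i (D.emb x) : ℤ)) • eps i := by module
  obtain ⟨n, hn, -, -, -, hn1⟩ := hb.pair_cases (i := i)
    (by
      have := smul_eps_add_ne hx h1 h2 (-(D.q i (D.emb x) : ℤ)) 1
      rwa [one_smul, ← e] at this)
    (by
      have := smul_eps_add_ne hx h1 h2 (-(D.q i (D.emb x) : ℤ)) (-1)
      rwa [neg_one_smul, ← e] at this)
  have hp : D.pair i (x - (D.q i (D.emb x) : ℤ) • eps i) =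
      -((D.p i (D.emb x) : ℤ) + D.q i (D.emb x)) := by
    rw [map_sub, map_smul, pair_eps_self, smul_eq_mul]; omega
  rw [hp] at hn hn1
  -- At the bottom the pairing is `-(p + q) ≤ -2`, so the opposite Cartan integer is `-1` and fixes
  -- the norm.
  rw [hn1 (by omega)] at hn
  linarith

theorem IsRt.norm_eq {x : I → ℤ} (hx : D.IsRt x) {i : I} (h1 : x ≠ eps i) (h2 : x ≠ -eps i)
    (hL : 2 ≤ D.p i (D.emb x) + D.q i (D.emb x)) :
    D.B x x = 2 * D.d i * (D.p i (D.emb x) + D.q i (D.emb x) -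
      D.q i (D.emb x) * D.p i (D.emb x)) := by
  have h := hx.norm_bottom h1 h2 hL
  have hq := hx.q_sub_p h1 h2
  simp only [map_sub, map_smul, LinearMap.sub_apply, LinearMap.smul_apply, smul_eq_mul, B_eps,
    B_eps_right, pair_eps_self] at h
  rw [← hq] at h
  linear_combination h

/-! ### Squares of roots -/

/-- Otherwise `⟨i, x⟩ ≥ 0` and `⟨j, x⟩ ≥ 2`, the latter giving `B(x, x) = 2 B(x, ε_j)`. Then `B(x, x
+ ε_i - ε_j) > 0`, and the difference `ε_j - ε_i` would be a root. -/
theorem IsRt.add_eps_of_square {x : I → ℤ} (hx : D.IsRt x) {i j : I} (hij : i ≠ j)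
    (hxj : D.IsRt (x - eps j)) (hz : D.IsRt (x + eps i - eps j)) (hi : x ≠ -eps i) :
    D.IsRt (x + eps i) := by
  by_contra hni
  have hd : (0 : ℤ) < D.d i := by exact_mod_cast D.d_pos i
  have hdj : (0 : ℤ) < D.d j := by exact_mod_cast D.d_pos j
  have h1 : 0 ≤ D.pair i x := by
    by_contra h
    exact hni (hx.add (.simple i) (by rw [B_eps_right]; nlinarith) hi)
  have h2 : 0 ≤ D.pair j (x + eps i - eps j) := by
    by_contra h
    apply hni
    have := hz.add (.simple j) (by rw [B_eps_right]; nlinarith) (by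
      intro e
      apply hi
      rw [sub_eq_iff_eq_add, neg_add_cancel] at e
      exact eq_neg_of_add_eq_zero_left e)
    simpa using this
  rw [map_sub, map_add, pair_eps_self, pair_eps] at h2
  have hc := D.cartan_nonpos (Ne.symm hij)
  have hxj1 : x ≠ eps j := by
    rintro rfl
    exact hxj.ne_zero (sub_self _)
  have hxj2 : x ≠ -eps j := by
    rintro rfl
    rw [map_neg, pair_eps_self] at h2
    omega
  obtain ⟨n, hn, -, -, hn1, -⟩ := hx.pair_cases hxj1 hxj2
  rw [hn1 (by omega), one_mul] at hn
  have h3 : D.B x (x + eps i - eps j) ≤ 0 := by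
    by_contra h
    have := hx.sub hz (by omega) (by
      intro e
      apply hij
      apply eps_injective
      rw [eq_sub_iff_add_eq] at e
      exact (add_left_cancel e).symm)
    apply not_isRt_eps_sub_eps (D := D) j i
    convert this using 1
    module
  rw [map_sub, map_add, B_eps_right, B_eps_right] at h3
  have := hx.B_pos
  nlinarith [mul_nonneg hd.le h1]

/-- Cartan integers rewritten as constraints on the norm of one root `f`, so that the constraints
from several roots `e` can be combined by linear arithmetic. -/
theorem IsRt.cartan_norm {e f : I → ℤ} (he : D.IsRt e) (hf : D.IsRt f) (h1 : f ≠ e)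
    (h2 : f ≠ -e) {w N : ℤ} (hN : D.B e e = N) (hw : 2 * D.B e f = w * N) :
    -3 ≤ w ∧ w ≤ 3 ∧ (w = 2 → D.B f f = 2 * N) ∧ (w = 3 → D.B f f = 3 * N) ∧
      (w = -2 → D.B f f = 2 * N) ∧ (w = -3 → D.B f f = 3 * N) ∧
      (w = 1 ∨ w = -1 → D.B f f ≤ N) := by
  obtain ⟨m, n, hm, hn, h0, h3, hz⟩ := he.cartan_cases hf h1 h2
  have hN0 := he.B_pos
  have hf0 := hf.B_pos
  rw [hN] at hm hN0
  have : w = m := by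
    apply mul_right_cancel₀ hN0.ne'
    rw [← hm, hw]
  subst this
  obtain ⟨a1, a2, a3, a4, a5, a6, a7, a8, a9⟩ := int_cases h0 h3 hz
  rw [hm] at hn
  refine ⟨a1, a2, fun h => ?_, fun h => ?_, fun h => ?_, fun h => ?_, fun h => ?_⟩
  · rw [h, a5 (by omega)] at hn; omega
  · rw [h, a5 (by omega)] at hn; omega
  · rw [h, a6 (by omega)] at hn; omega
  · rw [h, a6 (by omega)] at hn; omega
  · rcases h with h | h
    · have : 0 < n := a9.1 (by omega)
      rw [h] at hn
      nlinarith
    · have : n < 0 := by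
        subst h
        have : n ≠ 0 := fun h => by simp [h] at hz
        have : ¬ 0 < n := fun h => by simp [h] at a9
        omega
      rw [h] at hn
      nlinarith

/-- Four roots `x`, `x + i`, `x + j`, `x + i + j` do not occur together with a string of type
`G₂`. -/
theorem IsRt.p_add_q_le_two {x : I → ℤ} (hx : D.IsRt x) {i j : I} (hij : i ≠ j)
    (hxi : D.IsRt (x + eps i)) (hxj : D.IsRt (x + eps j)) (hxij : D.IsRt (x + eps i + eps j)) :
    D.p i (D.emb x) + D.q i (D.emb x) ≤ 2 := by
  have h1 : x ≠ eps i := by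
    rintro rfl
    exact hxi.not_two_smul (eps i) (by module)
  have h2 : x ≠ -eps i := by
    rintro rfl
    exact hxi.ne_zero (by module)
  by_contra hL
  have hL3 := hx.p_add_q_le h1 h2
  have hq := hx.q_sub_p h1 h2
  have hbot := hx.norm_bottom h1 h2 (by omega)
  have hnorm := hx.norm_eq h1 h2 (by omega)
  have hstr := hx.add_zsmul_iff h1 h2
  have hp1 := (one_le_p_iff hx i).2 hxi
  generalize hP : D.p i (D.emb x) = P at *
  generalize hQ : D.q i (D.emb x) = Q at *
  have hPQ : (P : ℤ) = 3 - Q := by omega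
  rw [hPQ] at hnorm hbot hq
  have hd : (0 : ℤ) < D.d i := by exact_mod_cast D.d_pos i
  have hj : D.IsRt (eps j) := .simple j
  -- If `ε_j` were `±(x + t ε_i)`, then `x + ε_j` or `x + ε_i + ε_j`, according to the parity of
  -- `t`, would be twice a lattice vector.
  have ne1 : ∀ t : ℤ, eps j ≠ x + t • eps i := by
    intro t e
    obtain ⟨n, rfl | rfl⟩ := t.even_or_odd'
    · exact hxj.not_two_smul (eps j - n • eps i) (by
        rw [eq_sub_of_add_eq e.symm]; module)
    · exact hxij.not_two_smul (eps j - n • eps i) (by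
        rw [eq_sub_of_add_eq e.symm]; module)
  have ne2 : ∀ t : ℤ, eps j ≠ -(x + t • eps i) := by
    intro t e
    have e' : x = -eps j - t • eps i := by rw [e]; module
    obtain ⟨n, rfl | rfl⟩ := t.even_or_odd'
    · exact hxj.not_two_smul (- n • eps i) (by rw [e']; module)
    · exact hxij.not_two_smul (- n • eps i) (by rw [e']; module)
  have root : ∀ k : ℤ, 0 ≤ k → k ≤ 3 → D.IsRt (x + (k - Q) • eps i) := fun k h0 h3 =>
    (hstr _).2 ⟨by omega, by omega⟩
  set b := x - (Q : ℤ) • eps i with hb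
  have hbk : ∀ k : ℤ, x + (k - Q) • eps i = b + k • eps i := fun k => by rw [hb]; module
  have hxb : x = b + (Q : ℤ) • eps i := by rw [hb]; module
  have hbr : D.IsRt b := by
    have := root 0 le_rfl (by norm_num)
    rw [hbk] at this
    simpa using this
  have hBb : D.B b b = 6 * D.d i := by rw [hbot]; ring
  have hpb : D.pair i b = -3 := by
    rw [hb, map_sub, map_smul, pair_eps_self, smul_eq_mul, ← hq]; ring
  obtain ⟨m, hm⟩ := hbr.dvd (eps j)
  rw [hBb] at hm
  have hm' : D.B b (eps j) = 3 * D.d i * m := by linarith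
  have hs : D.B (eps i) (eps j) = D.d i * D.cartan i j := by rw [B_eps, pair_eps]
  have hs0 := D.cartan_nonpos hij
  generalize D.cartan i j = s at hs hs0
  have nrm : ∀ k : ℤ, D.B (b + k • eps i) (b + k • eps i) = (6 - 6 * k + 2 * k ^ 2) * D.d i := by
    intro k
    simp only [map_add, map_smul, LinearMap.add_apply, LinearMap.smul_apply, smul_eq_mul, B_eps,
      B_eps_right, pair_eps_self, hpb, hBb]
    ring
  have prd : ∀ k : ℤ, D.B (b + k • eps i) (eps j) = D.d i * (3 * m + k * s) := by
    intro k
    simp only [map_add, map_smul, LinearMap.add_apply, LinearMap.smul_apply, smul_eq_mul, hs, hm']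
    ring
  have fact : ∀ k : ℤ, 0 ≤ k → k ≤ 3 → ∀ w : ℤ, 2 * (3 * m + k * s) = w * (6 - 6 * k + 2 * k ^ 2) →
      -3 ≤ w ∧ w ≤ 3 ∧
      (w = 2 → D.B (eps j) (eps j) = 2 * ((6 - 6 * k + 2 * k ^ 2) * D.d i)) ∧
      (w = 3 → D.B (eps j) (eps j) = 3 * ((6 - 6 * k + 2 * k ^ 2) * D.d i)) ∧
      (w = -2 → D.B (eps j) (eps j) = 2 * ((6 - 6 * k + 2 * k ^ 2) * D.d i)) ∧
      (w = -3 → D.B (eps j) (eps j) = 3 * ((6 - 6 * k + 2 * k ^ 2) * D.d i)) ∧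
      (w = 1 ∨ w = -1 → D.B (eps j) (eps j) ≤ (6 - 6 * k + 2 * k ^ 2) * D.d i) := by
    intro k h0 h3 w hw
    have hr := root k h0 h3
    rw [hbk] at hr
    refine hr.cartan_norm hj ?_ ?_ (nrm k) ?_
    · rw [← hbk]; exact ne1 _
    · rw [← hbk]; exact ne2 _
    · rw [prd]; linear_combination (D.d i : ℤ) * hw
  have f0 := fact 0 (by norm_num) (by norm_num) m (by ring)
  have f1 := fact 1 (by norm_num) (by norm_num) (3 * m + s) (by ring)
  have f2 := fact 2 (by norm_num) (by norm_num) (3 * m + 2 * s) (by ring)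
  have f3 := fact 3 (by norm_num) (by norm_num) (m + s) (by ring)
  have fi := (IsRt.simple (D := D) i).cartan_norm hj (w := s) (N := 2 * D.d i)
    (fun e => hij (eps_injective e).symm)
    (fun e => by
      have := congrFun e j
      rw [eps_same, Pi.neg_apply, eps_ne (Ne.symm hij)] at this
      omega)
    (by rw [B_eps, pair_eps_self]; ring) (by rw [hs]; ring)
  have hr3 := root 3 (by norm_num) (by norm_num)
  rw [hbk] at hr3
  -- The string `b, …, b + 3 ε_i` and `ε_i` generate a system of type `G₂`. Its remaining long root
  -- `2 b + 3 ε_i` supplies one more Cartan integer for `ε_j`.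
  have hbig : D.IsRt (b + (b + (3 : ℤ) • eps i)) := by
    apply hbr.add hr3
    · rw [map_add, map_smul, B_eps_right, hpb, hBb, smul_eq_mul]
      linarith
    · intro e
      have : D.pair i b = -(D.pair i b + 3 * 2) := by
        conv_lhs => rw [e]
        rw [map_neg, map_add, map_smul, pair_eps_self, smul_eq_mul]
      have h4 := D.B_pos hbr.ne_zero
      have h5 : (2 : ℤ) • b = (-3 : ℤ) • eps i := by
        nth_rewrite 1 [show (2 : ℤ) • b = b + b by module]
        nth_rewrite 1 [e]
        module
      have := congrFun h5 i
      rw [Pi.smul_apply, Pi.smul_apply, eps_same, smul_eq_mul, smul_eq_mul] at this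
      omega
  have fb := hbig.cartan_norm hj (w := 2 * m + s) (N := 6 * D.d i)
    (fun e => by
      have := congrFun e i
      rw [eps_ne hij] at this
      simp only [Pi.add_apply, Pi.smul_apply, eps_same, smul_eq_mul] at this
      omega)
    (fun e => by
      have := congrFun e i
      rw [eps_ne hij] at this
      simp only [Pi.neg_apply, Pi.add_apply, Pi.smul_apply, eps_same, smul_eq_mul] at this
      omega)
    (by
      simp only [map_add, map_smul, LinearMap.add_apply, LinearMap.smul_apply, smul_eq_mul, B_eps,
        B_eps_right, pair_eps_self, hpb, hBb]
      ring)
    (by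
      rw [LinearMap.map_add, LinearMap.add_apply, prd, hm']; ring)
  have hj0 : 0 < D.B (eps j) (eps j) := hj.B_pos
  generalize D.B (eps j) (eps j) = N at *
  norm_num at f0 f1 f2 f3
  -- The constraints force `ε_j` to be orthogonal to the whole `G₂` system.
  have hsm : s = 0 ∧ m = 0 := by
    obtain ⟨s1, s2, s3⟩ := fi
    obtain ⟨m1, m2, m3⟩ := f0
    clear fact prd nrm root hstr ne1 ne2 hnorm hbot
    interval_cases s <;> interval_cases m <;> omega
  obtain ⟨rfl, rfl⟩ := hsm
  -- By orthogonality the product is `B(x, x + ε_i)`, that is `3 d_i`, `d_i` or `3 d_i` for `Q = 0,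
  -- 1, 2`; so `ε_j - ε_i` would be a root.
  have hfin : 0 < D.B (x + eps j) (x + eps i) := by
    have e1 : D.B x (eps j) = 0 := by
      rw [hxb, LinearMap.map_add, LinearMap.add_apply, LinearMap.map_smul, LinearMap.smul_apply,
        hm', hs]
      simp
    simp only [LinearMap.map_add, LinearMap.add_apply, D.B_comm (eps j), e1, hs, hnorm,
      B_eps_right, ← hq]
    have : Q ≤ 2 := by omega
    clear fact prd nrm root hstr ne1 ne2
    interval_cases Q <;> norm_num <;> linarith
  apply not_isRt_eps_sub_eps (D := D) j i
  have := hxj.sub hxi hfin (fun e => hij (eps_injective (add_left_cancel e)).symm)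
  convert this using 1
  module

/-- The four edges of a square, in numbers: `P₁, Q₁` and `P₂, Q₂` are the `i`-strings through `x`
and `x + ε_j`, `P₃, Q₃` and `P₄, Q₄` the `j`-strings through `x` and `x + ε_i`; `a = d_i`, `b = d_j`
and `N = B(x, x)`. Each pair has three possible values. -/
theorem square_arith {a b P₁ Q₁ P₂ Q₂ P₃ Q₃ P₄ Q₄ : ℕ} {N c c' : ℤ} (ha : 0 < a) (hb : 0 < b)
    (l₁ : P₁ + Q₁ ≤ 2) (l₂ : P₂ + Q₂ ≤ 2) (l₃ : P₃ + Q₃ ≤ 2) (l₄ : P₄ + Q₄ ≤ 2)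
    (o₁ : 1 ≤ P₁) (o₂ : 1 ≤ P₂) (o₃ : 1 ≤ P₃) (o₄ : 1 ≤ P₄)
    (h₂ : (Q₂ : ℤ) - P₂ = Q₁ - P₁ + c) (h₄ : (Q₄ : ℤ) - P₄ = Q₃ - P₃ + c')
    (hc : (a : ℤ) * c = b * c')
    (n₁ : 2 ≤ P₁ + Q₁ → N = 2 * a * (P₁ + Q₁ - Q₁ * P₁))
    (n₂ : 2 ≤ P₂ + Q₂ → N + 2 * b * (Q₃ - P₃) + 2 * b = 2 * a * (P₂ + Q₂ - Q₂ * P₂))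
    (n₃ : 2 ≤ P₃ + Q₃ → N = 2 * b * (P₃ + Q₃ - Q₃ * P₃))
    (n₄ : 2 ≤ P₄ + Q₄ → N + 2 * a * (Q₁ - P₁) + 2 * a = 2 * b * (P₄ + Q₄ - Q₄ * P₄))
    (hB : N + a * (Q₁ - P₁) + b * (Q₃ - P₃) + a * c ≤ 0) :
    (Q₁ = Q₂ ∧ P₃ = P₄) ∨ (a = b ∧ Q₁ + 1 = P₄ ∧ P₃ = Q₂ + 1) := by
  have cases : ∀ {P Q : ℕ}, P + Q ≤ 2 → 1 ≤ P →
      (P = 1 ∧ Q = 0) ∨ (P = 1 ∧ Q = 1) ∨ (P = 2 ∧ Q = 0) := by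
    intro P Q h1 h2
    omega
  have hc1 : c = Q₂ - P₂ - (Q₁ - P₁) := by omega
  have hc1' : c' = Q₄ - P₄ - (Q₃ - P₃) := by omega
  subst hc1 hc1'
  clear h₂ h₄
  rcases cases l₁ o₁ with ⟨rfl, rfl⟩ | ⟨rfl, rfl⟩ | ⟨rfl, rfl⟩ <;>
  rcases cases l₂ o₂ with ⟨rfl, rfl⟩ | ⟨rfl, rfl⟩ | ⟨rfl, rfl⟩ <;>
  rcases cases l₃ o₃ with ⟨rfl, rfl⟩ | ⟨rfl, rfl⟩ | ⟨rfl, rfl⟩ <;>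
  rcases cases l₄ o₄ with ⟨rfl, rfl⟩ | ⟨rfl, rfl⟩ | ⟨rfl, rfl⟩ <;>
  norm_num at n₁ n₂ n₃ n₄ hB hc ⊢ <;> omega

/-- All strings in the square satisfy `p + q ≤ 2`, which leaves finitely many cases; norms and `B(x
+ ε_i, x + ε_j) ≤ 0` decide them. Either alternative makes the two products of quantum integers in
`E_i F_j` and `F_j E_i` equal. -/
theorem IsRt.square {x : I → ℤ} (hx : D.IsRt x) {i j : I} (hij : i ≠ j)
    (hxi : D.IsRt (x + eps i)) (hxj : D.IsRt (x + eps j)) (hxij : D.IsRt (x + eps i + eps j)) :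
    (D.q i (D.emb x) = D.q i (D.emb (x + eps j)) ∧ D.p j (D.emb x) = D.p j (D.emb (x + eps i))) ∨
    (D.d i = D.d j ∧ D.q i (D.emb x) + 1 = D.p j (D.emb (x + eps i)) ∧
      D.p j (D.emb x) = D.q i (D.emb (x + eps j)) + 1) := by
  have gen : ∀ {y : I → ℤ} {k : I}, D.IsRt y → D.IsRt (y + eps k) → y ≠ eps k ∧ y ≠ -eps k := by
    intro y k hy hyk
    constructor
    · rintro rfl
      exact hyk.not_two_smul (eps k) (by module)
    · rintro rfl
      exact hyk.ne_zero (by module)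
  have hxji : D.IsRt (x + eps j + eps i) := by rwa [add_right_comm]
  have top : ∀ {i j : I}, i ≠ j → D.IsRt (x + eps i) → D.IsRt (x + eps j) →
      D.IsRt (x + eps i + eps j) →
      D.p i (D.emb (x + eps j)) + D.q i (D.emb (x + eps j)) ≤ 2 := by
    intro i j hij hxi hxj hxij
    have hxji : D.IsRt (x + eps j + eps i) := by rwa [add_right_comm]
    have h := hxij.neg.p_add_q_le_two hij
      (by convert hxj.neg using 1; module) (by convert hxi.neg using 1; module)
      (by convert hx.neg using 1; module)
    rw [← q_emb, ← p_emb] at h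
    obtain ⟨a, b⟩ := hxj.p_add_eps hxji
    rw [add_right_comm] at h
    omega
  have l1 := hx.p_add_q_le_two hij hxi hxj hxij
  have l3 := hx.p_add_q_le_two hij.symm hxj hxi hxji
  have l2 := top hij hxi hxj hxij
  have l4 := top hij.symm hxj hxi hxji
  obtain ⟨g1, g1'⟩ := gen hx hxi
  obtain ⟨g2, g2'⟩ := gen hxj hxji
  obtain ⟨g3, g3'⟩ := gen hx hxj
  obtain ⟨g4, g4'⟩ := gen hxi hxij
  have c1 := hx.q_sub_p g1 g1'
  have c2 := hxj.q_sub_p g2 g2'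
  have c3 := hx.q_sub_p g3 g3'
  have c4 := hxi.q_sub_p g4 g4'
  have n1 := hx.norm_eq g1 g1'
  have n2 := hxj.norm_eq g2 g2'
  have n3 := hx.norm_eq g3 g3'
  have n4 := hxi.norm_eq g4 g4'
  have o1 := (one_le_p_iff hx i).2 hxi
  have o2 := (one_le_p_iff hxj i).2 hxji
  have o3 := (one_le_p_iff hx j).2 hxj
  have o4 := (one_le_p_iff hxi j).2 hxij
  have hc := D.d_mul_cartan i j
  have hB : D.B (x + eps i) (x + eps j) ≤ 0 := by
    by_contra h
    apply not_isRt_eps_sub_eps (D := D) i j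
    have := hxi.sub hxj (by omega) (fun e => hij (eps_injective (add_left_cancel e)))
    convert this using 1
    module
  rw [LinearMap.map_add (D.pair i), pair_eps] at c2
  rw [LinearMap.map_add (D.pair j), pair_eps] at c4
  have ei : D.B (x + eps i) (x + eps i) = D.B x x + 2 * D.d i * D.pair i x + 2 * D.d i := by
    simp only [LinearMap.map_add, LinearMap.add_apply, B_eps, B_eps_right, pair_eps_self]; ring
  have ej : D.B (x + eps j) (x + eps j) = D.B x x + 2 * D.d j * D.pair j x + 2 * D.d j := by
    simp only [LinearMap.map_add, LinearMap.add_apply, B_eps, B_eps_right, pair_eps_self]; ring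
  have eij : D.B (x + eps i) (x + eps j) = D.B x x + D.d i * D.pair i x + D.d j * D.pair j x +
      D.d i * D.cartan i j := by
    simp only [LinearMap.map_add, LinearMap.add_apply, B_eps, B_eps_right, pair_eps]
    linear_combination -hc
  rw [ei] at n4
  rw [ej] at n2
  rw [eij] at hB
  have hd := D.d_pos i
  have hdj := D.d_pos j
  rw [← c1] at c2 n4 hB
  rw [← c3] at c4 n2 hB
  exact square_arith hd hdj l1 l2 l3 l4 o1 o2 o3 o4 c2 c4 hc n1 n2 n3 n4 hB

/-! ### Dominant roots and the highest root -/

theorem IsRt.nonneg_of_dominant {x : I → ℤ} (hx : D.IsRt x) (hdom : ∀ i, 0 ≤ D.pair i x) :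
    0 ≤ x := by
  rcases hx.nonneg_or_nonpos with h | h
  · exact h
  · exfalso
    have h1 := hx.B_pos
    rw [B_eq_sum] at h1
    refine absurd h1 (not_lt.2 (Finset.sum_nonpos fun i _ => ?_))
    exact mul_nonpos_of_nonpos_of_nonneg (h i) (mul_nonneg (by positivity) (hdom i))

theorem B_nonneg_of_dominant {x y : I → ℤ} (hdom : ∀ i, 0 ≤ D.pair i x) (hy : 0 ≤ y) :
    0 ≤ D.B x y := by
  rw [B_comm, B_eq_sum]
  exact Finset.sum_nonneg fun i _ => mul_nonneg (hy i) (mul_nonneg (by positivity) (hdom i))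

/-- The pairing of `x + ε_i` with `i` is at least `2`, so the opposite Cartan integer is `1`. -/
theorem norm_eq_of_dominant {x : I → ℤ} (hdom : ∀ i, 0 ≤ D.pair i x) (hx : x ≠ 0)
    {i : I} (hi : D.IsRt (x + eps i)) : D.B x x = 2 * D.d i := by
  have h1 : x + eps i ≠ eps i := fun e => hx (by simpa using e)
  have h2 : x + eps i ≠ -eps i := by
    intro e
    have h := hdom i
    rw [eq_sub_of_add_eq e, map_sub, map_neg, pair_eps_self] at h
    omega
  obtain ⟨n, hn, -, -, h3, -⟩ := hi.pair_cases h1 h2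
  have h := hdom i
  rw [map_add, pair_eps_self] at h3
  rw [h3 (by omega)] at hn
  simp only [LinearMap.map_add, LinearMap.add_apply, B_eps, B_eps_right, pair_eps_self] at hn
  linarith

/-- A dominant root is covered by at most one root. -/
theorem IsRt.eq_of_add_eps {x : I → ℤ} (hx : D.IsRt x) (hdom : ∀ i, 0 ≤ D.pair i x) {i j : I}
    (hi : D.IsRt (x + eps i)) (hj : D.IsRt (x + eps j)) : i = j := by
  by_contra hij
  have n1 := norm_eq_of_dominant hdom hx.ne_zero hi
  have n2 := norm_eq_of_dominant hdom hx.ne_zero hj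
  have hd : (0 : ℤ) < D.d i := by exact_mod_cast D.d_pos i
  have hdd : (D.d i : ℤ) = D.d j := by omega
  -- For simple roots of equal length the two Cartan integers coincide, and their product is at most
  -- `3`.
  have hc : -1 ≤ D.pair i (eps j) := by
    obtain ⟨m, n, hm, hn, h0, h3, hz⟩ := (IsRt.simple (D := D) i).cartan_cases (.simple j)
      (fun e => hij (eps_injective e).symm) (fun e => by
        have := congrFun e j
        rw [eps_same, Pi.neg_apply, eps_ne (Ne.symm hij)] at this
        omega)
    rw [B_eps, B_eps, pair_eps_self] at hm
    rw [B_eps, B_eps, pair_eps_self, ← hdd] at hn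
    have e1 : D.pair i (eps j) = m := mul_left_cancel₀ hd.ne' (by linarith)
    have e2 : D.pair i (eps j) = n := mul_left_cancel₀ hd.ne' (by linarith)
    rw [← e1, ← e2] at h3
    nlinarith
  apply not_isRt_eps_sub_eps (D := D) i j
  have := hi.sub hj (by
    simp only [LinearMap.map_add, LinearMap.add_apply, B_eps, B_eps_right, n1]
    have a1 := hdom i
    have a2 := hdom j
    have e : D.pair j (eps i) = D.pair i (eps j) := by
      have h := D.d_mul_cartan i j
      rw [← hdd] at h
      rw [pair_eps, pair_eps]
      exact (mul_left_cancel₀ hd.ne' h).symm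
    rw [← hdd, e]
    have h1 := mul_nonneg hd.le a1
    have h2 := mul_nonneg hd.le a2
    have h3 := mul_nonneg hd.le (by linarith : 0 ≤ D.pair i (eps j) + 1)
    linarith) (fun e => hij (eps_injective (add_left_cancel e)))
  convert this using 1
  module

theorem isRt_or_zero_of_dominant {x : I → ℤ} (hdom : ∀ i, 0 ≤ D.pair i x) {i : I}
    (hi : D.IsRt (x + eps i) ∨ x + eps i = 0) : D.IsRt x ∨ x = 0 := by
  have h := hdom i
  rcases hi with hi | hi
  · by_cases h0 : x = 0
    · exact Or.inr h0
    · left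
      have hd : (0 : ℤ) < D.d i := by exact_mod_cast D.d_pos i
      have := hi.sub (.simple i) (by
        rw [B_eps_right, map_add, pair_eps_self]
        nlinarith) (fun e => h0 (by simpa using e))
      simpa using this
  · rw [eq_neg_of_add_eq_zero_left hi, map_neg, pair_eps_self] at h
    omega

/-- If the support were proper, irreducibility would link some `j` outside it to the support, and
then `⟨j, x⟩ < 0`. -/
theorem IsRt.pos_of_dominant (hD : D.IsIrreducible) {x : I → ℤ} (hx : D.IsRt x)
    (hdom : ∀ i, 0 ≤ D.pair i x) (k : I) : 0 < x k := by
  have hx0 := hx.nonneg_of_dominant hdom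
  by_contra hk
  have hne : ({i | x i ≠ 0} : Set I).Nonempty := by
    by_contra h
    rw [Set.not_nonempty_iff_eq_empty] at h
    apply hx.ne_zero
    ext i
    by_contra hi
    have : i ∈ ({i | x i ≠ 0} : Set I) := hi
    rw [h] at this
    exact this
  have hne' : ({i | x i ≠ 0}ᶜ : Set I).Nonempty := by
    refine ⟨k, ?_⟩
    have := hx0 k
    simp only [Pi.zero_apply] at this
    simp only [Set.mem_compl_iff, Set.mem_ofPred_eq, not_not]
    omega
  obtain ⟨i, hi, j, hj, hij⟩ := hD.2 _ hne hne'
  simp only [Set.mem_compl_iff, Set.mem_ofPred_eq, not_not] at hi hj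
  have hd : (0 : ℤ) < D.d j := by exact_mod_cast D.d_pos j
  have h1 : D.pair j x = ∑ l, x l * D.cartan j l := by
    conv_lhs => rw [eq_sum_eps x]
    simp only [map_sum, map_smul, pair_eps, smul_eq_mul]
  have h2 : ∀ l, x l * D.cartan j l ≤ 0 := by
    intro l
    by_cases hl : j = l
    · rw [← hl, hj, zero_mul]
    · exact mul_nonpos_of_nonneg_of_nonpos (hx0 l) (D.cartan_nonpos hl)
  have hne : j ≠ i := by
    rintro rfl
    exact hi hj
  have h3 : x i * D.cartan j i < 0 := by
    refine lt_of_le_of_ne (h2 i) (mul_ne_zero hi fun h0 => hij ?_)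
    rw [D.symm, form_eq, h0, mul_zero]
  have h4 : D.pair j x < 0 := by
    rw [h1]
    exact Finset.sum_neg' (fun l _ => h2 l) ⟨i, Finset.mem_univ _, h3⟩
  have := hdom j
  omega

/-! ### Existence and uniqueness of the highest root -/

/-- A root that is not covered by another root or by zero. -/
def IsTop (D : CartanDatum I) (x : I → ℤ) : Prop :=
  D.IsRt x ∧ ∀ i, ¬ D.IsRt (x + eps i) ∧ x ≠ -eps i

theorem IsTop.dominant {x : I → ℤ} (hx : D.IsTop x) (i : I) : 0 ≤ D.pair i x := by
  by_contra h
  have hd : (0 : ℤ) < D.d i := by exact_mod_cast D.d_pos i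
  exact (hx.2 i).1 (hx.1.add (.simple i) (by rw [B_eps_right]; nlinarith) (hx.2 i).2)

/-- The height of an element of the root lattice. -/
def height : (I → ℤ) →ₗ[ℤ] ℤ := Fintype.linearCombination ℤ (fun _ => 1)

omit [DecidableEq I] in
theorem height_apply (x : I → ℤ) : height x = ∑ i, x i := by
  simp [height, Fintype.linearCombination_apply]

theorem height_eps (i : I) : height (eps i) = 1 := by
  simp [height_apply, eps]

/-- Induction on the height of `y`. Split `y` into a simple root and a smaller positive root. Since
`B(x + y, y) > 0`, one of the two parts has positive product with `x + y` and can be subtracted,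
leaving `x` plus the other part. -/
theorem IsTop.not_isRt_add {x y : I → ℤ} (hx : D.IsTop x) (hy : D.IsRt y) (hy0 : 0 ≤ y) :
    ¬ D.IsRt (x + y) := by
  induction hn : (height y).toNat using Nat.strong_induction_on generalizing y with
  | _ n ih =>
    intro hxy
    have hx0 := hx.1.nonneg_of_dominant hx.dominant
    by_cases hsimple : ∃ i, y = eps i
    · obtain ⟨i, rfl⟩ := hsimple
      exact (hx.2 i).1 hxy
    push Not at hsimple
    have hyy := hy.B_pos
    rw [B_eq_sum] at hyy
    obtain ⟨i, -, hi⟩ := Finset.exists_lt_of_sum_lt (f := fun _ => (0 : ℤ)) (by simpa using hyy)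
    have hd : (0 : ℤ) < D.d i := by exact_mod_cast D.d_pos i
    have hyi0 := hy0 i
    simp only [Pi.zero_apply] at hyi0
    have hpi : 0 < D.pair i y := by
      by_contra h
      nlinarith [mul_nonneg hyi0 hd.le]
    have hz := hy.sub (.simple i) (by rw [B_eps_right]; positivity) (hsimple i)
    have hz0 : 0 ≤ y - eps i := by
      have : ∃ k, k ≠ i ∧ 0 < y k := by
        by_contra h
        push Not at h
        have hyc : y = y i • eps i := by
          ext k
          by_cases hk : k = i
          · subst hk; simp [eps_same]
          · have h1 := h k hk
            have h2 := hy0 k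
            simp only [Pi.zero_apply] at h2
            simp [eps_ne hk]
            omega
        have hb := (hy.pair_bounds i).2
        rw [hyc, map_smul, pair_eps_self, smul_eq_mul] at hb
        have : y i = 0 ∨ y i = 1 := by omega
        rcases this with h | h
        · exact hy.ne_zero (by rw [hyc, h, zero_smul])
        · exact hsimple i (by rw [hyc, h, one_smul])
      obtain ⟨k, hk, hk0⟩ := this
      exact hz.nonneg_of_pos (k := k) (by simpa [eps_ne hk] using hk0)
    have hht : (height (y - eps i)).toNat < n := by
      have h1 : 0 ≤ height (y - eps i) := by
        rw [height_apply]
        exact Finset.sum_nonneg fun k _ => hz0 k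
      rw [map_sub, height_eps] at h1 ⊢
      omega
    have h1 : D.B (x + y) (eps i) ≤ 0 := by
      by_contra h
      refine ih _ hht hz hz0 rfl ?_
      have := hxy.sub (.simple i) (by omega) (fun e => by
        have e1 : y - eps i = -x := by rw [← e]; module
        rw [e1] at hz0
        have := le_antisymm hx0 (by simpa using hz0)
        exact hx.1.ne_zero this.symm)
      rwa [add_sub_assoc] at this
    have h2 : D.B (x + y) (y - eps i) ≤ 0 := by
      by_contra h
      apply (hx.2 i).1
      have := hxy.sub hz (by omega) (fun e => (hx.2 i).2 (by
        rw [eq_sub_of_add_eq e]; module))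
      convert this using 1
      module
    have h3 : 0 < D.B (x + y) y := by
      have := B_nonneg_of_dominant hx.dominant hy0
      have := hy.B_pos
      rw [LinearMap.map_add, LinearMap.add_apply]
      omega
    rw [map_sub] at h2
    omega

/-- Both roots are dominant with full support, so their product is positive. Their difference is
then a root, and one of the two is the other plus a positive root. -/
theorem IsTop.unique (hD : D.IsIrreducible) {x y : I → ℤ} (hx : D.IsTop x) (hy : D.IsTop y) :
    x = y := by
  by_contra hne
  have hpos : 0 < D.B x y := by
    have hyy := hy.1.B_pos
    rw [B_eq_sum] at hyy ⊢
    obtain ⟨i, -, hi⟩ := Finset.exists_lt_of_sum_lt (f := fun _ => (0 : ℤ)) (by simpa using hyy)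
    refine Finset.sum_pos' (fun k _ => ?_) ⟨i, Finset.mem_univ _, ?_⟩
    · exact mul_nonneg (hx.1.pos_of_dominant hD hx.dominant k).le
        (mul_nonneg (by positivity) (hy.dominant k))
    · exact mul_pos (hx.1.pos_of_dominant hD hx.dominant i)
        (pos_of_mul_pos_right hi (hy.1.pos_of_dominant hD hy.dominant i).le)
  have hsub := hx.1.sub hy.1 hpos hne
  rcases hsub.nonneg_or_nonpos with h | h
  · apply hy.not_isRt_add hsub h
    simpa using hx.1
  · have h' : 0 ≤ y - x := by rw [← neg_sub]; exact neg_nonneg.2 h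
    apply hx.not_isRt_add (y := y - x) (by rw [← neg_sub]; exact hsub.neg) h'
    simpa using hy.1

theorem exists_isTop_height_le (hD : D.IsIrreducible) :
    ∃ x, D.IsTop x ∧ ∀ y, D.IsRt y → height y ≤ height x := by
  obtain ⟨i₀⟩ := hD.1
  obtain ⟨x, hx, hmax⟩ := Set.exists_max_image _ height D.finite_isRt ⟨eps i₀, IsRt.simple i₀⟩
  refine ⟨x, ⟨hx, fun i => ⟨fun h => ?_, fun h => ?_⟩⟩, hmax⟩
  · have := hmax _ h
    rw [map_add, height_eps] at this
    omega
  · have := hmax _ (IsRt.simple i)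
    rw [h, map_neg, height_eps] at this
    omega

theorem emb_natCast (n : I → ℕ) : D.emb (fun i => (n i : ℤ)) = ∑ i, n i • D.simpleRoot i := by
  rw [emb, Fintype.linearCombination_apply]
  simp only [natCast_zsmul]

theorem IsHighestRoot.exists_isTop {α : D.Wt} (h : D.IsHighestRoot α) :
    ∃ x, D.IsTop x ∧ α = D.emb x := by
  obtain ⟨hα, n, rfl, hmax⟩ := h
  rw [← emb_natCast] at hα ⊢
  rw [emb_mem_R] at hα
  have hmax' : ∀ y, D.IsRt y → 0 ≤ y → height y ≤ height (fun i => (n i : ℤ)) := by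
    intro y hy hy0
    obtain ⟨m, rfl⟩ : ∃ m : I → ℕ, y = fun i => (m i : ℤ) :=
      ⟨fun i => (y i).toNat, by ext i; exact (Int.toNat_of_nonneg (hy0 i)).symm⟩
    have := hmax m (by rwa [← emb_natCast, emb_mem_R])
    rw [height_apply, height_apply]
    exact_mod_cast this
  refine ⟨_, ⟨hα, fun i => ⟨fun h => ?_, fun h => ?_⟩⟩, rfl⟩
  · have := hmax' _ h (add_nonneg (fun k => Int.natCast_nonneg _) (eps_nonneg i))
    rw [map_add, height_eps] at this
    omega
  · have := congrFun h i
    rw [Pi.neg_apply, eps_same] at this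
    omega

theorem existsUnique_isHighestRoot (hD : D.IsIrreducible) : ∃! α : D.Wt, D.IsHighestRoot α := by
  obtain ⟨x, hx, hmax⟩ := exists_isTop_height_le hD
  refine ⟨D.emb x, ⟨(emb_mem_R D).2 hx.1, fun i => (x i).toNat, ?_, fun m hm => ?_⟩, ?_⟩
  · rw [← emb_natCast]
    congr 1
    ext i
    exact (Int.toNat_of_nonneg (hx.1.nonneg_of_dominant hx.dominant i)).symm
  · rw [← emb_natCast, emb_mem_R] at hm
    have := hmax _ hm
    rw [height_apply, height_apply] at this
    zify
    refine this.trans (Finset.sum_le_sum fun i _ => Int.self_le_toNat _)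
  · intro β hβ
    obtain ⟨y, hy, rfl⟩ := hβ.exists_isTop
    rw [hx.unique hD hy]

/-- Downward induction on roots. -/
theorem IsTop.induction (hD : D.IsIrreducible) {θ : I → ℤ} (hθ : D.IsTop θ) {C : (I → ℤ) → Prop}
    (top : C θ) (step : ∀ x i, D.IsRt x → D.IsRt (x + eps i) → C (x + eps i) → C x)
    (neg : ∀ i, C (eps i) → C (-eps i)) {x : I → ℤ} (hx : D.IsRt x) : C x := by
  obtain ⟨t, ht, hmax⟩ := exists_isTop_height_le hD
  induction hn : (height t - height x).toNat using Nat.strong_induction_on generalizing x with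
  | _ n ih =>
    by_cases hxt : D.IsTop x
    · rwa [hxt.unique hD hθ]
    · simp only [IsTop, hx, true_and, not_forall, not_and_or, not_not] at hxt
      obtain ⟨i, hi | rfl⟩ := hxt
      · refine step x i hx hi (ih _ ?_ hi rfl)
        have := hmax _ hi
        rw [map_add, height_eps] at this ⊢
        omega
      · refine neg i (ih _ ?_ (.simple i) rfl)
        have := hmax _ (IsRt.simple i)
        rw [map_neg, height_eps] at hn
        rw [height_eps] at this ⊢
        omega

/-! ### The adjoint action -/

theorem isGeneric_vi (D : CartanDatum I) (i : I) : IsGeneric (D.vi i) :=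
  isGeneric_vv.pow (D.d_pos i)

theorem vi_zpow (D : CartanDatum I) (i : I) (n : ℤ) : D.vi i ^ n = vv ^ ((D.d i : ℤ) * n) := by
  rw [vi, ← zpow_natCast, ← zpow_mul]

theorem IsRt.eq_of_smul_eps {i : I} {n : ℤ} (h : D.IsRt (n • eps i)) : n = 1 ∨ n = -1 := by
  have hb := h.pair_bounds i
  rw [map_smul, pair_eps_self, smul_eq_mul] at hb
  have : n ≠ 0 := by
    rintro rfl
    exact h.ne_zero (by simp)
  omega

theorem IsRt.of_add_succ {x : I → ℤ} (hx : D.IsRt x) {i : I} (h2 : x ≠ -eps i) {k : ℕ}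
    (h : D.IsRt (x + ((k : ℤ) + 1) • eps i)) : D.IsRt (x + (k : ℤ) • eps i) := by
  by_cases h1 : x = eps i
  · subst h1
    have := IsRt.eq_of_smul_eps (D := D) (i := i) (n := (k : ℤ) + 2) (by convert h using 1; module)
    omega
  · rw [hx.add_zsmul_iff h1 h2] at h ⊢
    omega

theorem IsRt.q_add {x : I → ℤ} (hx : D.IsRt x) {i : I} (h2 : x ≠ -eps i) {k : ℕ}
    (h : D.IsRt (x + (k : ℤ) • eps i)) :
    x + (k : ℤ) • eps i ≠ -eps i ∧ D.q i (D.emb (x + (k : ℤ) • eps i)) = D.q i (D.emb x) + k := by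
  by_cases h1 : x = eps i
  · subst h1
    have := IsRt.eq_of_smul_eps (D := D) (i := i) (n := (k : ℤ) + 1) (by convert h using 1; module)
    have hk : k = 0 := by omega
    subst hk
    simp [h2]
  · refine ⟨?_, ?_⟩
    · have := smul_eps_add_ne hx h1 h2 k (-1)
      rwa [neg_one_smul] at this
    · induction k with
      | zero => simp
      | succ k ih =>
        have h' := hx.of_add_succ h2 (k := k) (by exact_mod_cast h)
        have e : x + ((k + 1 : ℕ) : ℤ) • eps i = x + (k : ℤ) • eps i + eps i := by
          push_cast; module
        rw [e] at h ⊢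
        rw [(h'.p_add_eps h).2, ih h']
        omega

section Action

variable {V : Type*} [AddCommGroup V] [Module Kv V]

/-- The formulas for the action on the quantum adjoint representation, with the vectors `X`
indexed by the root lattice and extended by zero. -/
structure IsAdjointAction (D : CartanDatum I) (X : (I → ℤ) → V) (t : I → V)
    (e f : I → Module.End Kv V) : Prop where
  X_zero : ∀ x, ¬ D.IsRt x → X x = 0
  e_X : ∀ i x, D.IsRt x → x ≠ -eps i →
    e i (X x) = qint (D.vi i) (D.q i (D.emb x) + 1) • X (x + eps i)
  e_neg : ∀ i, e i (X (-eps i)) = t i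
  e_t : ∀ i j, e i (t j) = qint (D.vi j) |D.cartan j i| • X (eps i)
  f_X : ∀ i x, D.IsRt x → x ≠ eps i →
    f i (X x) = qint (D.vi i) (D.p i (D.emb x) + 1) • X (x - eps i)
  f_pos : ∀ i, f i (X (eps i)) = t i
  f_t : ∀ i j, f i (t j) = qint (D.vi j) |D.cartan j i| • X (-eps i)

namespace IsAdjointAction

variable {X : (I → ℤ) → V} {t : I → V} {e f : I → Module.End Kv V}

/-- The Chevalley involution; every statement on the `F_i` below is obtained from its counterpart
for the `E_i` in this way. -/
theorem symm (H : D.IsAdjointAction X t e f) : D.IsAdjointAction (fun x => X (-x)) t f e where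
  X_zero x hx := H.X_zero _ (fun h => hx (isRt_neg_iff.1 h))
  e_X i x hx h := by
    rw [H.f_X i (-x) hx.neg (fun e => h (by rw [← e, neg_neg])), q_emb, neg_add']
  e_neg i := by rw [neg_neg, H.f_pos]
  e_t := H.f_t
  f_X i x hx h := by
    rw [H.e_X i (-x) hx.neg (fun e => h (neg_injective e)), p_emb, neg_sub, sub_eq_neg_add]
  f_pos i := H.e_neg i
  f_t i j := by rw [H.e_t, neg_neg]

theorem e_pow_X (H : D.IsAdjointAction X t e f) {i : I} {x : I → ℤ} (hx : D.IsRt x)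
    (h : x ≠ -eps i) (k : ℕ) : (e i ^ k) (X x) =
      (∏ s ∈ Finset.range k, qint (D.vi i) ((D.q i (D.emb x) : ℤ) + s + 1)) •
        X (x + (k : ℤ) • eps i) := by
  induction k with
  | zero => simp
  | succ k ih =>
    rw [pow_succ', Module.End.mul_apply, ih, map_smul, Finset.prod_range_succ, mul_smul]
    congr 1
    by_cases hk : D.IsRt (x + (k : ℤ) • eps i)
    · obtain ⟨h1, h2⟩ := hx.q_add h hk
      rw [H.e_X i _ hk h1, h2]
      push_cast
      rw [add_smul, one_smul, ← add_assoc x]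
    · rw [H.X_zero _ hk, map_zero, H.X_zero (x + ((k + 1 : ℕ) : ℤ) • eps i), smul_zero]
      intro h'
      exact hk (hx.of_add_succ h (by exact_mod_cast h'))

theorem e_X_eps (H : D.IsAdjointAction X t e f) (i : I) : e i (X (eps i)) = 0 := by
  rw [H.e_X i _ (.simple i), H.X_zero, smul_zero]
  · exact fun h => h.not_two_smul (eps i) (by module)
  · intro h
    have := congrFun h i
    rw [Pi.neg_apply, eps_same] at this
    omega

theorem e_e_t (H : D.IsAdjointAction X t e f) (i j : I) : e i (e i (t j)) = 0 := by
  rw [H.e_t, map_smul, H.e_X_eps, smul_zero]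

theorem e_pow_t (H : D.IsAdjointAction X t e f) (i j : I) {k : ℕ} (hk : 2 ≤ k) :
    (e i ^ k) (t j) = 0 := by
  obtain ⟨m, rfl⟩ := Nat.exists_eq_add_of_le' hk
  rw [pow_add, Module.End.mul_apply, pow_two, Module.End.mul_apply, H.e_e_t, map_zero]

theorem e_pow_neg (H : D.IsAdjointAction X t e f) (i : I) {k : ℕ} (hk : 3 ≤ k) :
    (e i ^ k) (X (-eps i)) = 0 := by
  obtain ⟨m, rfl⟩ := Nat.exists_eq_add_of_le' hk
  rw [show m + 3 = m + 2 + 1 from rfl, pow_succ, Module.End.mul_apply, H.e_neg,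
    H.e_pow_t i i (by omega)]

theorem e_pow_two_neg (H : D.IsAdjointAction X t e f) (i : I) :
    (e i ^ 2) (X (-eps i)) = qint (D.vi i) 2 • X (eps i) := by
  rw [pow_two, Module.End.mul_apply, H.e_neg, H.e_t, cartan_self]
  rfl

theorem not_isRt_add_four {x : I → ℤ} (hx : D.IsRt x) {i : I} (h : x ≠ -eps i) :
    ¬ D.IsRt (x + (4 : ℤ) • eps i) := by
  intro h4
  by_cases h1 : x = eps i
  · subst h1
    have := IsRt.eq_of_smul_eps (D := D) (i := i) (n := 5) (by convert h4 using 1; module)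
    omega
  · have := hx.le_p h1 h h4
    have := hx.p_le_three i
    omega

theorem e_pow_four_X (H : D.IsAdjointAction X t e f) (i : I) (x : I → ℤ) :
    (e i ^ 4) (X x) = 0 := by
  by_cases hx : D.IsRt x
  · by_cases h : x = -eps i
    · rw [h, H.e_pow_neg i (by norm_num)]
    · rw [H.e_pow_X hx h, H.X_zero, smul_zero]
      exact not_isRt_add_four hx h
  · rw [H.X_zero x hx, map_zero]

theorem comm_self_t (H : D.IsAdjointAction X t e f) (i j : I) :
    e i (f i (t j)) = f i (e i (t j)) := by
  rw [H.f_t, H.e_t, map_smul, map_smul, H.e_neg, H.f_pos]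

theorem comm_self_eps (H : D.IsAdjointAction X t e f) (i : I) :
    e i (f i (X (eps i))) - f i (e i (X (eps i))) =
      qint (D.vi i) (D.pair i (eps i)) • X (eps i) := by
  rw [H.f_pos, H.e_t, H.e_X_eps, map_zero, sub_zero, cartan_self, pair_eps_self]
  rfl

/-- If `x - ε_i` is not a root, then `q = 0` and both sides vanish, so no case distinction is needed
in the result. -/
theorem e_f_X (H : D.IsAdjointAction X t e f) {i : I} {x : I → ℤ} (hx : D.IsRt x)
    (h1 : x ≠ eps i) : e i (f i (X x)) =
      (qint (D.vi i) (D.p i (D.emb x) + 1) * qint (D.vi i) (D.q i (D.emb x))) • X x := by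
  rw [H.f_X i x hx h1, map_smul, mul_smul]
  congr 1
  by_cases hk : D.IsRt (x - eps i)
  · have hx' : D.IsRt (x - eps i + eps i) := by simpa using hx
    have h := (hk.p_add_eps hx').2
    rw [sub_add_cancel] at h
    rw [H.e_X i _ hk, sub_add_cancel, h]
    · push_cast; rfl
    · intro h
      exact hx.ne_zero (by rw [sub_eq_iff_eq_add] at h; simpa using h)
  · have : D.q i (D.emb x) = 0 := by
      have := mt (one_le_q_iff hx i).1 hk
      omega
    rw [H.X_zero _ hk, this, map_zero, Nat.cast_zero, qint_zero, zero_smul]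

theorem comm_self_X (H : D.IsAdjointAction X t e f) (i : I) (x : I → ℤ) :
    e i (f i (X x)) - f i (e i (X x)) = qint (D.vi i) (D.pair i x) • X x := by
  by_cases hx : D.IsRt x
  · by_cases h1 : x = eps i
    · rw [h1, H.comm_self_eps]
    by_cases h2 : x = -eps i
    · have := H.symm.comm_self_eps i
      rw [h2, ← neg_sub, map_neg, qint_neg, neg_smul]
      exact congrArg Neg.neg this
    have h := H.symm.e_f_X hx.neg (i := i) (fun h => h2 (by rw [← h, neg_neg]))
    simp only [neg_neg, ← p_emb, ← q_emb] at h
    rw [H.e_f_X hx h1, h, ← sub_smul, ← hx.q_sub_p h1 h2]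
    rw [(D.isGeneric_vi i).qint_mul_sub]
  · rw [H.X_zero x hx]; simp

theorem not_isRt_sub_eps {i j : I} : ¬ D.IsRt (-eps j + eps i) := by
  rw [neg_add_eq_sub]
  exact not_isRt_eps_sub_eps i j

theorem e_neg_eps (H : D.IsAdjointAction X t e f) {i j : I} (hij : i ≠ j) :
    e i (X (-eps j)) = 0 := by
  rw [H.e_X i _ (IsRt.simple j).neg, H.X_zero _ not_isRt_sub_eps, smul_zero]
  exact fun h => hij (eps_injective (neg_injective h)).symm

theorem comm_ne_t (H : D.IsAdjointAction X t e f) {i j : I} (hij : i ≠ j) (k : I) :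
    e i (f j (t k)) = f j (e i (t k)) := by
  have h := H.symm.e_neg_eps hij.symm
  simp only [neg_neg] at h
  rw [H.f_t, H.e_t, map_smul, map_smul, H.e_neg_eps hij, h, smul_zero, smul_zero]

/-- The path through the zero weight space. As `ε_i - ε_j` is not a root, `|⟨j, i'⟩|` is the length
of the `j`-string through `ε_i`, which explains the coefficient of `E_i t_j`. -/
theorem comm_ne_eps (H : D.IsAdjointAction X t e f) {i j : I} (hij : i ≠ j) :
    e i (f j (X (eps j))) = f j (e i (X (eps j))) := by
  have hji : D.q i (D.emb (eps j)) = 0 := by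
    have := mt (one_le_q_iff (.simple j) i).1 (not_isRt_eps_sub_eps (D := D) j i)
    omega
  have hqj : D.q j (D.emb (eps i)) = 0 := by
    have := mt (one_le_q_iff (.simple i) j).1 (not_isRt_eps_sub_eps (D := D) i j)
    omega
  have hp := (IsRt.simple (D := D) i).q_sub_p (i := j) (fun h => hij (eps_injective h))
    (eps_ne_neg_eps i j)
  rw [hqj, pair_eps] at hp
  have hp' : |D.cartan j i| = D.p j (D.emb (eps i)) := by
    rw [← hp]; simp
  rw [H.f_pos, H.e_t, H.e_X i _ (.simple j) (eps_ne_neg_eps j i), hji, hp', map_smul,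
    Nat.cast_zero, zero_add, (D.isGeneric_vi i).qint_one, one_smul]
  by_cases hk : D.IsRt (eps j + eps i)
  · have hk' : D.IsRt (eps i + eps j) := by rwa [add_comm]
    have h := ((IsRt.simple i).p_add_eps hk').1
    rw [H.f_X j _ hk, add_comm (eps j), add_sub_cancel_right, h]
    · push_cast; rfl
    · intro h
      exact eps_ne_zero i (by simpa using h)
  · have : D.p j (D.emb (eps i)) = 0 := by
      have := mt (one_le_p_iff (.simple i) j).1 (by rwa [add_comm])
      omega
    rw [H.X_zero _ hk, this, map_zero, Nat.cast_zero, qint_zero, zero_smul]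

theorem comm_ne_X (H : D.IsAdjointAction X t e f) {i j : I} (hij : i ≠ j) (x : I → ℤ) :
    e i (f j (X x)) = f j (e i (X x)) := by
  by_cases hx : D.IsRt x
  swap
  · rw [H.X_zero x hx]; simp
  by_cases h1 : x = eps j
  · rw [h1, H.comm_ne_eps hij]
  by_cases h2 : x = -eps i
  · rw [h2]
    exact (H.symm.comm_ne_eps hij.symm).symm
  rw [H.f_X j x hx h1, H.e_X i x hx h2, map_smul, map_smul]
  classical
  have ez : x - eps j + eps i = x + eps i - eps j := by module
  have e1 : e i (X (x - eps j)) = if D.IsRt (x - eps j) then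
      qint (D.vi i) (D.q i (D.emb (x - eps j)) + 1) • X (x + eps i - eps j) else 0 := by
    split_ifs with h
    · rw [H.e_X i _ h, ez]
      intro e
      apply not_isRt_eps_sub_eps (D := D) j i
      rw [sub_eq_iff_eq_add, neg_add_eq_sub] at e
      rwa [← e]
    · rw [H.X_zero _ h, map_zero]
  have e2 : f j (X (x + eps i)) = if D.IsRt (x + eps i) then
      qint (D.vi j) (D.p j (D.emb (x + eps i)) + 1) • X (x + eps i - eps j) else 0 := by
    split_ifs with h
    · rw [H.f_X j _ h]
      intro e
      apply not_isRt_eps_sub_eps (D := D) j i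
      rwa [← eq_sub_of_add_eq e]
    · rw [H.X_zero _ h, map_zero]
  rw [e1, e2]
  by_cases hz : D.IsRt (x + eps i - eps j)
  swap
  · rw [H.X_zero _ hz]; simp
  have hiff : D.IsRt (x - eps j) ↔ D.IsRt (x + eps i) := by
    constructor
    · exact fun h => hx.add_eps_of_square hij h hz h2
    · intro h
      rw [← isRt_neg_iff, show -(x - eps j) = -x + eps j by module]
      refine hx.neg.add_eps_of_square hij.symm ?_ ?_ fun e => h1 (neg_injective e)
      · convert h.neg using 1
        module
      · convert hz.neg using 1
        module
  by_cases hk : D.IsRt (x - eps j)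
  swap
  · rw [if_neg hk, if_neg (fun h => hk (hiff.2 h)), smul_zero, smul_zero]
  rw [if_pos hk, if_pos (hiff.1 hk), smul_smul, smul_smul]
  congr 1
  have hk' := hiff.1 hk
  have s1 : x - eps j + eps j = x := by module
  have s2 : x + eps i - eps j + eps j = x + eps i := by module
  have p1 := (hk.p_add_eps (i := j) (by rwa [s1])).1
  have p2 := (hz.p_add_eps (i := j) (by rwa [s2])).1
  have hsq := hk.square hij (by rwa [ez]) (by rwa [s1]) (by rwa [ez, s2])
  rw [s1] at p1 hsq
  rw [s2] at p2
  rw [ez, p1, p2] at hsq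
  -- The square is based at `x - ε_j`. The factors agree one by one, or crosswise with `v_i = v_j`.
  rcases hsq with ⟨a, b⟩ | ⟨a, b, c⟩
  · have b' : D.p j (D.emb x) = D.p j (D.emb (x + eps i)) := by omega
    rw [a, b', mul_comm]
  · have b' : D.q i (D.emb (x - eps j)) = D.p j (D.emb (x + eps i)) := by omega
    have c' : D.p j (D.emb x) = D.q i (D.emb x) := by omega
    rw [b', c', vi, vi, a]

end IsAdjointAction

end Action

/-! ### The representation of the quantized enveloping algebra -/

theorem emb_single (x : I → ℤ) (i : I) (n : ℤ) : D.emb x (Pi.single i n) = n * D.pair i x := by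
  have : (Pi.single i n : I → ℤ) = n • Pi.single i 1 := by
    rw [← Pi.single_smul, smul_eq_mul, mul_one]
  rw [this, map_smul, smul_eq_mul]
  rfl

section Module

variable {V : Type*} [AddCommGroup V] [Module Kv V]

/-- The adjoint action together with the action of the torus. -/
structure IsAdjointModule (D : CartanDatum I) (X : (I → ℤ) → V) (t : I → V)
    (e f : I → Module.End Kv V) (k : (I → ℤ) → Module.End Kv V) : Prop
    extends D.IsAdjointAction X t e f where
  span_eq_top : Submodule.span Kv (Set.range X ∪ Set.range t) = ⊤
  k_X : ∀ y x, k y (X x) = vv ^ (D.emb x y) • X x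
  k_t : ∀ y i, k y (t i) = t i

namespace IsAdjointModule

variable {X : (I → ℤ) → V} {t : I → V} {e f : I → Module.End Kv V}
  {k : (I → ℤ) → Module.End Kv V}

theorem symm (H : D.IsAdjointModule X t e f k) :
    D.IsAdjointModule (fun x => X (-x)) t f e (fun y => k (-y)) where
  toIsAdjointAction := H.toIsAdjointAction.symm
  span_eq_top := by
    rw [← H.span_eq_top]
    congr 2
    exact (Equiv.neg (I → ℤ)).surjective.range_comp X
  k_X y x := by
    rw [H.k_X, map_neg, map_neg, LinearMap.neg_apply, neg_neg]
  k_t y i := H.k_t (-y) i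

theorem ext_end (H : D.IsAdjointModule X t e f k) {S T : Module.End Kv V}
    (hX : ∀ x, S (X x) = T (X x)) (ht : ∀ i, S (t i) = T (t i)) : S = T := by
  refine LinearMap.ext_on H.span_eq_top ?_
  rintro _ (⟨x, rfl⟩ | ⟨i, rfl⟩)
  · exact hX x
  · exact ht i

theorem comm_self (H : D.IsAdjointModule X t e f k) (i : I) :
    e i * f i - f i * e i = (D.vi i - (D.vi i)⁻¹)⁻¹ •
      (k (Pi.single i (D.d i : ℤ)) - k (Pi.single i (-(D.d i : ℤ)))) := by
  refine H.ext_end (fun x => ?_) (fun j => ?_)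
  · simp only [LinearMap.sub_apply, LinearMap.smul_apply, Module.End.mul_apply, H.k_X,
      H.comm_self_X, emb_single]
    rw [← sub_smul, smul_smul, qint, vi_zpow, vi_zpow, div_eq_inv_mul]
    rw [neg_mul, mul_neg]
  · simp only [LinearMap.sub_apply, LinearMap.smul_apply, Module.End.mul_apply, H.k_t,
      H.comm_self_t, sub_self, smul_zero]

theorem comm_ne (H : D.IsAdjointModule X t e f k) {i j : I} (hij : i ≠ j) :
    e i * f j = f j * e i :=
  H.ext_end (fun x => H.comm_ne_X hij x) (fun l => H.comm_ne_t hij l)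

theorem e_pow_four (H : D.IsAdjointModule X t e f k) (i : I) : e i ^ 4 = 0 :=
  H.ext_end (fun x => H.e_pow_four_X i x) (fun j => H.e_pow_t i j (by norm_num))

theorem k_e (H : D.IsAdjointModule X t e f k) (y : I → ℤ) (j : I) :
    k y * e j = vv ^ (D.simpleRoot j y) • (e j * k y) := by
  refine H.ext_end (fun x => ?_) (fun l => ?_)
  · simp only [LinearMap.smul_apply, Module.End.mul_apply, H.k_X, map_smul, smul_smul]
    rw [← zpow_add₀ vv_ne_zero]
    by_cases hx : D.IsRt x
    swap
    · rw [H.X_zero x hx]; simp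
    by_cases hn : x = -eps j
    · rw [hn, H.e_neg, H.k_t, map_neg, emb_eps, LinearMap.neg_apply, add_neg_cancel, zpow_zero,
        one_smul]
    · rw [H.e_X j x hx hn, map_smul, H.k_X, smul_comm, map_add, emb_eps, LinearMap.add_apply,
        add_comm]
  · simp only [LinearMap.smul_apply, Module.End.mul_apply, H.k_t, H.e_t, map_smul, H.k_X,
      emb_eps]
    rw [smul_comm]

theorem k_mul (H : D.IsAdjointModule X t e f k) (y y' : I → ℤ) : k y * k y' = k (y + y') := by
  refine H.ext_end (fun x => ?_) (fun l => ?_)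
  · simp only [Module.End.mul_apply, H.k_X, map_smul, smul_smul, map_add]
    rw [zpow_add₀ vv_ne_zero, mul_comm]
  · simp only [Module.End.mul_apply, H.k_t]

theorem k_zero (H : D.IsAdjointModule X t e f k) : k 0 = 1 := by
  refine H.ext_end (fun x => ?_) (fun l => ?_)
  · simp [H.k_X]
  · simp [H.k_t]

theorem simpleRoot_single (D : CartanDatum I) (i j : I) (n : ℤ) :
    D.simpleRoot j (Pi.single i n) = n * D.cartan i j := by
  rw [← emb_eps, emb_single, pair_eps]

/-- The triple is `e_i`, `f_i` and the torus element for `i`; `e_j` commutes with `f_i` and has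
weight `⟨i, j'⟩ ≤ 0`. Strings have at most four roots, so `e_i ^ 4 = 0`. -/
theorem serre_e (H : D.IsAdjointModule X t e f k) {i j : I} (hij : i ≠ j) :
    ∑ ab ∈ Finset.HasAntidiagonal.antidiagonal (1 - D.cartan i j).toNat,
      ((-1) ^ ab.2 * qbinom (D.vi i) ab.1 ab.2) • (e i ^ ab.1 * e j * e i ^ ab.2) = 0 := by
  have hc := D.cartan_nonpos hij
  refine serre_of_nilpotent (D.isGeneric_vi i) (c := D.cartan i j) ?_ (H.comm_self i)
    (H.symm.comm_ne (i := i) (j := j) hij).symm ?_ ?_ ?_ ?_ (H.e_pow_four i)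
  · omega
  · rw [H.k_mul, ← Pi.single_add, neg_add_cancel, Pi.single_zero, H.k_zero]
  · rw [H.k_mul, ← Pi.single_add, add_neg_cancel, Pi.single_zero, H.k_zero]
  · rw [H.k_e, simpleRoot_single, cartan_self, vi_zpow]
  · rw [H.k_e, simpleRoot_single, vi_zpow]

theorem exists_rep (H : D.IsAdjointModule X t e f k) :
    ∃ ρ : D.U →ₐ[Kv] Module.End Kv V,
      (∀ i, ρ (D.E i) = e i) ∧ (∀ i, ρ (D.F i) = f i) ∧ (∀ y, ρ (D.K y) = k y) := by
  let φ : Free I →ₐ[Kv] Module.End Kv V := FreeAlgebra.lift Kv fun g =>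
    match g with
    | .E i => e i
    | .F i => f i
    | .K y => k y
  have hE : ∀ i, φ (gE i) = e i := fun i => FreeAlgebra.lift_ι_apply _ _
  have hF : ∀ i, φ (gF i) = f i := fun i => FreeAlgebra.lift_ι_apply _ _
  have hK : ∀ y, φ (gK y) = k y := fun i => FreeAlgebra.lift_ι_apply _ _
  have hrel : ∀ ⦃a b : Free I⦄, D.Rel a b → φ a = φ b := by
    intro a b h
    cases h with
    | K_zero => rw [hK, map_one, H.k_zero]
    | K_add y y' => rw [map_mul, hK, hK, hK, H.k_mul]
    | K_E i j =>
      rw [map_smul, map_mul, map_mul, hK, hE, H.k_e, IsAdjointModule.simpleRoot_single, one_mul]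
    | K_F i j =>
      -- The involution replaces `K_y` by `K_{-y}`, hence the sign.
      have h := H.symm.k_e (-Pi.single i 1) j
      rw [neg_neg, map_neg, IsAdjointModule.simpleRoot_single, one_mul] at h
      rw [map_smul, map_mul, map_mul, hK, hF, h]
    | E_F_self i =>
      rw [map_sub, map_smul, map_sub, map_mul, map_mul, hE, hF, hK, hK, H.comm_self]
    | E_F_ne i j hij => rw [map_sub, map_mul, map_mul, hE, hF, H.comm_ne hij, sub_self, map_zero]
    | serre_E i j hij =>
      rw [serre, map_sum, map_zero, ← H.serre_e hij]
      refine Finset.sum_congr rfl fun ab _ => ?_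
      rw [map_smul, map_mul, map_mul, map_pow, map_pow, hE, hE]
    | serre_F i j hij =>
      rw [serre, map_sum, map_zero, ← H.symm.serre_e hij]
      refine Finset.sum_congr rfl fun ab _ => ?_
      rw [map_smul, map_mul, map_mul, map_pow, map_pow, hF, hF]
  let ρ : RingQuot D.Rel →ₐ[Kv] Module.End Kv V := RingQuot.liftAlgHom Kv ⟨φ, hrel⟩
  have hρ : ∀ a, ρ (RingQuot.mkAlgHom Kv D.Rel a) = φ a := fun a =>
    RingQuot.liftAlgHom_mkAlgHom_apply Kv φ hrel a
  exact ⟨ρ, fun i => (hρ _).trans (hE i), fun i => (hρ _).trans (hF i),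
    fun y => (hρ _).trans (hK y)⟩

end IsAdjointModule

/-! ### The explicit module with basis `R ⊔ I` -/

/-- The vectors of a family indexed by `R`, indexed by the root lattice and extended by zero. -/
def rootVec (b : D.R ⊕ I → V) (x : I → ℤ) : V :=
  open Classical in
  if h : D.IsRt x then b (.inl ⟨D.emb x, (emb_mem_R D).2 h⟩) else 0

omit [Module Kv V] in
theorem rootVec_of_isRt (b : D.R ⊕ I → V) {x : I → ℤ} (h : D.IsRt x) :
    rootVec b x = b (.inl ⟨D.emb x, (emb_mem_R D).2 h⟩) := dif_pos h

omit [Module Kv V] in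
theorem rootVec_of_not_isRt (b : D.R ⊕ I → V) {x : I → ℤ} (h : ¬ D.IsRt x) :
    rootVec b x = 0 := dif_neg h

omit [Module Kv V] in
theorem rootVec_eq (b : D.R ⊕ I → V) {x : I → ℤ} {α : D.R} (h : D.emb x = α) :
    rootVec b x = b (.inl α) := by
  have hx : D.IsRt x := (emb_mem_R D).1 (h ▸ α.2)
  rw [rootVec_of_isRt b hx]
  congr 2
  exact Subtype.ext h

omit [Module Kv V] in
theorem rootVec_eps (b : D.R ⊕ I → V) (i : I) : rootVec b (eps i) = b (.inl (D.posRt i)) :=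
  rootVec_eq b (D.emb_eps i)

omit [Module Kv V] in
theorem rootVec_neg_eps (b : D.R ⊕ I → V) (i : I) : rootVec b (-eps i) = b (.inl (D.negRt i)) :=
  rootVec_eq b (by rw [map_neg, emb_eps]; rfl)

theorem emb_add_eps_eq_up {i : I} {x : I → ℤ} {hx : D.emb x ∈ D.R} (h : 1 ≤ D.p i (D.emb x)) :
    D.emb (x + eps i) = (D.up i ⟨D.emb x, hx⟩ 1 h).1 := by
  change _ = D.emb x + 1 • D.simpleRoot i
  rw [map_add, emb_eps, one_smul]

theorem emb_sub_eps_eq_down {i : I} {x : I → ℤ} {hx : D.emb x ∈ D.R} (h : 1 ≤ D.q i (D.emb x)) :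
    D.emb (x - eps i) = (D.down i ⟨D.emb x, hx⟩ 1 h).1 := by
  change _ = D.emb x - 1 • D.simpleRoot i
  rw [map_sub, emb_eps, one_smul]

/-- The hypotheses are the formulas that define a standard basis, so the result serves both the
explicit module and an arbitrary standard basis of `Λ`. -/
theorem isAdjointAction_rootVec {b : D.R ⊕ I → V} {e f : I → Module.End Kv V}
    (E_X : ∀ (i : I) (α : D.R) (h : 1 ≤ D.p i α),
      e i (b (.inl α)) = qint (D.vi i) (D.q i α + 1) • b (.inl (D.up i α 1 h)))
    (E_X_neg : ∀ i : I, e i (b (.inl (D.negRt i))) = b (.inr i))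
    (E_X_zero : ∀ (i : I) (α : D.R), D.p i α = 0 → α ≠ D.negRt i → e i (b (.inl α)) = 0)
    (E_t : ∀ i j : I,
      e i (b (.inr j)) = qint (D.vi j) |D.cartan j i| • b (.inl (D.posRt i)))
    (F_X : ∀ (i : I) (α : D.R) (h : 1 ≤ D.q i α),
      f i (b (.inl α)) = qint (D.vi i) (D.p i α + 1) • b (.inl (D.down i α 1 h)))
    (F_X_pos : ∀ i : I, f i (b (.inl (D.posRt i))) = b (.inr i))
    (F_X_zero : ∀ (i : I) (α : D.R), D.q i α = 0 → α ≠ D.posRt i → f i (b (.inl α)) = 0)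
    (F_t : ∀ i j : I,
      f i (b (.inr j)) = qint (D.vi j) |D.cartan j i| • b (.inl (D.negRt i))) :
    D.IsAdjointAction (rootVec b) (fun i => b (.inr i)) e f where
  X_zero x hx := rootVec_of_not_isRt b hx
  e_X i x hx hne := by
    rw [rootVec_of_isRt b hx]
    by_cases h : 1 ≤ D.p i (D.emb x)
    · rw [E_X i ⟨D.emb x, (emb_mem_R D).2 hx⟩ h, rootVec_eq b (emb_add_eps_eq_up h)]
    · rw [rootVec_of_not_isRt b (mt (one_le_p_iff hx i).2 h), smul_zero]
      refine E_X_zero i _ (by simpa using h) fun e => hne (D.emb_injective ?_)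
      have e' : D.emb x = -D.simpleRoot i := Subtype.ext_iff.1 e
      rw [e', map_neg, emb_eps]
  e_neg i := by rw [rootVec_neg_eps, E_X_neg]
  e_t i j := by rw [E_t, rootVec_eps]
  f_X i x hx hne := by
    rw [rootVec_of_isRt b hx]
    by_cases h : 1 ≤ D.q i (D.emb x)
    · rw [F_X i ⟨D.emb x, (emb_mem_R D).2 hx⟩ h, rootVec_eq b (emb_sub_eps_eq_down h)]
    · rw [rootVec_of_not_isRt b (mt (one_le_q_iff hx i).2 h), smul_zero]
      refine F_X_zero i _ (by simpa using h) fun e => hne (D.emb_injective ?_)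
      have e' : D.emb x = D.simpleRoot i := Subtype.ext_iff.1 e
      rw [e', emb_eps]
  f_pos i := by rw [rootVec_eps, F_X_pos]
  f_t i j := by rw [F_t, rootVec_neg_eps]

end Module

theorem p_negRt (i : I) : D.p i (D.negRt i) = 0 := by
  have := D.p_neg_eps i
  rwa [map_neg, emb_eps] at this

theorem q_posRt (i : I) : D.q i (D.posRt i) = 0 := by
  have := D.q_emb i (eps i)
  rwa [p_neg_eps, emb_eps] at this

open Classical in
/-- The raising operators on the free module with basis `R ⊔ I`. -/
def adjE (D : CartanDatum I) (i : I) : Module.End Kv (D.R ⊕ I →₀ Kv) :=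
  Finsupp.linearCombination Kv (Sum.elim
    (fun α => if h : 1 ≤ D.p i α then
        Finsupp.single (.inl (D.up i α 1 h)) (qint (D.vi i) (D.q i α + 1))
      else if α = D.negRt i then Finsupp.single (.inr i) 1 else 0)
    (fun j => Finsupp.single (.inl (D.posRt i)) (qint (D.vi j) |D.cartan j i|)))

open Classical in
/-- The lowering operators on the free module with basis `R ⊔ I`. -/
def adjF (D : CartanDatum I) (i : I) : Module.End Kv (D.R ⊕ I →₀ Kv) :=
  Finsupp.linearCombination Kv (Sum.elim
    (fun α => if h : 1 ≤ D.q i α then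
        Finsupp.single (.inl (D.down i α 1 h)) (qint (D.vi i) (D.p i α + 1))
      else if α = D.posRt i then Finsupp.single (.inr i) 1 else 0)
    (fun j => Finsupp.single (.inl (D.negRt i)) (qint (D.vi j) |D.cartan j i|)))

/-- The torus operators on the free module with basis `R ⊔ I`. -/
def adjK (D : CartanDatum I) (y : I → ℤ) : Module.End Kv (D.R ⊕ I →₀ Kv) :=
  Finsupp.linearCombination Kv (Sum.elim
    (fun α => Finsupp.single (.inl α) (vv ^ (α.1 y))) (fun j => Finsupp.single (.inr j) 1))

/-- The standard basis vectors of the free module with basis `R ⊔ I`. -/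
def adjB (D : CartanDatum I) (s : D.R ⊕ I) : D.R ⊕ I →₀ Kv := Finsupp.single s 1

theorem isAdjointModule_adj (D : CartanDatum I) :
    D.IsAdjointModule (rootVec D.adjB) (fun i => D.adjB (.inr i)) D.adjE D.adjF D.adjK where
  toIsAdjointAction := by
    apply isAdjointAction_rootVec
    · intro i α h
      simp [adjE, adjB, h]
    · intro i
      simp [adjE, adjB, p_negRt]
    · intro i α h h'
      simp [adjE, adjB, h, h']
    · intro i j
      simp [adjE, adjB]
    · intro i α h
      simp [adjF, adjB, h]
    · intro i
      simp [adjF, adjB, q_posRt]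
    · intro i α h h'
      simp [adjF, adjB, h, h']
    · intro i j
      simp [adjF, adjB]
  span_eq_top := by
    rw [eq_top_iff, ← (Finsupp.basisSingleOne (R := Kv) (ι := D.R ⊕ I)).span_eq,
      Submodule.span_le]
    rintro _ ⟨s, rfl⟩
    apply Submodule.subset_span
    rw [Finsupp.coe_basisSingleOne]
    rcases s with α | i
    · left
      obtain ⟨x, hx, h⟩ := (D.mem_R_iff_exists α.1).1 α.2
      exact ⟨x, rootVec_eq _ h⟩
    · right
      exact ⟨i, rfl⟩
  k_X y x := by
    by_cases hx : D.IsRt x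
    · rw [rootVec_of_isRt _ hx]
      simp [adjK, adjB]
    · rw [rootVec_of_not_isRt _ hx]; simp
  k_t y i := by simp [adjK, adjB]

end CartanDatum

/-! ### Weight vectors for a quantum `sl₂` -/

section Sl2

variable {V : Type*} [AddCommGroup V] [Module Kv V]

/-- Operators `e`, `f` which shift the weight by `2` and `-2` and whose commutator is `[n]` on the
vectors of weight `n`. -/
structure IsSl2 (u : Kv) (W : ℤ → V → Prop) (e f : Module.End Kv V) : Prop where
  e_mem : ∀ n m, W n m → W (n + 2) (e m)
  f_mem : ∀ n m, W n m → W (n - 2) (f m)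
  comm : ∀ n m, W n m → e (f m) = f (e m) + qint u n • m

namespace IsSl2

variable {u : Kv} {W : ℤ → V → Prop} {e f : Module.End Kv V}

theorem symm (H : IsSl2 u W e f) : IsSl2 u (fun n => W (-n)) f e where
  e_mem n m h := by
    have := H.f_mem _ _ h
    rwa [show -n - 2 = -(n + 2) by ring] at this
  f_mem n m h := by
    have := H.e_mem _ _ h
    rwa [show -n + 2 = -(n - 2) by ring] at this
  comm n m h := by
    rw [H.comm _ _ h, qint_neg, neg_smul, neg_add_cancel_right]

theorem f_pow_mem (H : IsSl2 u W e f) {n : ℤ} {m : V} (h : W n m) (k : ℕ) :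
    W (n - 2 * k) ((f ^ k) m) := by
  induction k with
  | zero => simpa using h
  | succ k ih =>
    rw [pow_succ', Module.End.mul_apply]
    have := H.f_mem _ _ ih
    rwa [show n - 2 * (k : ℤ) - 2 = n - 2 * ((k + 1 : ℕ) : ℤ) by push_cast; ring] at this

theorem e_f_pow (H : IsSl2 u W e f) (hu : IsGeneric u) {n : ℤ} {m : V} (h : W n m) (k : ℕ) :
    e ((f ^ (k + 1)) m) =
      (f ^ (k + 1)) (e m) + (qint u (k + 1) * qint u (n - k)) • (f ^ k) m := by
  induction k with
  | zero => simp [H.comm _ _ h, hu.qint_one]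
  | succ k ih =>
    rw [pow_succ' f (k + 1), Module.End.mul_apply, Module.End.mul_apply,
      H.comm _ _ (H.f_pow_mem h (k + 1)), ih, map_add, map_smul, ← Module.End.mul_apply f (f ^ k),
      ← pow_succ', add_assoc, ← add_smul]
    congr 2
    have := hu.qint_mul_sub (k + 1) (n - k - 1)
    rw [show n - (k : ℤ) - 1 + 1 = n - k by ring,
      show n - (k : ℤ) - 1 - (k + 1) = n - 2 * ((k + 1 : ℕ) : ℤ) by push_cast; ring] at this
    rw [← this]
    push_cast
    rw [show n - ((k : ℤ) + 1) = n - k - 1 by ring]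
    ring

/-- Induction on the power of `e` that kills `m`: the hypotheses pass to `e m` with `k + 1` in place
of `k`, so `e m = 0`. For such a vector `e f ^ (k + 1) m` is a nonzero multiple of `f ^ k m`, and
`k` descends to `0`. -/
theorem eq_zero_of_f_pow_eq_zero (H : IsSl2 u W e f) (hu : IsGeneric u) (N : ℕ) :
    ∀ {n : ℤ} {m : V} {k : ℕ}, W n m → (k : ℤ) ≤ n → (e ^ N) m = 0 → (f ^ k) m = 0 → m = 0 := by
  induction N with
  | zero => intro n m k _ _ h _; simpa using h
  | succ N ih =>
    intro n m k hm hk he hf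
    have hem : e m = 0 := by
      refine ih (k := k + 1) (H.e_mem _ _ hm) (by push_cast; omega) ?_ ?_
      · rw [← Module.End.mul_apply, ← pow_succ, he]
      · have := H.e_f_pow hu hm k
        rw [pow_succ', Module.End.mul_apply, hf, map_zero, map_zero, smul_zero, add_zero] at this
        rw [pow_succ', ← this]
    clear he
    induction k with
    | zero => simpa using hf
    | succ k ihk =>
      refine ihk (by push_cast at hk; omega) ?_
      have := H.e_f_pow hu hm k
      rw [hf, hem, map_zero, map_zero, zero_add] at this
      refine (smul_eq_zero.1 this.symm).resolve_left (mul_ne_zero ?_ ?_)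
      · exact hu.qint_ne_zero (by omega)
      · exact hu.qint_ne_zero (by push_cast at hk; omega)

end IsSl2

/-- If `a ^ r b` is a combination of the `a ^ p b a ^ q` with `p < r`, `p + q = r`, then `b`
preserves the vectors that are killed by a power of `a`. -/
theorem exists_pow_apply_eq_zero {a b : Module.End Kv V} {r : ℕ} (c : ℕ × ℕ → Kv)
    (hc : c (r, 0) ≠ 0)
    (h : ∑ pq ∈ Finset.HasAntidiagonal.antidiagonal r, c pq • (a ^ pq.1 * b * a ^ pq.2) = 0)
    {m : V} {N : ℕ} (hm : (a ^ N) m = 0) : ∃ N', (a ^ N') (b m) = 0 := by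
  -- Monomials of degree `n` in `a` with fewer than `r` factors `a` on the left of `b`. The relation
  -- rewrites every `a ^ n * b` with `n ≥ r` in this form.
  let S : ℕ → Submodule Kv (Module.End Kv V) := fun n =>
    Submodule.span Kv {T | ∃ p q, p < r ∧ p + q = n ∧ T = a ^ p * b * a ^ q}
  have hr : a ^ r * b ∈ S r := by
    have hmem : ((r, 0) : ℕ × ℕ) ∈ Finset.HasAntidiagonal.antidiagonal r := by simp
    rw [← Finset.add_sum_erase _ _ hmem, pow_zero, mul_one] at h
    have : a ^ r * b = -(c (r, 0))⁻¹ • ∑ pq ∈ (Finset.HasAntidiagonal.antidiagonal r).erase (r, 0),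
        c pq • (a ^ pq.1 * b * a ^ pq.2) := by
      rw [eq_neg_of_add_eq_zero_right h, smul_neg, neg_smul, neg_neg, smul_smul,
        inv_mul_cancel₀ hc, one_smul]
    rw [this]
    refine Submodule.smul_mem _ _ (Submodule.sum_mem _ fun pq hpq => Submodule.smul_mem _ _ ?_)
    rw [Finset.mem_erase, Finset.HasAntidiagonal.mem_antidiagonal] at hpq
    refine Submodule.subset_span ⟨pq.1, pq.2, ?_, hpq.2, rfl⟩
    rcases pq with ⟨p, q⟩
    have h1 := hpq.1
    have h2 := hpq.2
    simp only [ne_eq, Prod.mk.injEq, not_and] at h1 h2 ⊢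
    omega
  have hmulr : ∀ n q T, T ∈ S n → T * a ^ q ∈ S (n + q) := by
    intro n q T hT
    induction hT using Submodule.span_induction with
    | mem T hT =>
      obtain ⟨p, q', hp, rfl, rfl⟩ := hT
      exact Submodule.subset_span ⟨p, q' + q, hp, by omega, by rw [pow_add, ← mul_assoc]⟩
    | zero => rw [zero_mul]; exact Submodule.zero_mem _
    | add _ _ _ _ h1 h2 => rw [add_mul]; exact Submodule.add_mem _ h1 h2
    | smul c _ _ h1 => rw [smul_mul_assoc]; exact Submodule.smul_mem _ _ h1
  have hmull : ∀ n T, T ∈ S n → a * T ∈ S (n + 1) := by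
    intro n T hT
    induction hT using Submodule.span_induction with
    | mem T hT =>
      obtain ⟨p, q, hp, rfl, rfl⟩ := hT
      rw [← mul_assoc, ← mul_assoc, ← pow_succ']
      rcases Nat.lt_or_ge (p + 1) r with h1 | h1
      · exact Submodule.subset_span ⟨p + 1, q, h1, by omega, rfl⟩
      · obtain rfl : p + 1 = r := by omega
        have := hmulr _ q _ hr
        rwa [show p + 1 + q = p + q + 1 by omega] at this
    | zero => rw [mul_zero]; exact Submodule.zero_mem _
    | add _ _ _ _ h1 h2 => rw [mul_add]; exact Submodule.add_mem _ h1 h2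
    | smul c _ _ h1 => rw [mul_smul_comm]; exact Submodule.smul_mem _ _ h1
  have hS : ∀ n, a ^ (r + n) * b ∈ S (r + n) := by
    intro n
    induction n with
    | zero => simpa using hr
    | succ n ih =>
      rw [← add_assoc, pow_succ', mul_assoc]
      exact hmull _ _ ih
  -- In degree `r + N`, fewer than `r` factors on the left leave at least `N` on the right, and
  -- these kill `m`.
  refine ⟨r + N, ?_⟩
  have key : ∀ T ∈ S (r + N), T m = 0 := by
    intro T hT
    induction hT using Submodule.span_induction with
    | mem T hT =>
      obtain ⟨p, q, hp, hpq, rfl⟩ := hT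
      obtain ⟨q', rfl⟩ : ∃ q', q = q' + N := ⟨q - N, by omega⟩
      rw [pow_add, ← mul_assoc, Module.End.mul_apply, hm, map_zero]
    | zero => rfl
    | add _ _ _ _ h1 h2 => rw [LinearMap.add_apply, h1, h2, add_zero]
    | smul c _ _ h1 => rw [LinearMap.smul_apply, h1, smul_zero]
  exact key _ (hS N)

/-- Carries the bound by a line from a weight space to its reflection. -/
theorem exists_le_span_singleton {W W' : Submodule Kv V} {T : Module.End Kv V}
    (hT : ∀ m ∈ W, T m ∈ W') (hinj : ∀ m ∈ W, T m = 0 → m = 0)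
    (h : ∃ u, W' ≤ Submodule.span Kv {u}) : ∃ u, W ≤ Submodule.span Kv {u} := by
  obtain ⟨u, hu⟩ := h
  by_cases hW : W = ⊥
  · exact ⟨0, by simp [hW]⟩
  obtain ⟨m₀, hm₀, h0⟩ := Submodule.exists_mem_ne_zero_of_ne_bot hW
  refine ⟨m₀, fun m hm => ?_⟩
  obtain ⟨c, hc⟩ := Submodule.mem_span_singleton.1 (hu (hT m hm))
  obtain ⟨c₀, hc₀⟩ := Submodule.mem_span_singleton.1 (hu (hT m₀ hm₀))
  have hne : c₀ ≠ 0 := by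
    rintro rfl
    rw [zero_smul] at hc₀
    exact h0 (hinj _ hm₀ hc₀.symm)
  refine Submodule.mem_span_singleton.2 ⟨c / c₀, ?_⟩
  refine (sub_eq_zero.1 (hinj _ (W.sub_mem hm (W.smul_mem (c / c₀) hm₀)) ?_)).symm
  rw [map_sub, map_smul, ← hc, ← hc₀, smul_smul, div_mul_cancel₀ _ hne, sub_self]

end Sl2

namespace CartanDatum

variable {I : Type*} [Fintype I] [DecidableEq I] {D : CartanDatum I}

/-! ### Integrable highest weight modules -/

section HighestWeight

variable {V : Type*} [AddCommGroup V] [Module Kv V]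

/-- The operators on an integrable highest weight module with highest weight vector `η`. -/
structure IsHighestWeight (D : CartanDatum I) (θ : I → ℤ) (e f : I → Module.End Kv V)
    (k : (I → ℤ) → Module.End Kv V) (η : V) : Prop where
  k_f : ∀ y j, k y * f j = vv ^ (-D.simpleRoot j y) • (f j * k y)
  comm_self : ∀ i, e i * f i - f i * e i = (D.vi i - (D.vi i)⁻¹)⁻¹ •
      (k (Pi.single i (D.d i : ℤ)) - k (Pi.single i (-(D.d i : ℤ))))
  comm_ne : ∀ i j, i ≠ j → e i * f j = f j * e i
  serre_f : ∀ i j, i ≠ j → ∑ ab ∈ Finset.HasAntidiagonal.antidiagonal (1 - D.cartan i j).toNat,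
      ((-1) ^ ab.2 * qbinom (D.vi i) ab.1 ab.2) • (f i ^ ab.1 * f j * f i ^ ab.2) = 0
  e_eta : ∀ i, e i η = 0
  k_eta : ∀ y, k y η = vv ^ (D.emb θ y) • η
  f_eta : ∀ i, ∃ N, (f i ^ N) η = 0
  cyclic : ∀ W : Submodule Kv V, η ∈ W → (∀ i, ∀ m ∈ W, e i m ∈ W) → (∀ i, ∀ m ∈ W, f i m ∈ W) →
    (∀ y, ∀ m ∈ W, k y m ∈ W) → W = ⊤

/-- The span of the vectors `f_{i₁} ⋯ f_{iₙ} η` with `θ - ε_{i₁} - ⋯ - ε_{iₙ} = x`. -/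
def wtSpan (θ : I → ℤ) (f : I → Module.End Kv V) (η : V) (x : I → ℤ) : Submodule Kv V :=
  Submodule.span Kv {m | ∃ w : List I, θ - (w.map eps).sum = x ∧ (w.map f).prod η = m}

namespace IsHighestWeight

variable {θ : I → ℤ} {e f : I → Module.End Kv V} {k : (I → ℤ) → Module.End Kv V} {η : V}

omit [Fintype I] in
theorem eta_mem : η ∈ wtSpan θ f η θ :=
  Submodule.subset_span ⟨[], by simp, by simp⟩

omit [Fintype I] in
theorem f_mem {x : I → ℤ} {m : V} (i : I) (hm : m ∈ wtSpan θ f η x) :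
    f i m ∈ wtSpan θ f η (x - eps i) := by
  induction hm using Submodule.span_induction with
  | mem m hm =>
    obtain ⟨w, rfl, rfl⟩ := hm
    refine Submodule.subset_span ⟨i :: w, ?_, by simp⟩
    rw [List.map_cons, List.sum_cons]
    abel
  | zero => rw [map_zero]; exact Submodule.zero_mem _
  | add _ _ _ _ h1 h2 => rw [map_add]; exact Submodule.add_mem _ h1 h2
  | smul c _ _ h => rw [map_smul]; exact Submodule.smul_mem _ _ h

omit [Fintype I] in
theorem induction {C : (I → ℤ) → V → Prop} (eta : C θ η)
    (step : ∀ i x m, m ∈ wtSpan θ f η x → C x m → C (x - eps i) (f i m))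
    (zero : ∀ x, C x 0) (add : ∀ x m m', C x m → C x m' → C x (m + m'))
    (smul : ∀ x (c : Kv) m, C x m → C x (c • m)) {x : I → ℤ} {m : V}
    (hm : m ∈ wtSpan θ f η x) : C x m := by
  have key : ∀ w : List I, C (θ - (w.map eps).sum) ((w.map f).prod η) := by
    intro w
    induction w with
    | nil => simpa using eta
    | cons i w ih =>
      have := step i _ _ (Submodule.subset_span ⟨w, rfl, rfl⟩) ih
      rw [List.map_cons, List.sum_cons, List.map_cons, List.prod_cons, Module.End.mul_apply]
      rwa [show θ - (eps i + (w.map eps).sum) = θ - (w.map eps).sum - eps i by abel]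
  induction hm using Submodule.span_induction with
  | mem m hm =>
    obtain ⟨w, rfl, rfl⟩ := hm
    exact key w
  | zero => exact zero x
  | add _ _ _ _ h1 h2 => exact add x _ _ h1 h2
  | smul c _ _ h => exact smul x c _ h

variable (H : D.IsHighestWeight θ e f k η)
include H

theorem k_apply (y : I → ℤ) {x : I → ℤ} {m : V} (hm : m ∈ wtSpan θ f η x) :
    k y m = vv ^ (D.emb x y) • m := by
  revert y
  refine induction (C := fun x m => ∀ y, k y m = vv ^ (D.emb x y) • m) (fun y => H.k_eta y) ?_ ?_
    ?_ ?_ hm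
  · intro i x m _ ih y
    rw [← Module.End.mul_apply, H.k_f, LinearMap.smul_apply, Module.End.mul_apply, ih, map_smul,
      smul_smul, ← zpow_add₀ vv_ne_zero, map_sub, emb_eps, LinearMap.sub_apply]
    congr 2
    ring
  · intro x y; simp
  · intro x m m' h h' y; rw [map_add, h, h', smul_add]
  · intro x c m h y; rw [map_smul, h, smul_comm]

theorem e_f_self (i : I) {x : I → ℤ} {m : V} (hm : m ∈ wtSpan θ f η x) :
    e i (f i m) = f i (e i m) + qint (D.vi i) (D.pair i x) • m := by
  have h := congrArg (fun T : Module.End Kv V => T m) (H.comm_self i)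
  simp only [LinearMap.sub_apply, LinearMap.smul_apply, Module.End.mul_apply, H.k_apply _ hm,
    emb_single] at h
  rw [← sub_smul, smul_smul] at h
  rw [← sub_eq_iff_eq_add', h, qint, vi_zpow, vi_zpow, div_eq_inv_mul, neg_mul, mul_neg]

/-- Moving `e_i` to the right through a word in the `f_j` produces only shorter words with scalars,
and `e_i` kills `η`. Hence words in the `f_j` alone already span the module. -/
theorem e_mem {x : I → ℤ} {m : V} (i : I) (hm : m ∈ wtSpan θ f η x) :
    e i m ∈ wtSpan θ f η (x + eps i) := by
  refine induction (C := fun x m => e i m ∈ wtSpan θ f η (x + eps i)) ?_ ?_ ?_ ?_ ?_ hm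
  · rw [H.e_eta]; exact Submodule.zero_mem _
  · intro j x m hm ih
    have h1 := f_mem j ih
    rw [show x + eps i - eps j = x - eps j + eps i by abel] at h1
    by_cases hij : i = j
    · subst hij
      rw [H.e_f_self i hm]
      refine Submodule.add_mem _ h1 (Submodule.smul_mem _ _ ?_)
      rwa [sub_add_cancel]
    · rwa [← Module.End.mul_apply, H.comm_ne i j hij]
  · intro x; rw [map_zero]; exact Submodule.zero_mem _
  · intro x m m' h h'; rw [map_add]; exact Submodule.add_mem _ h h'
  · intro x c m h; rw [map_smul]; exact Submodule.smul_mem _ _ h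

theorem iSup_wtSpan : ⨆ x, wtSpan θ f η x = ⊤ := by
  have key : ∀ (T : Module.End Kv V) (g : (I → ℤ) → (I → ℤ)),
      (∀ x, ∀ m ∈ wtSpan θ f η x, T m ∈ wtSpan θ f η (g x)) →
      ∀ m ∈ ⨆ x, wtSpan θ f η x, T m ∈ ⨆ x, wtSpan θ f η x := by
    intro T g h m hm
    have : ⨆ x, wtSpan θ f η x ≤ (⨆ x, wtSpan θ f η x).comap T :=
      iSup_le fun x m hm => Submodule.mem_iSup_of_mem (g x) (h x m hm)
    exact this hm
  refine H.cyclic _ (Submodule.mem_iSup_of_mem θ eta_mem) ?_ ?_ ?_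
  · exact fun i => key _ (fun x => x + eps i) fun x m hm => H.e_mem i hm
  · exact fun i => key _ (fun x => x - eps i) fun x m hm => f_mem i hm
  · refine fun y => key _ id fun x m hm => ?_
    rw [H.k_apply y hm]
    exact Submodule.smul_mem _ _ hm

omit H

theorem height_sum_eps (w : List I) : height (w.map eps).sum = w.length := by
  induction w with
  | nil => simp
  | cons i w ih =>
    rw [List.map_cons, List.sum_cons, map_add, ih, height_eps, List.length_cons]
    push_cast
    ring

theorem height_le {x : I → ℤ} (hx : wtSpan θ f η x ≠ ⊥) : height x ≤ height θ := by
  by_contra h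
  refine hx ((Submodule.span_eq_bot).2 ?_)
  rintro m ⟨w, rfl, rfl⟩
  rw [map_sub, height_sum_eps] at h
  omega

theorem wtSpan_top_le : wtSpan θ f η θ ≤ Submodule.span Kv {η} := by
  refine Submodule.span_le.2 ?_
  rintro m ⟨w, hw, rfl⟩
  have h := height_sum_eps w
  rw [sub_eq_self.1 hw, map_zero] at h
  obtain rfl : w = [] := List.length_eq_zero_iff.1 (by omega)
  exact Submodule.mem_span_singleton_self _

omit [Fintype I] in
theorem wtSpan_le {x : I → ℤ} (hx : x ≠ θ) :
    wtSpan θ f η x ≤ ⨆ i, (wtSpan θ f η (x + eps i)).map (f i) := by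
  refine Submodule.span_le.2 ?_
  rintro m ⟨w, hw, rfl⟩
  rcases w with _ | ⟨i, w⟩
  · exact absurd (by simpa using hw.symm) hx
  · refine Submodule.mem_iSup_of_mem i ⟨(w.map f).prod η, Submodule.subset_span ⟨w, ?_, rfl⟩, ?_⟩
    · rw [← hw, List.map_cons, List.sum_cons]
      abel
    · rw [List.map_cons, List.prod_cons, Module.End.mul_apply]

include H

theorem e_pow_mem {x : I → ℤ} {m : V} (i : I) (hm : m ∈ wtSpan θ f η x) (n : ℕ) :
    (e i ^ n) m ∈ wtSpan θ f η (x + (n : ℤ) • eps i) := by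
  induction n with
  | zero => simpa using hm
  | succ n ih =>
    rw [pow_succ', Module.End.mul_apply]
    have := H.e_mem i ih
    rwa [show x + (n : ℤ) • eps i + eps i = x + ((n + 1 : ℕ) : ℤ) • eps i by
      push_cast; module] at this

/-- True for `η` by assumption; applying `f_j` preserves it, for `j ≠ i` by the Serre relation. -/
theorem exists_f_pow_eq_zero {x : I → ℤ} {m : V} (i : I) (hm : m ∈ wtSpan θ f η x) :
    ∃ N, (f i ^ N) m = 0 := by
  refine induction (C := fun x m => ∃ N, (f i ^ N) m = 0) ?_ ?_ ?_ ?_ ?_ hm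
  · exact H.f_eta i
  · rintro j x m _ ⟨N, hN⟩
    by_cases hij : i = j
    · subst hij
      refine ⟨N, ?_⟩
      rw [← Module.End.mul_apply, ← pow_succ, pow_succ', Module.End.mul_apply, hN, map_zero]
    · refine exists_pow_apply_eq_zero (fun ab => (-1) ^ ab.2 * qbinom (D.vi i) ab.1 ab.2) ?_
        (H.serre_f i j hij) hN
      simp [qbinom, qfact_zero, (D.isGeneric_vi i).qfact_ne_zero]
  · exact fun _ => ⟨0, by simp⟩
  · rintro x m m' ⟨N, hN⟩ ⟨N', hN'⟩
    refine ⟨N + N', ?_⟩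
    rw [map_add, pow_add, Module.End.mul_apply, Module.End.mul_apply, hN', map_zero, add_zero,
      ← Module.End.mul_apply, ← pow_add, add_comm, pow_add, Module.End.mul_apply, hN, map_zero]
  · rintro x c m ⟨N, hN⟩
    exact ⟨N, by rw [map_smul, hN, smul_zero]⟩

theorem isSl2 (i : I) :
    IsSl2 (D.vi i) (fun n m => ∃ x, D.pair i x = n ∧ m ∈ wtSpan θ f η x) (e i) (f i) where
  e_mem := by
    rintro _ m ⟨x, rfl, hm⟩
    exact ⟨x + eps i, by rw [map_add, pair_eps_self], H.e_mem i hm⟩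
  f_mem := by
    rintro _ m ⟨x, rfl, hm⟩
    exact ⟨x - eps i, by rw [map_sub, pair_eps_self], f_mem i hm⟩
  comm := by
    rintro _ m ⟨x, rfl, hm⟩
    exact H.e_f_self i hm

/-- On a space of weight `-n ≤ 0` the operator `e_i ^ n` is injective. -/
theorem eq_zero_of_e_pow_eq_zero {x : I → ℤ} {m : V} {i : I} {n : ℕ} (hn : D.pair i x = -n)
    (hm : m ∈ wtSpan θ f η x) (h : (e i ^ n) m = 0) : m = 0 := by
  obtain ⟨N, hN⟩ := H.exists_f_pow_eq_zero i hm
  -- Exchanging `e_i` and `f_i` makes the weight `n`; the nilpotency required is then that of `f_i`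
  -- on `m`.
  exact (H.isSl2 i).symm.eq_zero_of_f_pow_eq_zero (D.isGeneric_vi i) N (n := n)
    ⟨x, hn, hm⟩ le_rfl hN h

theorem e_pow_mem_refl {x : I → ℤ} {m : V} {i : I} {n : ℕ} (hn : D.pair i x = -n)
    (hm : m ∈ wtSpan θ f η x) : (e i ^ n) m ∈ wtSpan θ f η (D.refl i x) := by
  have := H.e_pow_mem i hm n
  rwa [show x + (n : ℤ) • eps i = D.refl i x by rw [refl, hn]; module] at this

theorem wtSpan_refl_ne_bot {x : I → ℤ} {i : I} (hi : D.pair i x < 0) (hx : wtSpan θ f η x ≠ ⊥) :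
    wtSpan θ f η (D.refl i x) ≠ ⊥ := by
  obtain ⟨n, hn⟩ : ∃ n : ℕ, D.pair i x = -n := ⟨(-D.pair i x).toNat, by omega⟩
  obtain ⟨m, hm, h0⟩ := Submodule.exists_mem_ne_zero_of_ne_bot hx
  exact (Submodule.ne_bot_iff _).2
    ⟨_, H.e_pow_mem_refl hn hm, fun h => h0 (H.eq_zero_of_e_pow_eq_zero hn hm h)⟩

end IsHighestWeight

end HighestWeight

/-! ### Weights, multiplicities and the bound on the dimension -/

namespace IsHighestWeight

variable {V : Type*} [AddCommGroup V] [Module Kv V] {θ : I → ℤ} {e f : I → Module.End Kv V}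
  {k : (I → ℤ) → Module.End Kv V} {η : V}

theorem exists_wtSpan_ne_bot {x : I → ℤ} (hne : x ≠ θ) (hx : wtSpan θ f η x ≠ ⊥) :
    ∃ i, wtSpan θ f η (x + eps i) ≠ ⊥ := by
  by_contra! h
  exact hx (le_bot_iff.1 ((wtSpan_le hne).trans (by simp [h])))

theorem height_lt_refl {x : I → ℤ} {i : I} (hi : D.pair i x < 0) :
    height x < height (D.refl i x) := by
  rw [refl, map_sub, map_smul, height_eps, smul_eq_mul]
  omega

/-- Induction on the weights from the highest weight downwards: a weight is the reflection of a
higher weight, or it is dominant. -/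
theorem weight_induction (H : D.IsHighestWeight θ e f k η) {C : (I → ℤ) → Prop}
    (refl : ∀ x i, D.pair i x < 0 → wtSpan θ f η x ≠ ⊥ → C (D.refl i x) → C x)
    (dominant : ∀ x, (∀ i, 0 ≤ D.pair i x) → wtSpan θ f η x ≠ ⊥ →
      (∀ i, wtSpan θ f η (x + eps i) ≠ ⊥ → C (x + eps i)) → C x)
    {x : I → ℤ} (hx : wtSpan θ f η x ≠ ⊥) : C x := by
  induction hn : (height θ - height x).toNat using Nat.strong_induction_on generalizing x with
  | _ n ih =>
    have hle := height_le hx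
    by_cases hd : ∃ i, D.pair i x < 0
    · obtain ⟨i, hi⟩ := hd
      have hr := H.wtSpan_refl_ne_bot hi hx
      have := height_le hr
      have := height_lt_refl hi
      exact refl x i hi hx (ih _ (by omega) hr rfl)
    · push Not at hd
      refine dominant x hd hx fun i hi => ih _ ?_ hi rfl
      have := height_le hi
      rw [map_add, height_eps] at this ⊢
      omega

/-- Reflections preserve roots and zero, and a dominant weight just below a root or zero is again a
root or zero. -/
theorem isRt_or_eq_zero (H : D.IsHighestWeight θ e f k η) (hθ : D.IsRt θ) {x : I → ℤ}
    (hx : wtSpan θ f η x ≠ ⊥) : D.IsRt x ∨ x = 0 := by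
  refine H.weight_induction (C := fun x => D.IsRt x ∨ x = 0) ?_ ?_ hx
  · rintro x i - - (h | h)
    · left
      rw [← D.refl_refl i x]
      exact h.reflect i
    · right
      rw [← D.refl_refl i x, h, refl, map_zero, zero_smul, sub_zero]
  · intro x hdom hx ih
    by_cases hne : x = θ
    · exact Or.inl (hne ▸ hθ)
    · obtain ⟨i, hi⟩ := exists_wtSpan_ne_bot hne hx
      exact isRt_or_zero_of_dominant hdom (ih i hi)

/-- A non-dominant root space embeds into its reflection by a power of `e_i`. A dominant one other
than the top is spanned by the images under `f_j` of the spaces just above, and only one such space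
is nonzero. -/
theorem exists_wtSpan_le_span_singleton (H : D.IsHighestWeight θ e f k η) (hθ : D.IsRt θ)
    {x : I → ℤ} (hx : D.IsRt x) : ∃ u, wtSpan θ f η x ≤ Submodule.span Kv {u} := by
  by_cases h0 : wtSpan θ f η x = ⊥
  · exact ⟨0, by simp [h0]⟩
  refine H.weight_induction (C := fun x => D.IsRt x → ∃ u, wtSpan θ f η x ≤ Submodule.span Kv {u})
    ?_ ?_ h0 hx
  · intro x i hi _ ih hx
    obtain ⟨n, hn⟩ : ∃ n : ℕ, D.pair i x = -n := ⟨(-D.pair i x).toNat, by omega⟩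
    exact exists_le_span_singleton (fun m hm => H.e_pow_mem_refl hn hm)
      (fun m hm h => H.eq_zero_of_e_pow_eq_zero hn hm h) (ih (hx.reflect i))
  · intro x hdom h0 ih hx
    by_cases hne : x = θ
    · exact ⟨η, hne ▸ wtSpan_top_le⟩
    · obtain ⟨i, hi⟩ := exists_wtSpan_ne_bot hne h0
      have hrt : ∀ j, wtSpan θ f η (x + eps j) ≠ ⊥ → D.IsRt (x + eps j) := by
        intro j hj
        refine (H.isRt_or_eq_zero hθ hj).resolve_right fun h => ?_
        have := hdom j
        rw [eq_neg_of_add_eq_zero_left h, map_neg, pair_eps_self] at this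
        omega
      obtain ⟨u, hu⟩ := ih i hi (hrt i hi)
      refine ⟨f i u, (wtSpan_le hne).trans (iSup_le fun j => ?_)⟩
      by_cases hj : wtSpan θ f η (x + eps j) = ⊥
      · simp [hj]
      · obtain rfl := hx.eq_of_add_eps hdom (hrt i hi) (hrt j hj)
        refine (Submodule.map_mono hu).trans ?_
        rw [Submodule.map_span, Set.image_singleton]

theorem exists_span_range_eq_top (H : D.IsHighestWeight θ e f k η) (hθ : D.IsRt θ) :
    ∃ g : D.R ⊕ I → V, Submodule.span Kv (Set.range g) = ⊤ := by
  have h : ∀ x : I → ℤ, ∃ u, D.IsRt x → wtSpan θ f η x ≤ Submodule.span Kv {u} := by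
    intro x
    by_cases hx : D.IsRt x
    · obtain ⟨u, hu⟩ := H.exists_wtSpan_le_span_singleton hθ hx
      exact ⟨u, fun _ => hu⟩
    · exact ⟨0, fun h => absurd h hx⟩
  choose u hu using h
  choose r hr using fun α : D.R => (D.mem_R_iff_exists α.1).1 α.2
  refine ⟨Sum.elim (fun α => u (r α)) (fun i => f i (u (eps i))), eq_top_iff.2 ?_⟩
  rw [← H.iSup_wtSpan]
  refine iSup_le fun x => ?_
  by_cases hx : wtSpan θ f η x = ⊥
  · simp [hx]
  rcases H.isRt_or_eq_zero hθ hx with h | rfl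
  · refine (hu x h).trans (Submodule.span_mono (Set.singleton_subset_iff.2 ?_))
    refine ⟨.inl ⟨D.emb x, (emb_mem_R D).2 h⟩, ?_⟩
    have : r ⟨D.emb x, (emb_mem_R D).2 h⟩ = x := D.emb_injective (hr _).2
    simp [this]
  · refine (wtSpan_le hθ.ne_zero.symm).trans (iSup_le fun i => ?_)
    rw [zero_add]
    refine (Submodule.map_mono (hu _ (.simple i))).trans ?_
    rw [Submodule.map_span, Set.image_singleton]
    exact Submodule.span_mono (Set.singleton_subset_iff.2 ⟨.inr i, rfl⟩)

end IsHighestWeight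

/-! ### The module `Λ` -/

theorem toU_rel {a b : Free I} (h : D.Rel a b) : D.toU a = D.toU b :=
  RingQuot.mkAlgHom_rel Kv h

theorem K_zero_eq_one : D.K 0 = 1 := by
  rw [K, toU_rel (.K_zero), map_one]

theorem K_mul_K (y y' : I → ℤ) : D.K y * D.K y' = D.K (y + y') := by
  rw [K, K, ← map_mul, toU_rel (.K_add y y'), K]

/-- If the `K_i` commute with `z` up to powers of `v`, then so do all `K_y`. -/
theorem K_mul_eq_of_single {z : D.U} {μ : D.Wt}
    (h : ∀ i, D.K (Pi.single i 1) * z = vv ^ μ (Pi.single i 1) • (z * D.K (Pi.single i 1)))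
    (y : I → ℤ) : D.K y * z = vv ^ μ y • (z * D.K y) := by
  let S : AddSubgroup (I → ℤ) :=
    { carrier := {y | D.K y * z = vv ^ μ y • (z * D.K y)}
      zero_mem' := by simp [K_zero_eq_one]
      add_mem' := by
        intro a b ha hb
        simp only [Set.mem_ofPred_eq] at ha hb ⊢
        rw [← K_mul_K, mul_assoc, hb, mul_smul_comm, ← mul_assoc, ha, smul_mul_assoc, smul_smul,
          mul_assoc, map_add, zpow_add₀ vv_ne_zero, mul_comm (vv ^ μ b)]
      neg_mem' := by
        intro a ha
        simp only [Set.mem_ofPred_eq] at ha ⊢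
        have h1 : D.K (-a) * D.K a = 1 := by rw [K_mul_K, neg_add_cancel, K_zero_eq_one]
        have h2 : D.K a * D.K (-a) = 1 := by rw [K_mul_K, add_neg_cancel, K_zero_eq_one]
        have h3 : z * D.K (-a) = vv ^ μ a • (D.K (-a) * z) := by
          calc z * D.K (-a) = D.K (-a) * (D.K a * z) * D.K (-a) := by
                rw [← mul_assoc (D.K (-a)), h1, one_mul]
            _ = _ := by
                rw [ha, mul_smul_comm, smul_mul_assoc, ← mul_assoc, mul_assoc, h2, mul_one]
        rw [h3, smul_smul, map_neg, ← zpow_add₀ vv_ne_zero, neg_add_cancel, zpow_zero, one_smul] }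
  have hy : y = ∑ i, y i • Pi.single i (1 : ℤ) := by
    ext j; simp [Finset.sum_apply, Pi.single_apply]
  have : y ∈ S := by
    rw [hy]
    exact S.sum_mem fun i _ => S.zsmul_mem (h i) _
  exact this

theorem K_mul_F (y : I → ℤ) (j : I) :
    D.K y * D.F j = vv ^ (-D.simpleRoot j y) • (D.F j * D.K y) := by
  refine K_mul_eq_of_single (μ := -D.simpleRoot j) (fun i => ?_) y
  rw [LinearMap.neg_apply, IsAdjointModule.simpleRoot_single, one_mul, K, F, ← map_mul,
    toU_rel (.K_F i j), map_smul, map_mul]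

theorem E_F_self_comm (i : I) :
    D.E i * D.F i - D.F i * D.E i = (D.vi i - (D.vi i)⁻¹)⁻¹ •
      (D.K (Pi.single i (D.d i : ℤ)) - D.K (Pi.single i (-(D.d i : ℤ)))) := by
  rw [E, F, ← map_mul, ← map_mul, ← map_sub, toU_rel (.E_F_self i), map_smul, map_sub, K, K]

theorem E_mul_F {i j : I} (h : i ≠ j) : D.E i * D.F j = D.F j * D.E i := by
  rw [← sub_eq_zero, E, F, ← map_mul, ← map_mul, ← map_sub, toU_rel (.E_F_ne i j h), map_zero]

theorem serre_F_eq_zero {i j : I} (h : i ≠ j) :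
    ∑ ab ∈ Finset.HasAntidiagonal.antidiagonal (1 - D.cartan i j).toNat,
      ((-1) ^ ab.2 * qbinom (D.vi i) ab.1 ab.2) • (D.F i ^ ab.1 * D.F j * D.F i ^ ab.2) = 0 := by
  have := toU_rel (.serre_F (D := D) i j h)
  rw [serre, map_sum, map_zero] at this
  rw [← this]
  refine Finset.sum_congr rfl fun ab _ => ?_
  rw [map_smul, map_mul, map_mul, map_pow, map_pow, F, F]

/-- Induction on the elements of `U` as expressions in the generators. -/
theorem U_induction {C : D.U → Prop} (scalar : ∀ c : Kv, C (algebraMap Kv D.U c))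
    (add : ∀ a b, C a → C b → C (a + b)) (mul : ∀ a b, C a → C b → C (a * b))
    (hE : ∀ i, C (D.E i)) (hF : ∀ i, C (D.F i)) (hK : ∀ y, C (D.K y)) (u : D.U) : C u := by
  obtain ⟨a, rfl⟩ : ∃ a, D.toU a = u := RingQuot.mkAlgHom_surjective Kv D.Rel u
  induction a using FreeAlgebra.induction with
  | grade0 c => rw [AlgHom.commutes]; exact scalar c
  | grade1 g =>
    cases g with
    | E i => exact hE i
    | F i => exact hF i
    | K y => exact hK y
  | mul a b ha hb => rw [map_mul]; exact mul _ _ ha hb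
  | add a b ha hb => rw [map_add]; exact add _ _ ha hb

/-- The action of `U` on `Λ` by `ℚ(v)`-linear operators. -/
def lamRep (D : CartanDatum I) (lam : D.Wt) : D.U →ₐ[Kv] Module.End Kv (D.Lam lam) :=
  Algebra.lsmul Kv Kv (D.Lam lam)

theorem lamRep_apply (lam : D.Wt) (u : D.U) (m : D.Lam lam) : D.lamRep lam u m = u • m := rfl

theorem smul_eta (lam : D.Wt) (u : D.U) : u • D.eta lam = (D.leftIdeal lam).mkQ u := by
  have h := (D.leftIdeal lam).mkQ.map_smul u 1
  rw [smul_eq_mul, mul_one] at h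
  exact h.symm

theorem smul_eta_eq_zero {lam : D.Wt} {u : D.U} (h : u ∈ D.leftIdeal lam) : u • D.eta lam = 0 :=
  (smul_eta lam u).trans ((Submodule.Quotient.mk_eq_zero _).2 h)

theorem exists_smul_eta {lam : D.Wt} (m : D.Lam lam) : ∃ u : D.U, u • D.eta lam = m := by
  obtain ⟨u, hu⟩ := (D.leftIdeal lam).mkQ_surjective m
  exact ⟨u, (smul_eta lam u).trans hu⟩

theorem isHighestWeight_lam (D : CartanDatum I) (θ : I → ℤ) :
    D.IsHighestWeight θ (fun i => D.lamRep (D.emb θ) (D.E i)) (fun i => D.lamRep (D.emb θ) (D.F i))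
      (fun y => D.lamRep (D.emb θ) (D.K y)) (D.eta (D.emb θ)) where
  k_f y j := by rw [← map_mul, K_mul_F, map_smul, map_mul]
  comm_self i := by
    rw [← map_mul, ← map_mul, ← map_sub, E_F_self_comm, map_smul, map_sub]
  comm_ne i j h := by rw [← map_mul, E_mul_F h, map_mul]
  serre_f i j h := by
    rw [← map_zero (D.lamRep (D.emb θ)), ← serre_F_eq_zero h, map_sum]
    refine Finset.sum_congr rfl fun ab _ => ?_
    rw [map_smul, map_mul, map_mul, map_pow, map_pow]
  e_eta i := smul_eta_eq_zero (Submodule.subset_span (.inl (.inl ⟨i, rfl⟩)))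
  k_eta y := by
    have h := smul_eta_eq_zero (D := D) (lam := D.emb θ)
      (Submodule.subset_span (.inl (.inr ⟨y, rfl⟩)))
    rw [sub_smul, algebraMap_smul, sub_eq_zero] at h
    exact h
  f_eta i := by
    refine ⟨(D.pairing i (D.emb θ)).toNat + 1, ?_⟩
    rw [← map_pow]
    exact smul_eta_eq_zero (Submodule.subset_span (.inr ⟨i, rfl⟩))
  cyclic W h1 hE hF hK := by
    refine eq_top_iff.2 fun m _ => ?_
    obtain ⟨u, rfl⟩ := exists_smul_eta m
    have key : ∀ m ∈ W, u • m ∈ W := by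
      refine U_induction (C := fun u => ∀ m ∈ W, u • m ∈ W) ?_ ?_ ?_ hE hF hK u
      · intro c m hm
        rw [algebraMap_smul]
        exact W.smul_mem c hm
      · intro a b ha hb m hm
        rw [add_smul]
        exact W.add_mem (ha m hm) (hb m hm)
      · intro a b ha hb m hm
        rw [mul_smul]
        exact ha _ (hb _ hm)
    exact key _ h1

theorem exists_span_range_lam_eq_top {θ : I → ℤ} (hθ : D.IsRt θ) :
    ∃ g : D.R ⊕ I → D.Lam (D.emb θ), Submodule.span Kv (Set.range g) = ⊤ :=
  (D.isHighestWeight_lam θ).exists_span_range_eq_top hθ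

theorem IsRt.not_add_of_p_lt {x : I → ℤ} (hx : D.IsRt x) {i : I} (h2 : x ≠ -eps i) {k : ℕ}
    (hk : D.p i (D.emb x) < k) : ¬ D.IsRt (x + (k : ℤ) • eps i) := by
  intro h
  by_cases h1 : x = eps i
  · subst h1
    have := IsRt.eq_of_smul_eps (D := D) (i := i) (n := (k : ℤ) + 1) (by convert h using 1; module)
    omega
  · have := hx.le_p h1 h2 h
    omega

section Action

variable {V : Type*} [AddCommGroup V] [Module Kv V] {X : (I → ℤ) → V} {t : I → V}
  {e f : I → Module.End Kv V}

namespace IsAdjointAction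

theorem div_X (H : D.IsAdjointAction X t e f) {i : I} {x : I → ℤ} (hx : D.IsRt x)
    (h : x ≠ -eps i) (k : ℕ) : (qfact (D.vi i) k)⁻¹ • (e i ^ k) (X x) =
      qbinom (D.vi i) (D.q i (D.emb x)) k • X (x + (k : ℤ) • eps i) := by
  rw [H.e_pow_X hx h, smul_smul, (D.isGeneric_vi i).prod_qint_eq]

theorem div_two_neg (H : D.IsAdjointAction X t e f) (i : I) :
    (qfact (D.vi i) 2)⁻¹ • (e i ^ 2) (X (-eps i)) = X (eps i) := by
  have h : qfact (D.vi i) 2 = qint (D.vi i) 2 := by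
    rw [qfact_succ, (D.isGeneric_vi i).qfact_one, one_mul]
    rfl
  rw [H.e_pow_two_neg, h, smul_smul,
    inv_mul_cancel₀ ((D.isGeneric_vi i).qint_ne_zero (by norm_num)), one_smul]

theorem f_X_add_eps (H : D.IsAdjointAction X t e f) {i : I} {x : I → ℤ} (hx : D.IsRt x)
    (hxi : D.IsRt (x + eps i)) : ∃ c : Kv, c ≠ 0 ∧ f i (X (x + eps i)) = c • X x := by
  refine ⟨qint (D.vi i) (D.p i (D.emb (x + eps i)) + 1),
    (D.isGeneric_vi i).qint_ne_zero (by omega), ?_⟩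
  rw [H.f_X i _ hxi, add_sub_cancel_right]
  exact fun h => hx.ne_zero (by simpa using h)

theorem f_f_eps (H : D.IsAdjointAction X t e f) (i : I) :
    ∃ c : Kv, c ≠ 0 ∧ f i (f i (X (eps i))) = c • X (-eps i) := by
  refine ⟨qint (D.vi i) |D.cartan i i|, (D.isGeneric_vi i).qint_ne_zero ?_, ?_⟩
  · rw [cartan_self]; norm_num
  · rw [H.f_pos, H.f_t]

/-- The reflection `s_i` sends `θ - (⟨i, θ⟩ + 1) ε_i` to `θ + ε_i`, which is not a root. The case `θ
= ε_i`, where the string passes through zero, is separate. -/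
theorem f_pow_top (H : D.IsAdjointAction X t e f) {θ : I → ℤ} (hθ : D.IsTop θ) (i : I) :
    (f i ^ ((D.pair i θ).toNat + 1)) (X θ) = 0 := by
  by_cases h : θ = eps i
  · have := H.symm.e_pow_neg i (k := (D.pair i θ).toNat + 1) (by
      rw [h, pair_eps_self]; decide)
    rwa [neg_neg, ← h] at this
  · have h1 := H.symm.e_pow_X (i := i) hθ.1.neg (fun e => h (neg_injective e))
      ((D.pair i θ).toNat + 1)
    rw [neg_neg] at h1
    rw [h1, H.X_zero, smul_zero]
    intro h2
    have h3 := h2.reflect i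
    have h4 := hθ.dominant i
    obtain ⟨n, hn⟩ := Int.eq_ofNat_of_zero_le h4
    refine (hθ.2 i).1 ?_
    convert h3 using 1
    simp only [refl, map_neg, map_add, map_smul, pair_eps_self, hn, Int.toNat_natCast, smul_eq_mul]
    push_cast
    module

/-- A subspace which contains the highest root vector and is stable under the lowering operators
contains all vectors of the family. -/
theorem mem_of_top_mem (H : D.IsAdjointAction X t e f) (hD : D.IsIrreducible) {θ : I → ℤ}
    (hθ : D.IsTop θ) {W : Submodule Kv V} (hW : ∀ i, ∀ m ∈ W, f i m ∈ W) (h : X θ ∈ W) :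
    (∀ x, X x ∈ W) ∧ ∀ i, t i ∈ W := by
  have hX : ∀ x, D.IsRt x → X x ∈ W := by
    intro x hx
    refine hθ.induction hD (C := fun x => X x ∈ W) h ?_ ?_ hx
    · intro x i hx hxi hm
      obtain ⟨c, hc, he⟩ := H.f_X_add_eps hx hxi
      have := hW i _ hm
      rwa [he, W.smul_mem_iff hc] at this
    · intro i hm
      obtain ⟨c, hc, he⟩ := H.f_f_eps i
      have := hW i _ (hW i _ hm)
      rwa [he, W.smul_mem_iff hc] at this
  refine ⟨fun x => ?_, fun i => ?_⟩
  · by_cases hx : D.IsRt x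
    · exact hX x hx
    · rw [H.X_zero x hx]; exact W.zero_mem
  · rw [← H.f_pos]
    exact hW i _ (hX _ (.simple i))

/-- Every root is reached from the top by lowering operators whose coefficients are nonzero and the
same for both families, and each `t_i` is `f_i` applied to the vector of `ε_i`. -/
theorem eq_of_top_eq {X' : (I → ℤ) → V} {t' : I → V} (H : D.IsAdjointAction X t e f)
    (H' : D.IsAdjointAction X' t' e f) (hD : D.IsIrreducible) {θ : I → ℤ} (hθ : D.IsTop θ)
    (h : X θ = X' θ) : X = X' ∧ t = t' := by
  have hX : ∀ x, D.IsRt x → X x = X' x := by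
    intro x hx
    refine hθ.induction hD (C := fun x => X x = X' x) h ?_ ?_ hx
    · intro x i hx hxi hm
      have hne : x + eps i ≠ eps i := fun h => hx.ne_zero (by simpa using h)
      have h1 := H.f_X i _ hxi hne
      rw [hm, H'.f_X i _ hxi hne, add_sub_cancel_right] at h1
      exact (smul_right_injective V ((D.isGeneric_vi i).qint_ne_zero (by omega)) h1).symm
    · intro i hm
      have h1 := H.f_t i i
      rw [← H.f_pos, hm, H'.f_pos, H'.f_t, cartan_self] at h1
      exact (smul_right_injective V ((D.isGeneric_vi i).qint_ne_zero (by norm_num)) h1).symm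
  refine ⟨funext fun x => ?_, funext fun i => ?_⟩
  · by_cases hx : D.IsRt x
    · exact hX x hx
    · rw [H.X_zero x hx, H'.X_zero x hx]
  · rw [← H.f_pos, ← H'.f_pos, hX _ (.simple i)]

end IsAdjointAction

end Action

/-! ### The standard basis of `Λ` -/

/-- The universal property of `Λ`. -/
theorem exists_lam_hom {V : Type*} [AddCommGroup V] [Module Kv V] {lam : D.Wt}
    (ρ : D.U →ₐ[Kv] Module.End Kv V) (m : V) (hE : ∀ i, ρ (D.E i) m = 0)
    (hK : ∀ y, ρ (D.K y) m = vv ^ lam y • m)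
    (hF : ∀ i, (ρ (D.F i) ^ ((D.pairing i lam).toNat + 1)) m = 0) :
    ∃ φ : D.Lam lam →ₗ[Kv] V, (∀ u x, φ (u • x) = ρ u (φ x)) ∧ φ (D.eta lam) = m := by
  have hker : ∀ u ∈ D.leftIdeal lam, ρ u m = 0 := by
    intro u hu
    induction hu using Submodule.span_induction with
    | mem u hu =>
      rcases hu with (⟨i, rfl⟩ | ⟨y, rfl⟩) | ⟨i, rfl⟩
      · exact hE i
      · simp [hK, AlgHom.commutes]
      · simp only [map_pow]; exact hF i
    | zero => rw [map_zero, LinearMap.zero_apply]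
    | add _ _ _ _ h1 h2 => rw [map_add, LinearMap.add_apply, h1, h2, add_zero]
    | smul a u _ h => rw [smul_eq_mul, map_mul, Module.End.mul_apply, h, map_zero]
  let φ₀ : D.U →ₗ[Kv] V := (LinearMap.applyₗ m).comp ρ.toLinearMap
  let φ : D.Lam lam →ₗ[Kv] V :=
    (((D.leftIdeal lam).restrictScalars Kv).liftQ φ₀ hker).comp
      (Submodule.Quotient.restrictScalarsEquiv Kv (D.leftIdeal lam)).symm.toLinearMap
  have hφ : ∀ u : D.U, φ (u • D.eta lam) = ρ u m := fun u => by
    rw [smul_eta]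
    rfl
  refine ⟨φ, fun u x => ?_, ?_⟩
  · obtain ⟨a, rfl⟩ := exists_smul_eta x
    rw [← mul_smul, hφ, hφ, map_mul, Module.End.mul_apply]
  · have := hφ 1
    rwa [one_smul, map_one] at this

/-- `Λ` is the adjoint module. -/
theorem exists_lam_equiv (hD : D.IsIrreducible) {θ : I → ℤ} (hθ : D.IsTop θ) :
    ∃ ψ : D.Lam (D.emb θ) ≃ₗ[Kv] (D.R ⊕ I →₀ Kv), ψ (D.eta (D.emb θ)) = rootVec D.adjB θ ∧
      (∀ i x, ψ (D.E i • x) = D.adjE i (ψ x)) ∧ (∀ i x, ψ (D.F i • x) = D.adjF i (ψ x)) ∧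
      ∀ y x, ψ (D.K y • x) = D.adjK y (ψ x) := by
  have H := D.isAdjointModule_adj
  obtain ⟨ρ, hE, hF, hK⟩ := H.exists_rep
  obtain ⟨φ, hφ, hη⟩ := exists_lam_hom (lam := D.emb θ) ρ (rootVec D.adjB θ)
    (fun i => by
      rw [hE, H.e_X i θ hθ.1 (hθ.2 i).2, H.X_zero _ (hθ.2 i).1, smul_zero])
    (fun y => by rw [hK, H.k_X])
    (fun i => by rw [hF]; exact H.f_pow_top hθ i)
  have hsurj : Function.Surjective φ := by
    rw [← LinearMap.range_eq_top, eq_top_iff, ← H.span_eq_top, Submodule.span_le]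
    have := H.mem_of_top_mem hD hθ (W := LinearMap.range φ) (by
      rintro i _ ⟨x, rfl⟩
      exact ⟨D.F i • x, by rw [hφ, hF]⟩) ⟨_, hη⟩
    rintro _ (⟨x, rfl⟩ | ⟨i, rfl⟩)
    · exact this.1 x
    · exact this.2 i
  obtain ⟨g, hg⟩ := exists_span_range_lam_eq_top hθ.1
  have := Fintype.ofFinite D.R
  have hfd : Module.Finite Kv (D.Lam (D.emb θ)) :=
    Module.Finite.of_surjective (Fintype.linearCombination Kv g)
      (by rw [← LinearMap.range_eq_top, Fintype.range_linearCombination, hg])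
  have hle : Module.finrank Kv (D.Lam (D.emb θ)) ≤ Fintype.card (D.R ⊕ I) := by
    rw [← finrank_top, ← hg]
    exact finrank_range_le_card g
  -- The spanning family of `Λ` is indexed by the basis of the target, so a surjection is an
  -- isomorphism.
  have hinj : Function.Injective φ := by
    refine (LinearMap.injective_iff_surjective_of_finrank_eq_finrank (le_antisymm ?_ ?_)).2 hsurj
    · rwa [Module.finrank_finsupp_self]
    · exact LinearMap.finrank_le_finrank_of_surjective hsurj
  refine ⟨LinearEquiv.ofBijective φ ⟨hinj, hsurj⟩, hη, fun i x => ?_, fun i x => ?_, fun y x => ?_⟩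
  · rw [← hE]; exact hφ _ _
  · rw [← hF]; exact hφ _ _
  · rw [← hK]; exact hφ _ _

theorem exists_isStandardBasis (hD : D.IsIrreducible) {θ : I → ℤ} (hθ : D.IsTop θ) :
    ∃ b : Module.Basis (D.R ⊕ I) Kv (D.Lam (D.emb θ)), D.IsStandardBasis (D.emb θ) b := by
  obtain ⟨ψ, hη, hE, hF, hK⟩ := exists_lam_equiv hD hθ
  let b : Module.Basis (D.R ⊕ I) Kv (D.Lam (D.emb θ)) := Module.Basis.ofRepr ψ
  have hb : ∀ s, ψ (b s) = D.adjB s := fun s => b.repr_self s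
  refine ⟨b, ?_, ?_, ?_, ?_, ?_, ?_, ?_, ?_, ?_, ?_, ?_⟩
  · intro h
    apply ψ.injective
    rw [hb, hη, rootVec_of_isRt _ hθ.1]
  · intro α y
    apply ψ.injective
    rw [hK, map_smul, hb]
    simp [adjK, adjB]
  · intro i y
    apply ψ.injective
    rw [hK, map_smul, hb]
    simp [adjK, adjB]
  · intro i α h
    apply ψ.injective
    rw [hE, map_smul, hb, hb]
    simp [adjE, adjB, h]
  · intro i
    apply ψ.injective
    rw [hE, hb, hb]
    simp [adjE, adjB, p_negRt]
  · intro i α h h'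
    apply ψ.injective
    rw [hE, hb, map_zero]
    simp [adjE, adjB, h, h']
  · intro i j
    apply ψ.injective
    rw [hE, map_smul, hb, hb]
    simp [adjE, adjB]
  · intro i α h
    apply ψ.injective
    rw [hF, map_smul, hb, hb]
    simp [adjF, adjB, h]
  · intro i
    apply ψ.injective
    rw [hF, hb, hb]
    simp [adjF, adjB, q_posRt]
  · intro i α h h'
    apply ψ.injective
    rw [hF, hb, map_zero]
    simp [adjF, adjB, h, h']
  · intro i j
    apply ψ.injective
    rw [hF, map_smul, hb, hb]
    simp [adjF, adjB]

/-! ### Uniqueness, divided powers and positivity in a standard basis -/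

namespace IsStandardBasis

variable {lam : D.Wt} {b : Module.Basis (D.R ⊕ I) Kv (D.Lam lam)}

theorem isAdjointAction (hb : D.IsStandardBasis lam b) :
    D.IsAdjointAction (rootVec b) (fun i => b (.inr i)) (fun i => D.lamRep lam (D.E i))
      (fun i => D.lamRep lam (D.F i)) :=
  isAdjointAction_rootVec hb.E_X hb.E_X_neg hb.E_X_zero hb.E_t hb.F_X hb.F_X_pos hb.F_X_zero hb.F_t

theorem unique (hD : D.IsIrreducible) {θ : I → ℤ} (hθ : D.IsTop θ)
    {b b' : Module.Basis (D.R ⊕ I) Kv (D.Lam (D.emb θ))} (hb : D.IsStandardBasis (D.emb θ) b)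
    (hb' : D.IsStandardBasis (D.emb θ) b') : b = b' := by
  obtain ⟨hX, ht⟩ := hb.isAdjointAction.eq_of_top_eq hb'.isAdjointAction hD hθ (by
    rw [rootVec_of_isRt _ hθ.1, rootVec_of_isRt _ hθ.1, hb.highest, hb'.highest])
  refine Module.Basis.eq_of_apply_eq ?_
  rintro (α | i)
  · obtain ⟨x, -, hx⟩ := (D.mem_R_iff_exists α.1).1 α.2
    rw [← rootVec_eq b hx, ← rootVec_eq b' hx, hX]
  · exact congrFun ht i

theorem divE_smul (i : I) (k : ℕ) (m : D.Lam lam) :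
    D.divE i k • m = (qfact (D.vi i) k)⁻¹ • (D.lamRep lam (D.E i) ^ k) m := by
  rw [divE, smul_assoc, ← map_pow, lamRep_apply]

theorem divF_smul (i : I) (k : ℕ) (m : D.Lam lam) :
    D.divF i k • m = (qfact (D.vi i) k)⁻¹ • (D.lamRep lam (D.F i) ^ k) m := by
  rw [divF, smul_assoc, ← map_pow, lamRep_apply]

theorem divE_X (hb : D.IsStandardBasis lam b) (i : I) (k : ℕ) (α : D.R) (hα : α ≠ D.negRt i) :
    (∀ hk : k ≤ D.p i α,
      D.divE i k • b (.inl α) = qbinom (D.vi i) (D.q i α) k • b (.inl (D.up i α k hk))) ∧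
    (D.p i α < k → D.divE i k • b (.inl α) = 0) := by
  rcases α with ⟨α, hα'⟩
  obtain ⟨x, hx, rfl⟩ := (D.mem_R_iff_exists α).1 hα'
  have hne : x ≠ -eps i := by
    rintro rfl
    have h : D.emb (-eps i) = -D.simpleRoot i := by rw [map_neg, emb_eps]
    exact hα (Subtype.ext h)
  have h := hb.isAdjointAction.div_X hx hne k
  rw [rootVec_of_isRt b hx, ← divE_smul] at h
  refine ⟨fun hk => ?_, fun hk => ?_⟩
  · rw [h]
    congr 1
    exact rootVec_eq b (emb_add_nsmul i x k).symm
  · rw [h, rootVec_of_not_isRt b (hx.not_add_of_p_lt hne hk), smul_zero]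

theorem divF_X (hb : D.IsStandardBasis lam b) (i : I) (k : ℕ) (α : D.R) (hα : α ≠ D.posRt i) :
    (∀ hk : k ≤ D.q i α,
      D.divF i k • b (.inl α) = qbinom (D.vi i) (D.p i α) k • b (.inl (D.down i α k hk))) ∧
    (D.q i α < k → D.divF i k • b (.inl α) = 0) := by
  rcases α with ⟨α, hα'⟩
  obtain ⟨x, hx, rfl⟩ := (D.mem_R_iff_exists α).1 hα'
  have hne : -x ≠ -eps i := by
    intro h
    obtain rfl := neg_injective h
    exact hα (Subtype.ext (D.emb_eps i))
  have h := hb.isAdjointAction.symm.div_X hx.neg hne k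
  rw [neg_neg, rootVec_of_isRt b hx, ← divF_smul, ← p_emb,
    show -(-x + (k : ℤ) • eps i) = x - (k : ℤ) • eps i by module] at h
  refine ⟨fun hk => ?_, fun hk => ?_⟩
  · rw [h]
    congr 1
    exact rootVec_eq b (emb_sub_nsmul i x k).symm
  · rw [h, rootVec_of_not_isRt b, smul_zero]
    rw [← isRt_neg_iff, show -(x - (k : ℤ) • eps i) = -x + (k : ℤ) • eps i by module]
    refine hx.neg.not_add_of_p_lt hne ?_
    rwa [← q_emb]

theorem divE_two_neg (hb : D.IsStandardBasis lam b) (i : I) :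
    D.divE i 2 • b (.inl (D.negRt i)) = b (.inl (D.posRt i)) := by
  rw [divE_smul, ← rootVec_neg_eps b, ← rootVec_eps b]
  exact hb.isAdjointAction.div_two_neg i

theorem divF_two_pos (hb : D.IsStandardBasis lam b) (i : I) :
    D.divF i 2 • b (.inl (D.posRt i)) = b (.inl (D.negRt i)) := by
  have h := hb.isAdjointAction.symm.div_two_neg i
  rwa [neg_neg, rootVec_eps, rootVec_neg_eps, ← divF_smul] at h

theorem divE_neg (hb : D.IsStandardBasis lam b) (i : I) {k : ℕ} (hk : 3 ≤ k) :
    D.divE i k • b (.inl (D.negRt i)) = 0 := by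
  rw [divE_smul, ← rootVec_neg_eps b]
  exact (congrArg _ (hb.isAdjointAction.e_pow_neg i hk)).trans (smul_zero _)

theorem divF_pos (hb : D.IsStandardBasis lam b) (i : I) {k : ℕ} (hk : 3 ≤ k) :
    D.divF i k • b (.inl (D.posRt i)) = 0 := by
  have h := hb.isAdjointAction.symm.e_pow_neg i hk
  rw [neg_neg, rootVec_eps] at h
  rw [divF_smul, h, smul_zero]

theorem divE_t (hb : D.IsStandardBasis lam b) (i j : I) {k : ℕ} (hk : 2 ≤ k) :
    D.divE i k • b (.inr j) = 0 := by
  rw [divE_smul]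
  exact (congrArg _ (hb.isAdjointAction.e_pow_t i j hk)).trans (smul_zero _)

theorem divF_t (hb : D.IsStandardBasis lam b) (i j : I) {k : ℕ} (hk : 2 ≤ k) :
    D.divF i k • b (.inr j) = 0 := by
  rw [divF_smul]
  exact (congrArg _ (hb.isAdjointAction.symm.e_pow_t i j hk)).trans (smul_zero _)

theorem divE_one (i : I) : D.divE i 1 = D.E i := by
  rw [divE, (D.isGeneric_vi i).qfact_one, inv_one, one_smul, pow_one]

theorem divF_one (i : I) : D.divF i 1 = D.F i := by
  rw [divF, (D.isGeneric_vi i).qfact_one, inv_one, one_smul, pow_one]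

/-- Each column of the matrix has at most one nonzero entry, which is `1`, a quantum integer or a
quantum binomial. -/
theorem divE_monomial (hb : D.IsStandardBasis lam b) (i : I) {k : ℕ} (hk : 1 ≤ k) (s : D.R ⊕ I) :
    ∃ c ∈ natLaurent, ∃ r, D.divE i k • b s = c • b r := by
  have zero : ∀ {m : D.Lam lam}, m = 0 → ∃ c ∈ natLaurent, ∃ r, m = c • b r := fun h =>
    ⟨0, zero_mem _, s, by rw [h, zero_smul]⟩
  rcases s with α | j
  · by_cases hα : α = D.negRt i
    · subst hα
      rcases (by omega : k = 1 ∨ k = 2 ∨ 3 ≤ k) with rfl | rfl | hk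
      · exact ⟨1, one_mem _, .inr i, by rw [divE_one, one_smul, hb.E_X_neg]⟩
      · exact ⟨1, one_mem _, _, by rw [one_smul, hb.divE_two_neg]⟩
      · exact zero (hb.divE_neg i hk)
    · rcases le_or_gt k (D.p i α) with h | h
      · exact ⟨_, qbinom_mem_natLaurent (D.d_pos i) _ _, _, (hb.divE_X i k α hα).1 h⟩
      · exact zero ((hb.divE_X i k α hα).2 h)
  · rcases hk.eq_or_lt with rfl | hk
    · rw [divE_one]
      exact ⟨_, qint_mem_natLaurent (D.d_pos j) (abs_nonneg _), _, hb.E_t i j⟩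
    · exact zero (hb.divE_t i j hk)

theorem divF_monomial (hb : D.IsStandardBasis lam b) (i : I) {k : ℕ} (hk : 1 ≤ k) (s : D.R ⊕ I) :
    ∃ c ∈ natLaurent, ∃ r, D.divF i k • b s = c • b r := by
  have zero : ∀ {m : D.Lam lam}, m = 0 → ∃ c ∈ natLaurent, ∃ r, m = c • b r := fun h =>
    ⟨0, zero_mem _, s, by rw [h, zero_smul]⟩
  rcases s with α | j
  · by_cases hα : α = D.posRt i
    · subst hα
      rcases (by omega : k = 1 ∨ k = 2 ∨ 3 ≤ k) with rfl | rfl | hk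
      · exact ⟨1, one_mem _, .inr i, by rw [divF_one, one_smul, hb.F_X_pos]⟩
      · exact ⟨1, one_mem _, _, by rw [one_smul, hb.divF_two_pos]⟩
      · exact zero (hb.divF_pos i hk)
    · rcases le_or_gt k (D.q i α) with h | h
      · exact ⟨_, qbinom_mem_natLaurent (D.d_pos i) _ _, _, (hb.divF_X i k α hα).1 h⟩
      · exact zero ((hb.divF_X i k α hα).2 h)
  · rcases hk.eq_or_lt with rfl | hk
    · rw [divF_one]
      exact ⟨_, qint_mem_natLaurent (D.d_pos j) (abs_nonneg _), _, hb.F_t i j⟩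
    · exact zero (hb.divF_t i j hk)

theorem repr_mem_natLaurent {m : D.Lam lam} (h : ∃ c ∈ natLaurent, ∃ r, m = c • b r)
    (r : D.R ⊕ I) : b.repr m r ∈ natLaurent := by
  classical
  obtain ⟨c, hc, s, rfl⟩ := h
  rw [map_smul, b.repr_self, Finsupp.smul_apply, Finsupp.single_apply, smul_eq_mul]
  split_ifs
  · rwa [mul_one]
  · rw [mul_zero]; exact zero_mem _

end IsStandardBasis

end CartanDatum

end QuantumAdjoint

end

theorem mainTheorem2 {I : Type*} [Fintype I] [DecidableEq I]
    (D : QuantumAdjoint.CartanDatum I) (hD : D.IsIrreducible) :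
    (∃! α₀ : D.Wt, D.IsHighestRoot α₀) ∧
    ∀ α₀ : D.Wt, D.IsHighestRoot α₀ →
      (∃! b : Module.Basis (D.R ⊕ I) QuantumAdjoint.Kv (D.Lam α₀), D.IsStandardBasis α₀ b) ∧
      ∀ b : Module.Basis (D.R ⊕ I) QuantumAdjoint.Kv (D.Lam α₀), D.IsStandardBasis α₀ b →
        ∀ i : I,
          -- the action of the divided powers of `E i`
          (∀ (k : ℕ) (α : D.R), 1 ≤ k → α ≠ D.negRt i →
            (∀ hk : k ≤ D.p i α,
              D.divE i k • b (.inl α) =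
                QuantumAdjoint.qbinom (D.vi i) (D.q i α) k • b (.inl (D.up i α k hk))) ∧
            (D.p i α < k → D.divE i k • b (.inl α) = 0)) ∧
          D.E i • b (.inl (D.negRt i)) = b (.inr i) ∧
          D.divE i 2 • b (.inl (D.negRt i)) = b (.inl (D.posRt i)) ∧
          (∀ k : ℕ, 3 ≤ k → D.divE i k • b (.inl (D.negRt i)) = 0) ∧
          (∀ j : I,
            D.E i • b (.inr j) =
              QuantumAdjoint.qint (D.vi j) |D.cartan j i| • b (.inl (D.posRt i))) ∧
          (∀ (j : I) (k : ℕ), 2 ≤ k → D.divE i k • b (.inr j) = 0) ∧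
          -- the action of the divided powers of `F i`
          (∀ (k : ℕ) (α : D.R), 1 ≤ k → α ≠ D.posRt i →
            (∀ hk : k ≤ D.q i α,
              D.divF i k • b (.inl α) =
                QuantumAdjoint.qbinom (D.vi i) (D.p i α) k • b (.inl (D.down i α k hk))) ∧
            (D.q i α < k → D.divF i k • b (.inl α) = 0)) ∧
          D.F i • b (.inl (D.posRt i)) = b (.inr i) ∧
          D.divF i 2 • b (.inl (D.posRt i)) = b (.inl (D.negRt i)) ∧
          (∀ k : ℕ, 3 ≤ k → D.divF i k • b (.inl (D.posRt i)) = 0) ∧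
          (∀ j : I,
            D.F i • b (.inr j) =
              QuantumAdjoint.qint (D.vi j) |D.cartan j i| • b (.inl (D.negRt i))) ∧
          (∀ (j : I) (k : ℕ), 2 ≤ k → D.divF i k • b (.inr j) = 0) ∧
          -- positivity of all matrix entries
          (∀ (k : ℕ) (r s : D.R ⊕ I), 1 ≤ k →
            b.repr (D.divE i k • b s) r ∈ QuantumAdjoint.natLaurent ∧
            b.repr (D.divF i k • b s) r ∈ QuantumAdjoint.natLaurent) := by
  refine ⟨QuantumAdjoint.CartanDatum.existsUnique_isHighestRoot hD, fun α₀ hα₀ => ?_⟩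
  obtain ⟨θ, hθ, rfl⟩ := hα₀.exists_isTop
  refine ⟨?_, fun b hb i => ⟨fun k α _ hα => hb.divE_X i k α hα, hb.E_X_neg i, hb.divE_two_neg i,
    fun k hk => hb.divE_neg i hk, hb.E_t i, fun j k hk => hb.divE_t i j hk,
    fun k α _ hα => hb.divF_X i k α hα, hb.F_X_pos i, hb.divF_two_pos i,
    fun k hk => hb.divF_pos i hk, hb.F_t i, fun j k hk => hb.divF_t i j hk,
    fun k r s hk => ⟨?_, ?_⟩⟩⟩
  · obtain ⟨b, hb⟩ := QuantumAdjoint.CartanDatum.exists_isStandardBasis hD hθ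
    exact ⟨b, hb, fun b' hb' => hb'.unique hD hθ hb⟩
  · exact QuantumAdjoint.CartanDatum.IsStandardBasis.repr_mem_natLaurent
      (hb.divE_monomial i hk s) r
  · exact QuantumAdjoint.CartanDatum.IsStandardBasis.repr_mem_natLaurent
      (hb.divF_monomial i hk s) r
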